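/- **Notation.** Write $W(x)=e^{i\arccos(x)\sigma_x}$ for $x\in[-1,1]$. A single-qubit unitary is *embeddable* if it is $e^{i\theta\sigma_x}$ with $\theta\in[0,\pi]$, and *twisted embeddable* if it is $e^{i\varphi\sigma_z/2}e^{i\theta\sigma_x}e^{-i\varphi\sigma_z/2}$ with $\theta\in[0,\pi]$, $\varphi\in[-\pi,\pi]$. An *$(a,b)$ gadget* $\mathfrak G$ maps $a$ embeddable oracles to $b$ twisted embeddable unitaries $\mathfrak G[U_0,\dots,U_{a-1}]_k$; it *achieves* $F=(f_0,\dots,f_{b-1})$ over $[-1,1]^a$ if $f_k(x)=\langle 0|\mathfrak G[W(x_0),\dots,W(x_{a-1})]_k|0\rangle$. An *atomic $(c,d)$ gadget* $(\Xi,S)$ is a list of $d$ M-QSP protocols $(\Phi_k,s_k)$, $\Phi_k=(\phi_0,\dots,\phi_{n})\in\mathbb R^{n+1}$, $s_k\in\{0,\dots,c-1\}^{n}$ (with $n=n_k$), with outputs $\Phi_k[U_0,\dots,U_{c-1}]=e^{i\phi_0\sigma_z}\prod_{j=1}^{n}U_{s_{k,j}}e^{i\phi_j\sigma_z}$; it is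 *antisymmetric* if every $\Phi_k$ is fixed by reversal composed with negation and every $s_k$ is fixed by reversal. $|\Xi|_\infty$ is the maximal length $n_k+1$ of the lists in $\Xi$. An *interlink* $\mathfrak I=(B,C,W)$ consists of ordered sublists $B\subseteq\{0,\dots,b-1\}$, $C\subseteq\{0,\dots,c-1\}$ of the same size $e$ and a permutation $W\in S_e$. For $F:\mathbb R^a\to\mathbb R^b$ and $G=(g_0,\dots,g_{d-1}):\mathbb R^c\to\mathbb R^d$, the *partial composition* $H=G\circ_{\mathfrak I}F$ is the list of functions of $x\in\mathbb R^a$ and $y'=(y_k)_{k\notin C}$ that consists of $g_k(z)$, $k<d$, followed by $f_k(x)$, $k\notin B$; here $z_{C_i}=f_{B_{W(i)}}(x)$ for $i<e$, and $z_k=y_k$ for $k\notin C$. **Correction procedures.** There are three access modes, with parameters $\varepsilon,\delta,\gamma\in(0,1]$. For each we list the ancilla number, the cost $\zeta$, the success probability $p$, and the condition on the unitary $e^{i\varphi\sigma_z/2}e^{i\theta\sigma_x}e^{-i\varphi\sigma_z/2}$ to be corrected, $\theta\in[0,\pi]$. 1. Controlled queries allowed: 1 ancilla, $\zeta(\varepsilon)=\delta^{-1}\log\frac{2}{\varepsilon\delta}$,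 $p=(1-\varepsilon)^2$; $\varphi\in[-\pi,\pi]$, $\cos\theta\in[-1+\delta,1-\delta]$. 2. Uncontrolled queries only: 2 ancillas, $\zeta(\varepsilon)=\delta^{-1}\log\frac{2}{\varepsilon\delta}$, $p=(1-\varepsilon)^2$; $\varphi\in[-\pi,\pi]$, $\cos\theta\in[\delta,1-\delta]$. 3. Uncontrolled queries only: no ancilla, $\zeta(\varepsilon)=\delta^{-1}\gamma^{-2}\log^2\frac{2}{\varepsilon\delta\gamma}$, $p=1$; $\varphi\in[-\pi/2,\pi/2]$, $\cos\theta\in[-1+\delta,1-\delta]$, $\cos\varphi\in[\gamma,\sqrt{1-\gamma^2}]$. **Theorem.** There is an absolute constant $K>0$ such that the following holds for every access mode, every antisymmetric atomic $(c,d)$ gadget $(\Xi,S)$, every interlink $\mathfrak I=(B,C,W)$ from $b$ to $c$ legs, and all $\varepsilon,\delta,\gamma\in(0,1]$. There are $d$ circuits, one for each output leg of $(\Xi,S)$, each acting on a target qubit and the ancillas of the mode, and built from one-qubit gates, controlled one-qubit gates, controlled swaps, queries to black boxes $V_j$, $j\in B$ (controlled only in mode 1), and uncontrolled queries to oracles $U_k$,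 $k\notin C$. These circuits depend only on the mode, $(\Xi,S)$, $\mathfrak I$, $\varepsilon,\delta,\gamma$. The number of queries to the $V_j$, summed over the $d$ circuits, and also the total number of elementary gates and queries of all kinds, is at most $$K\cdot d\,|\Xi|_\infty\,\zeta\!\left(\varepsilon/|\Xi|_\infty\right)=\widetilde O(d\,|\Xi|_\infty\,\zeta).$$ For every $a$ and every $(a,b)$ gadget $\mathfrak G$, let $\mathfrak G'$ be the composite with $a+c-e$ input legs and $b+d-e$ output legs that runs these circuits with the outputs $V_j=\mathfrak G[\,\cdot\,]_j$, $j\in B$, and passes on each output $k\notin B$ of $\mathfrak G$ unchanged (one further call each). In each circuit the ancillas start in $|0\rangle$ and are measured in the computational basis at the end; the run succeeds if all outcomes are $0$. In mode 3, $\mathfrak G'$ is an $(a+c-e,\,b+d-e)$ gadget. Moreover, in every mode, if $\mathfrak G$ achieves $F$ over $[-1,1]^a$ and $(\Xi,S)$ achieves $G$ over $[-1,1]^c$, then $\mathfrak G'$ $\varepsilon$-approximately achieves $H=G\circ_{\mathfrak I}F$ on the domain $\mathcal D$ of all $x\in[-1,1]^a$, $y'\in[-1,1]^{c-e}$ for which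 each $\mathfrak G[W(x_0),\dots,W(x_{a-1})]_j$, $j\in B$, satisfies the condition of the mode (in modes 1 and 2 this says $f_j(x)\in[-1+\delta,1-\delta]$, respectively $f_j(x)\in[\delta,1-\delta]$). That is, for $(x,y')\in\mathcal D$ and each output leg, with $h$ the corresponding component of $H(x,y')$ and $T$ the (unnormalized) operator on the target upon success, $|\langle 0|T|0\rangle-h|\le\varepsilon$; and there is a twisted embeddable unitary $V$ with $\langle0|V|0\rangle=h$ and $\|T-V\|\le\varepsilon$, such that on every unit vector $\psi$ the run succeeds with probability $\|T\psi\|^2\ge p$ and then leaves a state within $\varepsilon$ of $V\psi$. -/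

import Mathlib

noncomputable section

namespace QGadget

/-! ## Single-qubit unitaries -/

/-- Operators on one qubit, in the computational basis `|0⟩, |1⟩`. -/
abbrev Mat2 : Type := Matrix (Fin 2) (Fin 2) ℂ

/-- `exp(i θ σ_x) = cos θ + i sin θ σ_x`. -/
def rotX (θ : ℝ) : Mat2 :=
  !![(Real.cos θ : ℂ), Complex.I * (Real.sin θ : ℂ);
     Complex.I * (Real.sin θ : ℂ), (Real.cos θ : ℂ)]

/-- `exp(i φ σ_z)`. -/
def rotZ (φ : ℝ) : Mat2 :=
  !![Complex.exp (Complex.I * (φ : ℂ)), 0; 0, Complex.exp (-(Complex.I * (φ : ℂ)))]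

/-- The oracle `exp(i arccos(x) σ_x)` that encodes the scalar `x ∈ [-1, 1]`. -/
def signal (x : ℝ) : Mat2 := rotX (Real.arccos x)

/-- `exp(i φ σ_z / 2) exp(i θ σ_x) exp(-i φ σ_z / 2)`. -/
def twist (φ θ : ℝ) : Mat2 := rotZ (φ / 2) * rotX θ * rotZ (-(φ / 2))

/-- Embeddable unitaries. -/
def IsEmbeddable (U : Mat2) : Prop := ∃ θ ∈ Set.Icc 0 Real.pi, U = rotX θ

/-- Twisted embeddable unitaries. -/
def IsTwistedEmbeddable (U : Mat2) : Prop :=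
  ∃ θ ∈ Set.Icc 0 Real.pi, ∃ φ ∈ Set.Icc (-Real.pi) Real.pi, U = twist φ θ

/-- Operators on one qubit acting on `ℂ²` with its Euclidean norm. -/
def act (K : Mat2) : EuclideanSpace ℂ (Fin 2) →L[ℂ] EuclideanSpace ℂ (Fin 2) :=
  Matrix.toEuclideanCLM (n := Fin 2) (𝕜 := ℂ) K

/-- Distance in operator (spectral) norm. -/
def opDist (K V : Mat2) : ℝ := ‖act (K - V)‖

/-! ## Gadgets -/

/-- A gadget with input legs `ι` and output legs `κ`; an `(a, b)` gadget is a
`Gadget (Fin a) (Fin b)`. It sends embeddable oracles to twisted embeddable unitaries; its values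
on other inputs are irrelevant. -/
structure Gadget (ι κ : Type) where
  toFun : (ι → Mat2) → κ → Mat2
  twisted : ∀ U : ι → Mat2, (∀ i, IsEmbeddable (U i)) → ∀ k, IsTwistedEmbeddable (toFun U k)

/-- The superoperator `T` achieves `F` over `[-1, 1]^ι`: the top-left matrix element of its `k`-th
output, on the oracles encoding `x`, is `F x k`. -/
def Achieves {ι κ : Type} (T : (ι → Mat2) → κ → Mat2) (F : (ι → ℝ) → κ → ℝ) : Prop :=
  ∀ x : ι → ℝ, (∀ i, x i ∈ Set.Icc (-1 : ℝ) 1) →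
    ∀ k, T (fun i => signal (x i)) k 0 0 = (F x k : ℂ)

/-- A `t`-variable M-QSP protocol `(Φ, s)`, with `Φ ∈ ℝ^{n+1}` and `s ∈ [t]^n`. -/
structure MQSP (t : ℕ) where
  n : ℕ
  phase : Fin (n + 1) → ℝ
  label : Fin n → Fin t

namespace MQSP

variable {t : ℕ}

/-- `Φ[U_0, …, U_{t-1}] = e^{i φ_0 σ_z} ∏_{k=1}^{n} U_{s_k} e^{i φ_k σ_z}`. -/
def eval (Φ : MQSP t) (U : Fin t → Mat2) : Mat2 :=
  rotZ (Φ.phase 0) *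
    (List.ofFn fun k : Fin Φ.n => U (Φ.label k) * rotZ (Φ.phase k.succ)).prod

/-- Reversing and negating the phases fixes them, and reversing the labels fixes them. -/
def IsAntisymmetric (Φ : MQSP t) : Prop :=
  (∀ k, -Φ.phase k.rev = Φ.phase k) ∧ ∀ k, Φ.label k.rev = Φ.label k

/-- The length of the list of phases. -/
def length (Φ : MQSP t) : ℕ := Φ.n + 1

end MQSP

/-- An atomic `(c, d)` gadget `(Ξ, S)`: a list of `d` M-QSP protocols in `c` oracles. -/
abbrev AtomicGadget (c d : ℕ) : Type := Fin d → MQSP c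

namespace AtomicGadget

variable {c d : ℕ}

/-- The outputs of an atomic gadget. -/
def toFun (A : AtomicGadget c d) (U : Fin c → Mat2) (k : Fin d) : Mat2 := (A k).eval U

/-- All protocols of the gadget are antisymmetric. -/
def IsAntisymmetric (A : AtomicGadget c d) : Prop := ∀ k, (A k).IsAntisymmetric

/-- `|Ξ|_∞`, the maximal length of the lists in `Ξ`. -/
def maxLength (A : AtomicGadget c d) : ℕ := Finset.univ.sup fun k => (A k).length

end AtomicGadget

/-! ## Interlinks and partial composition -/

/-- An interlink `(B, C, W)` from a gadget with `b` outputs to a gadget with `c` inputs: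
`B` and `C` are ordered sublists of `[b]` and `[c]` of the same size `e`, and `W ∈ S_e`. -/
structure Interlink (b c : ℕ) where
  e : ℕ
  B : Fin e ↪o Fin b
  C : Fin e ↪o Fin c
  W : Equiv.Perm (Fin e)

namespace Interlink

variable {b c : ℕ} (I : Interlink b c)

/-- The input legs of the second gadget that are not in `C`. -/
abbrev FreeIn : Type := {k : Fin c // ¬ ∃ i, I.C i = k}

/-- The output legs of the first gadget that are not in `B`. -/
abbrev FreeOut : Type := {k : Fin b // ¬ ∃ i, I.B i = k}

/-- The inputs of the second gadget: the `i`-th leg of `C` receives the output of the `W(i)`-th leg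
of `B`, and every other leg receives its own input. -/
def plug (f : Fin b → ℝ) (y : I.FreeIn → ℝ) (k : Fin c) : ℝ :=
  open Classical in
  if h : ∃ i, I.C i = k then f (I.B (I.W h.choose)) else y ⟨k, h⟩

/-- The partial composition `H = G ∘_I F`, in the variables `x` and `y'`. Its components are the
`g_k`, followed by the `f_k` with `k ∉ B`. -/
def comp {a d : ℕ} (G : (Fin c → ℝ) → Fin d → ℝ) (F : (Fin a → ℝ) → Fin b → ℝ)
    (x : Fin a → ℝ) (y : I.FreeIn → ℝ) : Fin d ⊕ I.FreeOut → ℝ :=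
  Sum.elim (fun k => G (I.plug (F x) y) k) (fun k => F x k)

end Interlink

/-! ## Circuits that query black boxes

The register has qubits `0, …, m`: qubit `0` is the target and the others are the `m` ancillas. -/

/-- Computational basis states of the register. -/
abbrev Reg (m : ℕ) : Type := Fin (m + 1) → Fin 2

/-- Operators on the register. -/
abbrev RegMat (m : ℕ) : Type := Matrix (Reg m) (Reg m) ℂ

/-- The one-qubit operator `g` applied to qubit `q`. -/
def onQubit {m : ℕ} (q : Fin (m + 1)) (g : Mat2) : RegMat m :=
  Matrix.of fun s t => if ∀ r, r ≠ q → s r = t r then g (s q) (t q) else 0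

/-- `M` controlled on qubit `c`, where `M` does not act on `c`. -/
def controlled {m : ℕ} (c : Fin (m + 1)) (M : RegMat m) : RegMat m :=
  Matrix.of fun s t => if t c = 1 then M s t else if s = t then 1 else 0

/-- The gate that swaps the qubits `q` and `q'`. -/
def swapGate {m : ℕ} (q q' : Fin (m + 1)) : RegMat m :=
  Matrix.of fun s t => if s = t ∘ Equiv.swap q q' then 1 else 0

/-- One step of a circuit with `m` ancillas: an elementary gate, or a query. The circuit has black
boxes `V_i`, `i < e`, and `Y_k`, `k : υ`; it may query the `V_i` also in controlled form. -/
inductive Step (m e : ℕ) (υ : Type) where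
  | gate (q : Fin (m + 1)) (g : Matrix.unitaryGroup (Fin 2) ℂ)
  | cgate (c q : Fin (m + 1)) (hcq : c ≠ q) (g : Matrix.unitaryGroup (Fin 2) ℂ)
  | cswap (c q q' : Fin (m + 1)) (hcq : c ≠ q) (hcq' : c ≠ q') (hqq' : q ≠ q')
  | call (i : Fin e) (q : Fin (m + 1))
  | ccall (i : Fin e) (c q : Fin (m + 1)) (hcq : c ≠ q)
  | query (k : υ) (q : Fin (m + 1))

namespace Step

variable {m e : ℕ} {υ : Type}

/-- The operator that a step applies. -/
def mat (V : Fin e → Mat2) (Y : υ → Mat2) : Step m e υ → RegMat m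
  | gate q g => onQubit q (g : Mat2)
  | cgate c q _ g => controlled c (onQubit q (g : Mat2))
  | cswap c q q' _ _ _ => controlled c (swapGate q q')
  | call i q => onQubit q (V i)
  | ccall i c q _ => controlled c (onQubit q (V i))
  | query k q => onQubit q (Y k)

/-- Whether a step is a controlled query. -/
def isControlledCall : Step m e υ → Bool
  | ccall _ _ _ _ => true
  | _ => false

/-- Whether a step is a query to one of the `V_i`, controlled or not. -/
def isCall : Step m e υ → Bool
  | call _ _ => true
  | ccall _ _ _ _ => true
  | _ => false

end Step

/-- A circuit is a list of steps; as in a product of operators, the last step of the list is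
applied first. -/
abbrev Circuit (m e : ℕ) (υ : Type) : Type := List (Step m e υ)

namespace Circuit

variable {m e : ℕ} {υ : Type}

/-- The operator of the circuit on the whole register. -/
def mat (P : Circuit m e υ) (V : Fin e → Mat2) (Y : υ → Mat2) : RegMat m :=
  (P.map (Step.mat V Y)).prod

/-- The basis state with the target in state `j` and all ancillas in state `0`. -/
def ket (m : ℕ) (j : Fin 2) : Reg m := fun r => if r = 0 then j else 0

/-- The operator `⟨0^m| M |0^m⟩` on the target: the ancillas start in `|0^m⟩`, are measured in the
computational basis at the end, and the run succeeds when the outcome is `0^m`. On the target state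
`ψ` the run succeeds with probability `‖K ψ‖²`, and then leaves `K ψ / ‖K ψ‖`. -/
def output (P : Circuit m e υ) (V : Fin e → Mat2) (Y : υ → Mat2) : Mat2 :=
  Matrix.of fun i j => P.mat V Y (ket m i) (ket m j)

/-- The number of queries to the black boxes `V_i`. -/
def calls (P : Circuit m e υ) : ℕ := P.countP Step.isCall

/-- The number of elementary gates and queries of all kinds. -/
def size (P : Circuit m e υ) : ℕ := P.length

/-- The circuit makes no controlled query. -/
def Uncontrolled (P : Circuit m e υ) : Prop := ∀ s ∈ P, s.isControlledCall = false

end Circuit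

/-- The outputs of the composite that is given by one circuit for each output leg of the second
gadget. The black boxes of these circuits are the outputs of `𝔊` on the legs in `B`, and the
oracles on the free input legs. The output legs of `𝔊` outside `B` are passed on unchanged. -/
def compositeOutput {a b c d m : ℕ} (I : Interlink b c) (P : Fin d → Circuit m I.e I.FreeIn)
    (𝔊 : Gadget (Fin a) (Fin b)) (U : Fin a ⊕ I.FreeIn → Mat2) : Fin d ⊕ I.FreeOut → Mat2 :=
  Sum.elim
    (fun k => (P k).output (fun i => 𝔊.toFun (fun j => U (Sum.inl j)) (I.B i))
      (fun k => U (Sum.inr k)))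
    (fun k => 𝔊.toFun (fun j => U (Sum.inl j)) k)

/-- The operation with success operator `K` realizes, up to `ε` and with success probability at
least `p`, a twisted embeddable unitary with top-left matrix element `h`; in particular the
top-left matrix element of `K` is within `ε` of `h`. -/
def ApproxRealizes (ε p h : ℝ) (K : Mat2) : Prop :=
  ‖K 0 0 - (h : ℂ)‖ ≤ ε ∧
  ∃ V : Mat2, IsTwistedEmbeddable V ∧ V 0 0 = (h : ℂ) ∧ opDist K V ≤ ε ∧
    ∀ ψ : EuclideanSpace ℂ (Fin 2), ‖ψ‖ = 1 →
      p ≤ ‖act K ψ‖ ^ 2 ∧ ‖((‖act K ψ‖⁻¹ : ℝ) : ℂ) • act K ψ - act V ψ‖ ≤ ε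

/-! ## Correction procedures -/

/-- The three correction procedures: with controlled access to the unitaries to be corrected; with
ancillas but only uncontrolled access; and without ancillas. -/
inductive Correction where
  | controlledAccess
  | uncontrolledAccess
  | ancillaFree

namespace Correction

/-- The number of ancilla qubits. -/
def ancillas : Correction → ℕ
  | controlledAccess => 1
  | uncontrolledAccess => 2
  | ancillaFree => 0

/-- The cost `ζ` of correcting one unitary to precision `ε`. -/
def cost (ε δ γ : ℝ) : Correction → ℝ
  | controlledAccess => δ⁻¹ * Real.log (2 / (ε * δ))
  | uncontrolledAccess => δ⁻¹ * Real.log (2 / (ε * δ))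
  | ancillaFree => δ⁻¹ * (γ ^ 2)⁻¹ * Real.log (2 / (ε * δ * γ)) ^ 2

/-- The guaranteed success probability. -/
def successProb (ε : ℝ) : Correction → ℝ
  | controlledAccess => (1 - ε) ^ 2
  | uncontrolledAccess => (1 - ε) ^ 2
  | ancillaFree => 1

/-- The domain of the procedure: the twisted embeddable unitaries that it has to correct. -/
def Domain (δ γ : ℝ) (V : Mat2) : Correction → Prop
  | controlledAccess =>
      ∃ θ ∈ Set.Icc 0 Real.pi, ∃ φ ∈ Set.Icc (-Real.pi) Real.pi, V = twist φ θ ∧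
        Real.cos θ ∈ Set.Icc (-1 + δ) (1 - δ)
  | uncontrolledAccess =>
      ∃ θ ∈ Set.Icc 0 Real.pi, ∃ φ ∈ Set.Icc (-Real.pi) Real.pi, V = twist φ θ ∧
        Real.cos θ ∈ Set.Icc δ (1 - δ)
  | ancillaFree =>
      ∃ θ ∈ Set.Icc 0 Real.pi, ∃ φ ∈ Set.Icc (-(Real.pi / 2)) (Real.pi / 2), V = twist φ θ ∧
        Real.cos θ ∈ Set.Icc (-1 + δ) (1 - δ) ∧
        Real.cos φ ∈ Set.Icc γ (Real.sqrt (1 - γ ^ 2))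

end Correction

end QGadget

end

noncomputable section

namespace QGadget

open Polynomial
open scoped Matrix.Norms.L2Operator

/-! ## Quaternionic matrices and alternating sequences -/

/-! The gadget `A` keeps its promise about `G` only on inputs `e^{iθσ_x}`, whereas the outputs of
`𝔊` carry an unknown twist: they are `U = e^{iασ_z/2} e^{iθσ_x} e^{-iασ_z/2}`. So everything reduces
to one task (`exists_corrector`): from queries to `U` build a circuit close to `e^{iθσ_x}`.
Substituting this circuit for each oracle of a protocol adds up errors linearly, so correction to
precision `ε / |Ξ|_∞` suffices.

The twist is removed with the help of `U` itself. The off-diagonal entries of `U` are `i sin θ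
e^{±iα}`. Rotations about `z` commute with the twist, so a signal-processing sequence in `U` is the
twisted sequence in `e^{iθσ_x}` (`seq_conj`). If it amplifies `sin θ` to `1`, the result is nearly
antidiagonal with phases `e^{±iα}`, and a bit flip turns it into a rotation about `z` by the unknown
angle.

With ancillas, this rotation acts on `|0⟩` of an ancilla, controlled by the target. Phase kickback
gives `diag(1, e^{iα})` on the target, and a second run on the other side gives the conjugate phase
(`sim_corrected`). If the queries cannot be controlled, only the phases are controlled. In the idle
branch they make pairs of queries cancel, since `σ_z U σ_z = U†`. This needs an even number of
queries, hence an extra odd factor that approximates the sign of `cos θ`; this is why `cos θ ≥ δ` is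
required there.

Without ancillas, `e^{-iασ_z}` is moved to the `x` axis and fed to a second sequence that halves the
angle. The resulting `M ≈ e^{-iασ_z/2}` gives `M U M'`, where `M'` is the image of `M` under `X ↦
σ_z X† σ_z`. Since `U` is fixed by this anti-automorphism, `M'` is `M` read backwards and needs no
inverse queries. The fixed points of determinant one in the unitary group are exactly the twisted
embeddable unitaries. Hence palindromic products, among them antisymmetric protocols, stay exactly
twisted embeddable.

The sequences come from polynomials. A pair with `PP̄ + (1 - x²)QQ̄ = 1` and the right parities is
realized by stripping off one rotation at a time (`exists_phases`). A real pair with `p² + (1 -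
x²)q² ≤ 1` is completed by imaginary parts, because a polynomial positive on `[0, 1]` has the form
`p² + (1 - x²)q²` in `y = x²` (`hasSquares_of_pos`). The required approximations are explicit
truncated series, whose errors are controlled by differential equations that the truncations satisfy
up to one term. -/

/-- The matrix `[[α, iβ], [iβ̄, ᾱ]]`. -/
def quat (α β : ℂ) : Mat2 :=
  !![α, Complex.I * β; Complex.I * starRingEnd ℂ β, starRingEnd ℂ α]

lemma quat_mul (α β α' β' : ℂ) :
    quat α β * quat α' β' =
      quat (α * α' - β * starRingEnd ℂ β') (α * β' + β * starRingEnd ℂ α') := by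
  ext i j
  fin_cases i <;> fin_cases j <;>
    simp [quat, Matrix.mul_apply, Fin.sum_univ_two] <;> ring_nf <;> simp <;> ring

lemma quat_sub (α β α' β' : ℂ) : quat α β - quat α' β' = quat (α - α') (β - β') := by
  ext i j
  fin_cases i <;> fin_cases j <;> simp [quat] <;> ring

lemma quat_conjTranspose (α β : ℂ) :
    (quat α β).conjTranspose = quat (starRingEnd ℂ α) (-β) := by
  ext i j
  fin_cases i <;> fin_cases j <;> simp [quat, Matrix.conjTranspose_apply]

lemma quat_conjTranspose_mul_self (α β : ℂ) :
    (quat α β).conjTranspose * quat α β =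
      ((Complex.normSq α + Complex.normSq β : ℝ) : ℂ) • (1 : Mat2) := by
  rw [quat_conjTranspose, quat_mul]
  ext i j
  fin_cases i <;> fin_cases j <;>
    simp [quat, Complex.normSq_eq_conj_mul_self] <;> ring

lemma norm_quat_sq (α β : ℂ) : ‖quat α β‖ ^ 2 = Complex.normSq α + Complex.normSq β := by
  rw [sq, ← Matrix.l2_opNorm_conjTranspose_mul_self, quat_conjTranspose_mul_self, norm_smul,
    CStarRing.norm_one, mul_one, Complex.norm_real, Real.norm_of_nonneg]
  exact add_nonneg (Complex.normSq_nonneg _) (Complex.normSq_nonneg _)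

lemma quat_mem_unitaryGroup {α β : ℂ} (h : Complex.normSq α + Complex.normSq β = 1) :
    quat α β ∈ Matrix.unitaryGroup (Fin 2) ℂ := by
  rw [Matrix.mem_unitaryGroup_iff', Matrix.star_eq_conjTranspose, quat_conjTranspose_mul_self, h]
  simp

lemma conj_exp_I_mul (x : ℝ) :
    starRingEnd ℂ (Complex.exp (Complex.I * x)) = Complex.exp (-(Complex.I * x)) := by
  rw [← Complex.exp_conj]; simp

lemma rotZ_eq_quat (x : ℝ) : rotZ x = quat (Complex.exp (Complex.I * x)) 0 := by
  simp [rotZ, quat, conj_exp_I_mul]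

lemma rotX_eq_quat (x : ℝ) : rotX x = quat (Real.cos x) (Real.sin x) := by
  simp only [rotX, quat, Complex.conj_ofReal]

lemma rotX_mem (x : ℝ) : rotX x ∈ Matrix.unitaryGroup (Fin 2) ℂ := by
  rw [rotX_eq_quat]
  apply quat_mem_unitaryGroup
  rw [Complex.normSq_ofReal, Complex.normSq_ofReal]
  nlinarith [Real.sin_sq_add_cos_sq x]

lemma normSq_exp_I_mul (x : ℝ) : Complex.normSq (Complex.exp (Complex.I * x)) = 1 := by
  rw [Complex.normSq_eq_norm_sq, mul_comm, Complex.norm_exp_ofReal_mul_I, one_pow]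

lemma rotZ_mem (x : ℝ) : rotZ x ∈ Matrix.unitaryGroup (Fin 2) ℂ := by
  rw [rotZ_eq_quat]
  apply quat_mem_unitaryGroup
  rw [normSq_exp_I_mul]; simp

lemma rotZ_mul (x y : ℝ) : rotZ x * rotZ y = rotZ (x + y) := by
  rw [rotZ_eq_quat, rotZ_eq_quat, rotZ_eq_quat, quat_mul]
  simp [mul_add, Complex.exp_add]

lemma rotZ_zero : rotZ 0 = 1 := by
  ext i j; fin_cases i <;> fin_cases j <;> simp [rotZ]

lemma twist_eq_quat (φ θ : ℝ) :
    twist φ θ = quat (Real.cos θ) (Real.sin θ * Complex.exp (Complex.I * φ)) := by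
  rw [twist, rotZ_eq_quat, rotX_eq_quat, rotZ_eq_quat, quat_mul, quat_mul]
  have h : Complex.exp (Complex.I * φ) =
      Complex.exp (Complex.I * ((φ / 2 : ℝ) : ℂ)) * Complex.exp (Complex.I * ((φ / 2 : ℝ) : ℂ)) := by
    rw [← Complex.exp_add]; push_cast; congr 1; ring
  have h' : Complex.exp (Complex.I * ((φ / 2 : ℝ) : ℂ)) *
      Complex.exp (Complex.I * ((-(φ / 2) : ℝ) : ℂ)) = 1 := by
    rw [← Complex.exp_add]; simp
  have h2 : starRingEnd ℂ (Complex.exp (Complex.I * ((-(φ / 2) : ℝ) : ℂ))) =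
      Complex.exp (Complex.I * ((φ / 2 : ℝ) : ℂ)) := by
    rw [conj_exp_I_mul]; simp
  congr 1
  · simp only [Complex.conj_ofReal, map_zero, mul_zero, zero_mul, sub_zero, add_zero]
    linear_combination ((Real.cos θ : ℝ) : ℂ) * h'
  · rw [h2, h]; simp; ring

lemma twist_mem (φ θ : ℝ) : twist φ θ ∈ Matrix.unitaryGroup (Fin 2) ℂ :=
  mul_mem (mul_mem (rotZ_mem _) (rotX_mem _)) (rotZ_mem _)

lemma norm_le_one_of_mem {n : Type*} [Fintype n] [DecidableEq n] {U : Matrix n n ℂ}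
    (h : U ∈ Matrix.unitaryGroup n ℂ) : ‖U‖ ≤ 1 := by
  have h1 : ‖U‖ * ‖U‖ = ‖(1 : Matrix n n ℂ)‖ := by
    rw [← Matrix.l2_opNorm_conjTranspose_mul_self, ← Matrix.star_eq_conjTranspose,
      Matrix.mem_unitaryGroup_iff'.1 h]
  rcases isEmpty_or_nonempty n with hn | hn
  · have : U = 0 := Subsingleton.elim _ _
    rw [this, norm_zero]; exact zero_le_one
  · rw [CStarRing.norm_one] at h1
    nlinarith [norm_nonneg U]

/-- `a 0 * u * a 1 * u * ⋯ * u * a n`. -/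
def alt {M : Type*} [Mul M] (a : ℕ → M) (u : M) : ℕ → M
  | 0 => a 0
  | n + 1 => alt a u n * u * a (n + 1)

/-- `e^{iφ₀σ_z} U e^{iφ₁σ_z} U ⋯ U e^{iφₙσ_z}`. -/
def seq (φ : ℕ → ℝ) (U : Mat2) (n : ℕ) : Mat2 := alt (fun k => rotZ (φ k)) U n

lemma alt_congr {M : Type*} [Mul M] {a b : ℕ → M} {u : M} {n : ℕ} (h : ∀ k ≤ n, a k = b k) :
    alt a u n = alt b u n := by
  induction n with
  | zero => simp [alt, h 0 le_rfl]
  | succ n ih => rw [alt, alt, ih (fun k hk => h k (by omega)), h (n + 1) le_rfl]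

/-! ## Layer stripping -/

/-- Polynomials of degree at most `n` with the parity of `n`. -/
def Par {R : Type*} [Semiring R] (n : ℕ) (p : R[X]) : Prop :=
  ∀ k, p.coeff k ≠ 0 → ∃ j, k + 2 * j = n

/-- Polynomials of degree at most `n - 1` with the parity of `n - 1`. -/
def ParQ {R : Type*} [Semiring R] (n : ℕ) (q : R[X]) : Prop :=
  ∀ k, q.coeff k ≠ 0 → ∃ j, k + 1 + 2 * j = n

/-- The polynomial with conjugate coefficients. -/
def conjPoly (p : ℂ[X]) : ℂ[X] := p.map (starRingEnd ℂ)

lemma Par.natDegree_le {R : Type*} [Semiring R] {n : ℕ} {p : R[X]} (h : Par n p) :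
    p.natDegree ≤ n := by
  rw [natDegree_le_iff_coeff_eq_zero]
  intro k hk
  by_contra hne
  obtain ⟨j, hj⟩ := h k hne
  omega

lemma ParQ.natDegree_le {R : Type*} [Semiring R] {n : ℕ} {q : R[X]} (h : ParQ (n + 1) q) :
    q.natDegree ≤ n := by
  rw [natDegree_le_iff_coeff_eq_zero]
  intro k hk
  by_contra hne
  obtain ⟨j, hj⟩ := h k hne
  omega

lemma exists_phase (a b : ℂ) (h : Complex.normSq a = Complex.normSq b) :
    ∃ φ : ℝ, Complex.exp (-(Complex.I * φ)) * a = Complex.exp (Complex.I * φ) * b := by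
  refine ⟨(a.arg - b.arg) / 2, ?_⟩
  have hn : ‖a‖ = ‖b‖ := by
    rw [Complex.normSq_eq_norm_sq, Complex.normSq_eq_norm_sq] at h
    exact (sq_eq_sq₀ (norm_nonneg _) (norm_nonneg _)).1 h
  have ha := Complex.norm_mul_exp_arg_mul_I a
  have hb := Complex.norm_mul_exp_arg_mul_I b
  generalize a.arg = x at *
  generalize b.arg = y at *
  rw [← ha, ← hb, hn, mul_left_comm, mul_left_comm _ (‖b‖ : ℂ), ← Complex.exp_add,
    ← Complex.exp_add]
  congr 2
  push_cast
  ring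

/-- Layer stripping: multiplication by the inverse of the last layer `e^{iθσ_x} e^{iφσ_z}` preserves
the norm identity, and a suitable `φ` lowers the degree by one. -/
theorem exists_phases (n : ℕ) : ∀ (P Q : ℂ[X]), Par n P → ParQ n Q →
    P * conjPoly P + (1 - X ^ 2) * (Q * conjPoly Q) = 1 →
    ∃ φ : ℕ → ℝ, ∀ θ : ℝ, seq φ (rotX θ) n =
      quat (P.eval (Real.cos θ : ℂ)) (Real.sin θ * Q.eval (Real.cos θ : ℂ)) := by
  induction n with
  | zero =>
    intro P Q hP hQ h
    have hQ0 : Q = 0 := by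
      ext k
      by_contra hne
      obtain ⟨j, hj⟩ := hQ k hne
      omega
    have hPc : P = C (P.coeff 0) := eq_C_of_natDegree_le_zero hP.natDegree_le
    subst hQ0
    rw [hPc] at h
    simp only [conjPoly, map_C, zero_mul, mul_zero, add_zero] at h
    rw [← C_mul, ← C_1, C_inj] at h
    obtain ⟨φ, hφ⟩ := exists_phase (P.coeff 0) (starRingEnd ℂ (P.coeff 0)) (by simp)
    have h1 : ‖P.coeff 0‖ = 1 := by
      have : Complex.normSq (P.coeff 0) = 1 := by
        rw [Complex.mul_conj] at h; exact_mod_cast h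
      rw [Complex.normSq_eq_norm_sq] at this
      nlinarith [norm_nonneg (P.coeff 0)]
    refine ⟨fun _ => (P.coeff 0).arg, fun θ => ?_⟩
    rw [hPc]
    simp only [seq, alt, eval_C, eval_zero, mul_zero, rotZ_eq_quat]
    congr 1
    rw [mul_comm]
    have := Complex.norm_mul_exp_arg_mul_I (P.coeff 0)
    simpa [h1] using this
  | succ n ih =>
    intro P Q hP hQ h
    -- The coefficient of `X ^ (2n + 2)` in the norm identity is the difference of these two
    -- numbers, and it vanishes.
    have hlead : Complex.normSq (P.coeff (n + 1)) = Complex.normSq (Q.coeff n) := by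
      have hPd := hP.natDegree_le
      have hQd := hQ.natDegree_le
      have hPd' : (conjPoly P).natDegree ≤ n + 1 := (natDegree_map_le).trans hPd
      have hQd' : (conjPoly Q).natDegree ≤ n := (natDegree_map_le).trans hQd
      have e1 := coeff_mul_add_eq_of_natDegree_le hPd hPd'
      have e2 := coeff_mul_add_eq_of_natDegree_le hQd hQd'
      have e3 : (Q * conjPoly Q).coeff (n + 1 + (n + 1)) = 0 :=
        coeff_eq_zero_of_natDegree_lt (lt_of_le_of_lt natDegree_mul_le (by omega))
      have e4 := congrArg (fun p => p.coeff (n + 1 + (n + 1))) h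
      have e5 : (X ^ 2 * (Q * conjPoly Q)).coeff (n + 1 + (n + 1)) =
          (Q * conjPoly Q).coeff (n + n) := by
        rw [show n + 1 + (n + 1) = n + n + 2 by ring, coeff_X_pow_mul]
      simp only [sub_mul, one_mul, coeff_add, coeff_sub, e1, e3, e5, e2] at e4
      rw [coeff_one, if_neg (by omega)] at e4
      simp only [conjPoly, coeff_map] at e4
      rw [Complex.mul_conj, Complex.mul_conj] at e4
      have : Complex.normSq (P.coeff (n + 1)) + (0 - Complex.normSq (Q.coeff n)) = 0 := by
        exact_mod_cast e4
      linarith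
    obtain ⟨φ, hφ⟩ := exists_phase _ _ hlead
    set ω : ℂ := Complex.exp (Complex.I * φ) with hω
    set ω' : ℂ := Complex.exp (-(Complex.I * φ)) with hω'
    have hωω : ω * ω' = 1 := by rw [hω, hω', ← Complex.exp_add]; simp
    have hc : starRingEnd ℂ ω = ω' := conj_exp_I_mul φ
    have hc' : starRingEnd ℂ ω' = ω := by rw [← hc, Complex.conj_conj]
    have hCC : (C ω : ℂ[X]) * C ω' = 1 := by rw [← C_mul, hωω, C_1]
    -- `P'` and `sin θ * Q'` are the entries of `quat P (sin θ * Q)` times the inverse of `rotX θ *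
    -- rotZ φ`, with `sin² θ` written as `1 - X²`. Their degrees could be `n + 2` and `n + 1`; the
    -- equation for `φ` cancels exactly these top coefficients.
    set P' : ℂ[X] := C ω' * (X * P) + C ω * (Q - X ^ 2 * Q) with hP'
    set Q' : ℂ[X] := C ω * (X * Q) - C ω' * P with hQ'
    have hPar : Par n P' := by
      intro k hk
      by_contra hcon
      apply hk
      have a1 : (X ^ 2 * Q).coeff k = if 2 ≤ k then Q.coeff (k - 2) else 0 := by
        rw [coeff_X_pow_mul']
      have a2 : (X * P).coeff k = if 1 ≤ k then P.coeff (k - 1) else 0 := by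
        rw [← pow_one (X : ℂ[X]), coeff_X_pow_mul']
      simp only [hP', coeff_add, coeff_C_mul, coeff_sub, a1, a2]
      have b1 : Q.coeff k = 0 := by
        by_contra hne
        obtain ⟨j, hj⟩ := hQ k hne
        exact hcon ⟨j, by omega⟩
      rw [b1]
      rcases Nat.lt_or_ge k 1 with hk1 | hk1
      · simp [show ¬ 2 ≤ k by omega, show ¬ 1 ≤ k by omega]
      rw [if_pos hk1]
      by_cases hkn : k = n + 2
      · subst hkn
        simp only [show n + 2 - 1 = n + 1 by omega, show n + 2 - 2 = n by omega]
        rw [if_pos (by omega), hφ]; ring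
      · have b2 : P.coeff (k - 1) = 0 := by
          by_contra hne
          obtain ⟨j, hj⟩ := hP _ hne
          exact hcon ⟨j - 1, by omega⟩
        have b3 : (if 2 ≤ k then Q.coeff (k - 2) else 0) = 0 := by
          split_ifs with h2
          · by_contra hne
            obtain ⟨j, hj⟩ := hQ _ hne
            exact hcon ⟨j - 1, by omega⟩
          · rfl
        rw [b2, b3]; ring
    have hParQ : ParQ n Q' := by
      intro k hk
      by_contra hcon
      apply hk
      have a2 : (X * Q).coeff k = if 1 ≤ k then Q.coeff (k - 1) else 0 := by
        rw [← pow_one (X : ℂ[X]), coeff_X_pow_mul']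
      simp only [hQ', coeff_sub, coeff_C_mul, a2]
      by_cases hkn : k = n + 1
      · subst hkn
        simp only [show n + 1 - 1 = n by omega]
        rw [if_pos (by omega), hφ]; ring
      · have b2 : P.coeff k = 0 := by
          by_contra hne
          obtain ⟨j, hj⟩ := hP _ hne
          exact hcon ⟨j - 1, by omega⟩
        have b3 : (if 1 ≤ k then Q.coeff (k - 1) else 0) = 0 := by
          split_ifs with h2
          · by_contra hne
            obtain ⟨j, hj⟩ := hQ _ hne
            exact hcon ⟨j - 1, by omega⟩
          · rfl
        rw [b2, b3]; ring
    have hnorm : P' * conjPoly P' + (1 - X ^ 2) * (Q' * conjPoly Q') = 1 := by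
      have e1 : conjPoly P' = C ω * (X * conjPoly P) +
          C ω' * (conjPoly Q - X ^ 2 * conjPoly Q) := by
        simp [hP', conjPoly, hc, hc']
      have e2 : conjPoly Q' = C ω' * (X * conjPoly Q) - C ω * conjPoly P := by
        simp [hQ', conjPoly, hc, hc']
      rw [e1, e2, hP', hQ']
      linear_combination (P * conjPoly P + (1 - X ^ 2) * (Q * conjPoly Q)) * hCC + h
    obtain ⟨ψ, hψ⟩ := ih P' Q' hPar hParQ hnorm
    refine ⟨fun k => if k = n + 1 then φ else ψ k, fun θ => ?_⟩
    have hs : seq (fun k => if k = n + 1 then φ else ψ k) (rotX θ) n = seq ψ (rotX θ) n := by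
      apply alt_congr
      intro k hk
      simp only [if_neg (show k ≠ n + 1 by omega)]
    have hstep : seq (fun k => if k = n + 1 then φ else ψ k) (rotX θ) (n + 1) =
        seq (fun k => if k = n + 1 then φ else ψ k) (rotX θ) n * rotX θ * rotZ φ := by
      simp [seq, alt]
    rw [hstep, hs, hψ, rotX_eq_quat, rotZ_eq_quat, quat_mul, quat_mul]
    have hsc : (Real.sin θ : ℂ) ^ 2 + (Real.cos θ : ℂ) ^ 2 = 1 := by
      exact_mod_cast Real.sin_sq_add_cos_sq θ
    rw [← hω]
    simp only [hP', hQ', eval_add, eval_sub, eval_mul, eval_C, eval_X, eval_pow, map_zero,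
      mul_zero, sub_zero, zero_add, Complex.conj_ofReal, hc]
    generalize (Real.sin θ : ℂ) = s at *
    generalize (Real.cos θ : ℂ) = c at *
    congr 1
    · linear_combination (P.eval c * (c ^ 2 + s ^ 2)) * hωω + P.eval c * hsc
        - ω ^ 2 * c * Q.eval c * hsc
    · linear_combination (s * Q.eval c) * hωω

end QGadget
end

noncomputable section

namespace QGadget

open Polynomial
open scoped Matrix.Norms.L2Operator

/-! ### Calculus of degrees and parities. -/

section Parity

variable {R : Type*} [CommRing R] {n m : ℕ} {p q : R[X]}

lemma parQ_iff : ParQ n q ↔ Par n (X * q) := by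
  constructor
  · intro h k hk
    rw [← pow_one (X : R[X]), coeff_X_pow_mul'] at hk
    split_ifs at hk with h1
    · obtain ⟨j, hj⟩ := h _ hk
      exact ⟨j, by omega⟩
    · exact absurd rfl hk
  · intro h k hk
    exact h (k + 1) (by rwa [coeff_X_mul])

lemma Par.add (hp : Par n p) (hq : Par n q) : Par n (p + q) := by
  intro k hk
  by_cases h : p.coeff k = 0
  · exact hq k (by rwa [coeff_add, h, zero_add] at hk)
  · exact hp k h

lemma Par.neg (hp : Par n p) : Par n (-p) := fun k hk => hp k (by simpa using hk)

lemma Par.mul (hp : Par n p) (hq : Par m q) : Par (n + m) (p * q) := by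
  intro k hk
  rw [coeff_mul] at hk
  obtain ⟨x, hx, hne⟩ := Finset.exists_ne_zero_of_sum_ne_zero hk
  obtain ⟨j, hj⟩ := hp x.1 (left_ne_zero_of_mul hne)
  obtain ⟨i, hi⟩ := hq x.2 (right_ne_zero_of_mul hne)
  have hx' := Finset.HasAntidiagonal.mem_antidiagonal.1 hx
  exact ⟨j + i, by omega⟩

lemma Par.C_mul (c : R) (hp : Par n p) : Par n (C c * p) := fun k hk =>
  hp k (right_ne_zero_of_mul (by rwa [coeff_C_mul] at hk))

lemma Par.mono_two (hp : Par n p) : Par (n + 2) p := fun k hk => by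
  obtain ⟨j, hj⟩ := hp k hk
  exact ⟨j + 1, by omega⟩

lemma par_X : Par 1 (X : R[X]) := fun k hk => ⟨0, by
  rw [coeff_X] at hk
  by_contra h
  exact hk (if_neg (by omega))⟩

lemma par_one : Par 0 (1 : R[X]) := fun k hk => ⟨0, by
  rw [coeff_one] at hk
  by_contra h
  exact hk (if_neg (by omega))⟩

lemma par_zero : Par n (0 : R[X]) := fun k hk => absurd (coeff_zero k) hk

lemma Par.pow (hp : Par n p) (k : ℕ) : Par (k * n) (p ^ k) := by
  induction k with
  | zero => simpa using par_one
  | succ k ih => rw [pow_succ, add_mul, one_mul]; exact ih.mul hp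

lemma Par.mono (hp : Par n p) (j : ℕ) : Par (n + 2 * j) p := by
  induction j with
  | zero => exact hp
  | succ j ih => exact ih.mono_two

lemma Par.sum {ι : Type*} {s : Finset ι} {f : ι → R[X]} (h : ∀ i ∈ s, Par n (f i)) :
    Par n (∑ i ∈ s, f i) :=
  Finset.sum_induction f (Par n) (fun _ _ => Par.add) par_zero h

lemma Par.of_X_sq_mul (h : Par n (X ^ 2 * p)) : Par n p := fun k hk => by
  obtain ⟨j, hj⟩ := h (k + 2) (by rwa [coeff_X_pow_mul])
  exact ⟨j + 1, by omega⟩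

lemma par_one_sub_X_sq : Par 2 (1 - X ^ 2 : R[X]) := by
  rw [sub_eq_add_neg]
  exact par_one.mono_two.add (by simpa using (par_X.pow 2).neg)

lemma Par.one_sub_mul (hp : ParQ n p) (hq : ParQ m q) :
    Par (n + m) ((1 - X ^ 2) * (p * q)) := by
  have h : Par (n + m) (X ^ 2 * (p * q)) := by
    have := (parQ_iff.1 hp).mul (parQ_iff.1 hq)
    rwa [show X * p * (X * q) = X ^ 2 * (p * q) by ring] at this
  rw [sub_mul, one_mul, sub_eq_add_neg]
  exact h.of_X_sq_mul.add h.neg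

lemma Par.mul_parQ (hp : Par n p) (hq : ParQ m q) : ParQ (n + m) (p * q) := by
  rw [parQ_iff, mul_left_comm]
  exact hp.mul (parQ_iff.1 hq)

lemma ParQ.add (hp : ParQ n p) (hq : ParQ n q) : ParQ n (p + q) := by
  rw [parQ_iff, mul_add]
  exact (parQ_iff.1 hp).add (parQ_iff.1 hq)

end Parity

/-! ## Polynomials that are positive on the unit interval -/

/-- `r(x²) = p(x)² + (1 - x²) q(x)²` with the degrees and parities of a sequence of length `n`. -/
def HasSquares (n : ℕ) (r : ℝ[X]) : Prop :=
  ∃ p q : ℝ[X], Par n p ∧ ParQ n q ∧ p ^ 2 + (1 - X ^ 2) * q ^ 2 = expand ℝ 2 r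

/-- `p² + (1 - x²)q²` is the norm of `p + i√(1 - x²) q`, and norms are multiplicative. -/
lemma HasSquares.mul {n m : ℕ} {r r' : ℝ[X]} (h : HasSquares n r) (h' : HasSquares m r') :
    HasSquares (n + m) (r * r') := by
  obtain ⟨p, q, hp, hq, e⟩ := h
  obtain ⟨p', q', hp', hq', e'⟩ := h'
  refine ⟨p * p' + -((1 - X ^ 2) * (q * q')), p * q' + p' * q,
    (hp.mul hp').add (Par.one_sub_mul hq hq').neg,
    (hp.mul_parQ hq').add (by rw [add_comm]; exact hp'.mul_parQ hq), ?_⟩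
  rw [map_mul, ← e, ← e']
  ring

lemma parQ_one_C (c : ℝ) : ParQ 1 (C c : ℝ[X]) := by
  rw [parQ_iff, mul_comm]; exact par_X.C_mul c

/-- With `y = x²`, interpolate between the endpoint values: `a + b y = (a + b) y + a (1 - y)`. -/
lemma hasSquares_linear (a b : ℝ) (ha : 0 ≤ a) (hab : 0 ≤ a + b) :
    HasSquares 1 (C a + C b * X) := by
  refine ⟨C √(a + b) * X, C √a, par_X.C_mul _, parQ_one_C _, ?_⟩
  simp only [map_add, map_mul, expand_C, expand_X, mul_pow, ← C_pow, Real.sq_sqrt ha,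
    Real.sq_sqrt hab]
  ring

/-- Let `u²` and `v²` be the values at `0` and `1`. Then `f - (u - (u + v) y)²` vanishes at both
endpoints, so it equals `κ y (1 - y)` with `κ = (u + v)² - l`. At `y = u / (u + v)` the square
vanishes, and positivity of `f` there gives `κ ≥ 0`. -/
lemma hasSquares_quadratic (f : ℝ[X]) (hd : f.natDegree ≤ 2)
    (h : ∀ y ∈ Set.Icc (0 : ℝ) 1, 0 < f.eval y) : HasSquares 2 f := by
  obtain ⟨c, b, l, rfl⟩ : ∃ c b l : ℝ, f = C c + C b * X + C l * X ^ 2 := by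
    refine ⟨f.coeff 0, f.coeff 1, f.coeff 2, ?_⟩
    conv_lhs => rw [f.as_sum_range_C_mul_X_pow' (Nat.lt_succ_of_le hd)]
    simp [Finset.sum_range_succ]
  have h0 := h 0 (by simp)
  have h1 := h 1 (by simp)
  simp at h0 h1
  obtain ⟨u, hu, rfl⟩ : ∃ u : ℝ, 0 < u ∧ u ^ 2 = c := ⟨√c, by positivity, Real.sq_sqrt h0.le⟩
  obtain ⟨v, hv, hv2⟩ : ∃ v : ℝ, 0 < v ∧ v ^ 2 = u ^ 2 + b + l :=
    ⟨√_, Real.sqrt_pos.2 h1, Real.sq_sqrt h1.le⟩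
  have hl : 0 ≤ (u + v) ^ 2 - l := by
    have ht := h (u / (u + v)) ⟨by positivity, by rw [div_le_one (by positivity)]; linarith⟩
    simp at ht
    have e : u ^ 2 + b * (u / (u + v)) + l * (u / (u + v)) ^ 2 =
        u * v * ((u + v) ^ 2 - l) / (u + v) ^ 2 := by
      have hb : b = v ^ 2 - u ^ 2 - l := by linarith
      rw [hb]; field_simp; ring
    rw [e] at ht
    by_contra hneg
    have : u * v * ((u + v) ^ 2 - l) / (u + v) ^ 2 ≤ 0 :=
      div_nonpos_of_nonpos_of_nonneg
        (mul_nonpos_of_nonneg_of_nonpos (by positivity) (by linarith)) (by positivity)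
    linarith
  have hC : Par 2 (C u * 1 + C (-(u + v)) * X ^ 2 : ℝ[X]) :=
    (par_one.C_mul u).mono_two.add (Par.C_mul _ (by simpa using par_X.pow 2))
  refine ⟨_, C √((u + v) ^ 2 - l) * X, hC, ?_, ?_⟩
  · rw [parQ_iff, mul_left_comm, ← sq]; exact Par.C_mul _ (by simpa using par_X.pow 2)
  · obtain rfl : b = v ^ 2 - u ^ 2 - l := by linarith
    simp only [map_add, map_mul, map_pow, expand_C, expand_X, mul_pow]
    have hs := congrArg (C : ℝ → ℝ[X]) (Real.sq_sqrt hl)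
    simp only [map_sub, map_neg, map_add, map_pow] at hs ⊢
    linear_combination X ^ 2 * (1 - X ^ 2) * hs

lemma same_sign (f g : ℝ[X]) (h : ∀ y ∈ Set.Icc (0 : ℝ) 1, 0 < (f * g).eval y) :
    (∀ y ∈ Set.Icc (0 : ℝ) 1, 0 < f.eval y) ∨ ∀ y ∈ Set.Icc (0 : ℝ) 1, 0 < (-f).eval y := by
  have hne : ∀ y ∈ Set.Icc (0 : ℝ) 1, f.eval y ≠ 0 := fun y hy h0 => by
    have := h y hy
    rw [eval_mul, h0, zero_mul] at this
    exact lt_irrefl _ this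
  have hc : ContinuousOn (fun y => f.eval y) (Set.Icc 0 1) := f.continuous.continuousOn
  have hpc : IsPreconnected (Set.Icc (0 : ℝ) 1) := isPreconnected_Icc
  by_contra hcon
  push Not at hcon
  obtain ⟨⟨a, ha, hfa⟩, b, hb, hfb⟩ := hcon
  rw [eval_neg] at hfb
  have := hpc.intermediate_value ha hb hc
  obtain ⟨y, hy, hy0⟩ := this ⟨hfa, (by linarith : (0 : ℝ) ≤ f.eval b)⟩
  exact hne y hy hy0

/-- A real polynomial of degree at least two has a factor of degree two. Neither factor vanishes on
`[0, 1]`, so after a common change of sign both are positive there, and the representations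
multiply. -/
theorem hasSquares_of_pos (n : ℕ) : ∀ r : ℝ[X], r.natDegree ≤ n →
    (∀ y ∈ Set.Icc (0 : ℝ) 1, 0 < r.eval y) → HasSquares n r := by
  induction n using Nat.strong_induction_on with
  | _ n ih =>
  intro r hd hr
  match n, ih, hd with
  | 0, _, hd =>
    rw [eq_C_of_natDegree_le_zero hd] at hr ⊢
    have h0 := hr 0 (by simp)
    rw [eval_C] at h0
    refine ⟨C √(r.coeff 0) * 1, 0, par_one.C_mul _, fun k hk => absurd (coeff_zero k) hk, ?_⟩
    rw [expand_C, mul_one, ← C_pow, Real.sq_sqrt h0.le]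
    ring
  | 1, _, hd =>
    have e : r = C (r.coeff 0) + C (r.coeff 1) * X := by
      conv_lhs => rw [r.as_sum_range_C_mul_X_pow' (Nat.lt_succ_of_le hd)]
      simp [Finset.sum_range_succ]
    have h0 := hr 0 (by simp)
    have h1 := hr 1 (by simp)
    rw [e] at h0 h1 ⊢
    simp at h0 h1
    exact hasSquares_linear _ _ h0.le h1.le
  | n + 2, ih, hd =>
    by_cases hlt : r.natDegree ≤ n + 1
    -- `1 = x² + (1 - x²)` is a representation of length one, which makes up for a degree below the
    -- bound.
    · have hone : HasSquares 1 1 := by simpa using hasSquares_linear 1 0 (by simp) (by simp)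
      simpa using (ih (n + 1) (by omega) r hlt hr).mul hone
    · have hdeg : r.natDegree = n + 2 := by omega
      have hr0 : r ≠ 0 := by rintro rfl; simp at hdeg
      have hlc : r.leadingCoeff ≠ 0 := leadingCoeff_ne_zero.2 hr0
      have hmon : IsMonicOfDegree (C r.leadingCoeff⁻¹ * r) (n + 2) := by
        constructor
        · rw [natDegree_C_mul (inv_ne_zero hlc), hdeg]
        · rw [Monic, leadingCoeff_mul, leadingCoeff_C, inv_mul_cancel₀ hlc]
      obtain ⟨f, g, hf, hg, e⟩ := hmon.eq_isMonicOfDegree_two_mul_isMonicOfDegree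
      have e' : r = f * (C r.leadingCoeff * g) := by
        rw [mul_left_comm, ← e, ← mul_assoc, ← C_mul, mul_inv_cancel₀ hlc, C_1, one_mul]
      have key : ∀ f' g' : ℝ[X], r = f' * g' → f'.natDegree ≤ 2 → g'.natDegree ≤ n →
          (∀ y ∈ Set.Icc (0 : ℝ) 1, 0 < f'.eval y) → HasSquares (n + 2) r := by
        intro f' g' e hf' hg' hpos
        rw [e, add_comm]
        refine (hasSquares_quadratic f' hf' hpos).mul (ih n (by omega) g' hg' fun y hy => ?_)
        have := hr y hy
        rw [e, eval_mul] at this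
        exact (mul_pos_iff_of_pos_left (hpos y hy)).1 this
      have hg2 : (C r.leadingCoeff * g).natDegree ≤ n :=
        (natDegree_C_mul_le _ _).trans hg.natDegree_eq.le
      rcases same_sign f _ (e' ▸ hr) with hp | hp
      · exact key _ _ e' hf.natDegree_eq.le hg2 hp
      · refine key (-f) (-(C r.leadingCoeff * g)) (by rw [neg_mul_neg]; exact e') ?_ ?_ hp
        · rw [natDegree_neg]; exact hf.natDegree_eq.le
        · rw [natDegree_neg]; exact hg2

lemma exists_expand_of_par (n : ℕ) (p : ℝ[X]) (h : Par (2 * n) p) :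
    ∃ r : ℝ[X], r.natDegree ≤ n ∧ expand ℝ 2 r = p := by
  refine ⟨contract 2 p, ?_, ?_⟩
  · rw [natDegree_le_iff_coeff_eq_zero]
    intro k hk
    rw [coeff_contract two_ne_zero]
    by_contra hne
    obtain ⟨j, hj⟩ := h _ hne
    omega
  · ext k
    rw [coeff_expand two_pos]
    split_ifs with hk
    · rw [coeff_contract two_ne_zero, Nat.div_mul_cancel hk]
    · by_contra hne
      obtain ⟨j, hj⟩ := h k (Ne.symm hne)
      omega

/-- Real polynomials `p`, `q` with `p² + (1 - x²) q² ≤ 1` on `[-1, 1]` can be realized, up to a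
small rescaling, as the real parts of the entries of an alternating sequence. In particular the
sequence is close to `a + ibσ_x` wherever `(p, √(1 - x²) q)` is close to the unit vector
`(a, b)`. -/
theorem exists_phases_approx {n : ℕ} {p q : ℝ[X]} (hp : Par n p) (hq : ParQ n q)
    (hle : ∀ x ∈ Set.Icc (-1 : ℝ) 1, p.eval x ^ 2 + (1 - x ^ 2) * q.eval x ^ 2 ≤ 1)
    {η : ℝ} (hη : 0 < η) (hη1 : η < 1) :
    ∃ φ : ℕ → ℝ, ∀ θ a b : ℝ, a ^ 2 + b ^ 2 = 1 → |p.eval (Real.cos θ) - a| ≤ η →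
      |Real.sin θ * q.eval (Real.cos θ) - b| ≤ η →
      ‖seq φ (rotX θ) n - quat a b‖ ^ 2 ≤ 8 * η := by
  -- The factor `1 - η` makes the defect `1 - p₁² - (1 - x²)q₁²` strictly positive, as
  -- `hasSquares_of_pos` requires.
  set p₁ : ℝ[X] := C (1 - η) * p with hp₁
  set q₁ : ℝ[X] := C (1 - η) * q with hq₁
  have hpar₁ : Par n p₁ := hp.C_mul _
  have hparq₁ : ParQ n q₁ := by
    rw [parQ_iff, hq₁, mul_left_comm]; exact (parQ_iff.1 hq).C_mul _
  have hpar : Par (2 * n) (1 + -(p₁ ^ 2 + (1 - X ^ 2) * (q₁ * q₁))) := by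
    refine Par.add ?_ (Par.neg (Par.add ?_ ?_))
    · simpa using (par_one (R := ℝ)).mono n
    · rw [sq, two_mul]; exact hpar₁.mul hpar₁
    · rw [two_mul]; exact Par.one_sub_mul hparq₁ hparq₁
  obtain ⟨r, hrd, hr⟩ := exists_expand_of_par n _ hpar
  have hrpos : ∀ y ∈ Set.Icc (0 : ℝ) 1, 0 < r.eval y := by
    intro y hy
    have hs : √y ^ 2 = y := Real.sq_sqrt hy.1
    have h1 : √y ∈ Set.Icc (-1 : ℝ) 1 :=
      ⟨by linarith [Real.sqrt_nonneg y], Real.sqrt_le_one.2 hy.2⟩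
    have e : r.eval y = (expand ℝ 2 r).eval √y := by rw [expand_eval, hs]
    rw [e, hr, hp₁, hq₁]
    simp only [eval_add, eval_neg, eval_mul, eval_pow, eval_sub, eval_one, eval_X, eval_C]
    have h2 := mul_le_mul_of_nonneg_left (hle _ h1) (sq_nonneg (1 - η))
    nlinarith
  -- These become the imaginary parts of the two entries.
  obtain ⟨p₂, q₂, hp₂, hq₂, e⟩ := hasSquares_of_pos n r hrd hrpos
  rw [hr] at e
  have hcoe : ∀ (u v : ℝ[X]) (x : ℝ), (u.map Complex.ofRealHom + C Complex.I *
      v.map Complex.ofRealHom).eval (x : ℂ) = ((u.eval x : ℝ) : ℂ) + Complex.I * ((v.eval x : ℝ) : ℂ) := by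
    intro u v x
    have := fun w : ℝ[X] => Polynomial.eval_map_apply Complex.ofRealHom (p := w) x
    simp only [Complex.ofRealHom_eq_coe] at this
    rw [eval_add, eval_mul, eval_C, this, this]
  have hconj : ∀ u v : ℝ[X], conjPoly (u.map Complex.ofRealHom + C Complex.I *
      v.map Complex.ofRealHom) = u.map Complex.ofRealHom - C Complex.I *
      v.map Complex.ofRealHom := by
    intro u v
    have hh : (starRingEnd ℂ).comp Complex.ofRealHom = Complex.ofRealHom := by
      ext x; simp
    simp [conjPoly, Polynomial.map_map, hh, sub_eq_add_neg]
  have hI : (C Complex.I : ℂ[X]) * C Complex.I = -1 := by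
    rw [← C_mul, Complex.I_mul_I, C_neg, C_1]
  have hPar : ∀ u v : ℝ[X], Par n u → Par n v → Par n (u.map Complex.ofRealHom + C Complex.I *
      v.map Complex.ofRealHom) := by
    have hm : ∀ u : ℝ[X], Par n u → Par n (u.map Complex.ofRealHom) := fun u hu k hk => hu k
      (fun h0 => hk (by rw [coeff_map, h0, map_zero]))
    exact fun u v hu hv => (hm u hu).add ((hm v hv).C_mul _)
  have hParQ : ∀ u v : ℝ[X], ParQ n u → ParQ n v → ParQ n (u.map Complex.ofRealHom +
      C Complex.I * v.map Complex.ofRealHom) := by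
    intro u v hu hv
    rw [parQ_iff] at hu hv ⊢
    have := hPar _ _ hu hv
    rw [Polynomial.map_mul, Polynomial.map_mul, map_X] at this
    rwa [show X * (map Complex.ofRealHom u + C Complex.I * map Complex.ofRealHom v) =
      X * map Complex.ofRealHom u + C Complex.I * (X * map Complex.ofRealHom v) by ring]
  obtain ⟨φ, hφ⟩ := exists_phases n _ _ (hPar p₁ p₂ hpar₁ hp₂) (hParQ q₁ q₂ hparq₁ hq₂) (by
    rw [hconj, hconj]
    have e' := congrArg (Polynomial.map Complex.ofRealHom) e
    simp only [Polynomial.map_add, Polynomial.map_mul, Polynomial.map_pow, Polynomial.map_sub,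
      Polynomial.map_one, map_X, Polynomial.map_neg] at e'
    linear_combination e' - (map Complex.ofRealHom p₂ ^ 2 +
      (1 - X ^ 2) * map Complex.ofRealHom q₂ ^ 2) * hI)
  refine ⟨φ, fun θ a b hab ha hb => ?_⟩
  rw [hφ, quat_sub, norm_quat_sq, hcoe, hcoe]
  have hev := congrArg (eval (Real.cos θ)) e
  simp only [eval_add, eval_mul, eval_pow, eval_sub, eval_one, eval_X, eval_neg] at hev
  have hs := Real.sin_sq_add_cos_sq θ
  rw [show 1 - Real.cos θ ^ 2 = Real.sin θ ^ 2 by linarith] at hev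
  have e1 : ((eval (Real.cos θ) p₁ : ℝ) : ℂ) + Complex.I * ((eval (Real.cos θ) p₂ : ℝ) : ℂ) - a =
      ((eval (Real.cos θ) p₁ - a : ℝ) : ℂ) + ((eval (Real.cos θ) p₂ : ℝ) : ℂ) * Complex.I := by
    push_cast; ring
  have e2 : (Real.sin θ : ℂ) * (((eval (Real.cos θ) q₁ : ℝ) : ℂ) +
      Complex.I * ((eval (Real.cos θ) q₂ : ℝ) : ℂ)) - b =
      ((Real.sin θ * eval (Real.cos θ) q₁ - b : ℝ) : ℂ) +
      ((Real.sin θ * eval (Real.cos θ) q₂ : ℝ) : ℂ) * Complex.I := by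
    push_cast; ring
  rw [e1, e2, Complex.normSq_add_mul_I, Complex.normSq_add_mul_I]
  have hp1e : eval (Real.cos θ) p₁ = (1 - η) * eval (Real.cos θ) p := by simp [hp₁]
  have hq1e : eval (Real.cos θ) q₁ = (1 - η) * eval (Real.cos θ) q := by simp [hq₁]
  rw [hp1e, hq1e] at hev ⊢
  clear e1 e2 hp1e hq1e hle
  generalize eval (Real.cos θ) p = P at *
  generalize eval (Real.cos θ) q = Q at *
  generalize eval (Real.cos θ) p₂ = P₂ at *
  generalize eval (Real.cos θ) q₂ = Q₂ at *
  generalize Real.sin θ = s at *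
  -- The two entries and `(a, b)` are unit vectors, so the squared distance is `2 - 2(1 - η)(aP + b
  -- s Q)`. The imaginary parts need no separate estimate: the inner product is at least `1 - 2η`,
  -- and `2 - 2(1 - η)(1 - 2η) ≤ 8η`.
  have ha1 : |a| ≤ 1 := abs_le_one_iff_mul_self_le_one.2 (by nlinarith [sq_nonneg b])
  have hb1 : |b| ≤ 1 := abs_le_one_iff_mul_self_le_one.2 (by nlinarith [sq_nonneg a])
  have k1 : a * (a - P) ≤ η := by
    calc a * (a - P) ≤ |a * (a - P)| := le_abs_self _
      _ = |a| * |P - a| := by rw [abs_mul, abs_sub_comm]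
      _ ≤ 1 * η := mul_le_mul ha1 ha (abs_nonneg _) zero_le_one
      _ = η := one_mul _
  have k2 : b * (b - s * Q) ≤ η := by
    calc b * (b - s * Q) ≤ |b * (b - s * Q)| := le_abs_self _
      _ = |b| * |s * Q - b| := by rw [abs_mul, abs_sub_comm]
      _ ≤ 1 * η := mul_le_mul hb1 hb (abs_nonneg _) zero_le_one
      _ = η := one_mul _
  have k3 : a * P + b * (s * Q) ≥ 1 - 2 * η := by nlinarith
  have k4 : (1 - η) * (a * P + b * (s * Q)) ≥ (1 - η) * (1 - 2 * η) :=
    mul_le_mul_of_nonneg_left k3 (by linarith)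
  nlinarith [sq_nonneg η]

end QGadget
end

noncomputable section

namespace QGadget

open Polynomial

/-! ## Approximating polynomials -/

/-- The coefficients of the power series of `1 / √(1 - y)`. -/
def invSqrtCoeff : ℕ → ℝ
  | 0 => 1
  | k + 1 => invSqrtCoeff k * ((2 * k + 1) / (2 * k + 2))

lemma invSqrtCoeff_pos (k : ℕ) : 0 < invSqrtCoeff k := by
  induction k with
  | zero => simp [invSqrtCoeff]
  | succ k ih => rw [invSqrtCoeff]; positivity

lemma invSqrtCoeff_le_one (k : ℕ) : invSqrtCoeff k ≤ 1 := by
  induction k with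
  | zero => simp [invSqrtCoeff]
  | succ k ih =>
    rw [invSqrtCoeff]
    refine mul_le_one₀ ih (by positivity) ?_
    rw [div_le_one (by positivity)]; linarith

/-- The truncated power series of `1 / √(1 - y)`. -/
def invSqrtPoly (N : ℕ) : ℝ[X] := ∑ k ∈ Finset.range (N + 1), C (invSqrtCoeff k) * X ^ k

lemma eval_invSqrtPoly (N : ℕ) (y : ℝ) :
    (invSqrtPoly N).eval y = ∑ k ∈ Finset.range (N + 1), invSqrtCoeff k * y ^ k := by
  simp [invSqrtPoly, eval_finsetSum]

lemma eval_invSqrtPoly_nonneg (N : ℕ) {y : ℝ} (hy : 0 ≤ y) : 0 ≤ (invSqrtPoly N).eval y := by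
  rw [eval_invSqrtPoly]
  exact Finset.sum_nonneg fun k _ => mul_nonneg (invSqrtCoeff_pos k).le (pow_nonneg hy k)

/-- The full series would give the constant `1`. The recursion of the coefficients makes the
derivative of a truncation telescope to a single term. -/
lemma hasDerivAt_sin_mul_invSqrtPoly (N : ℕ) (θ : ℝ) :
    HasDerivAt (fun θ => Real.sin θ * (invSqrtPoly N).eval (Real.cos θ ^ 2))
      ((2 * N + 1) * invSqrtCoeff N * Real.cos θ ^ (2 * N + 1)) θ := by
  induction N with
  | zero =>
    simpa [eval_invSqrtPoly, invSqrtCoeff] using Real.hasDerivAt_sin θ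
  | succ N ih =>
    have e : (fun θ => Real.sin θ * (invSqrtPoly (N + 1)).eval (Real.cos θ ^ 2)) =
        fun θ => Real.sin θ * (invSqrtPoly N).eval (Real.cos θ ^ 2) +
          invSqrtCoeff (N + 1) * (Real.sin θ * Real.cos θ ^ (2 * N + 2)) := by
      funext θ
      rw [eval_invSqrtPoly, eval_invSqrtPoly, Finset.sum_range_succ, ← pow_mul]
      ring
    rw [e]
    have h1 := ((Real.hasDerivAt_sin θ).mul ((Real.hasDerivAt_cos θ).pow (2 * N + 2))).const_mul
      (invSqrtCoeff (N + 1))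
    refine (ih.add h1).congr_deriv ?_
    have hs : Real.sin θ ^ 2 = 1 - Real.cos θ ^ 2 := by linarith [Real.sin_sq_add_cos_sq θ]
    have hb : invSqrtCoeff (N + 1) * (2 * N + 2) = invSqrtCoeff N * (2 * N + 1) := by
      rw [invSqrtCoeff]; field_simp
    simp only [Pi.pow_apply, show 2 * N + 2 - 1 = 2 * N + 1 by omega]
    push_cast
    linear_combination -Real.cos θ ^ (2 * N + 1) * hb -
      invSqrtCoeff (N + 1) * (2 * N + 2) * Real.cos θ ^ (2 * N + 1) * hs

/-- The derivative is nonnegative on `[θ, π / 2]` and the value at `π / 2` is `1`. The deficit at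
`θ` is at most the maximal slope times an interval of length at most `2`. -/
lemma sin_mul_invSqrtPoly_bounds (N : ℕ) {θ : ℝ} (h0 : 0 ≤ θ) (h1 : θ ≤ Real.pi / 2) :
    Real.sin θ * (invSqrtPoly N).eval (Real.cos θ ^ 2) ≤ 1 ∧
      1 - Real.sin θ * (invSqrtPoly N).eval (Real.cos θ ^ 2) ≤
        2 * (2 * N + 1) * Real.cos θ ^ (2 * N + 1) := by
  set F : ℝ → ℝ := fun θ => Real.sin θ * (invSqrtPoly N).eval (Real.cos θ ^ 2) with hF
  have hd := hasDerivAt_sin_mul_invSqrtPoly N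
  have hend : F (Real.pi / 2) = 1 := by
    simp [hF, eval_invSqrtPoly, Finset.sum_range_succ', invSqrtCoeff]
  have hcont : ContinuousOn F (Set.Icc θ (Real.pi / 2)) :=
    fun x _ => (hd x).continuousAt.continuousWithinAt
  have hdiff : DifferentiableOn ℝ F (interior (Set.Icc θ (Real.pi / 2))) :=
    fun x _ => (hd x).differentiableAt.differentiableWithinAt
  have hcos : ∀ x ∈ interior (Set.Icc θ (Real.pi / 2)), 0 ≤ Real.cos x ∧
      Real.cos x ≤ Real.cos θ := by
    intro x hx
    have hx := interior_subset hx
    have := Real.pi_pos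
    exact ⟨Real.cos_nonneg_of_mem_Icc ⟨by linarith [hx.1], hx.2⟩,
      Real.cos_le_cos_of_nonneg_of_le_pi h0 (by linarith [hx.2]) hx.1⟩
  have hml : θ ∈ Set.Icc θ (Real.pi / 2) := ⟨le_rfl, h1⟩
  have hmr : Real.pi / 2 ∈ Set.Icc θ (Real.pi / 2) := ⟨h1, le_rfl⟩
  constructor
  · rw [← hend]
    refine monotoneOn_of_deriv_nonneg (convex_Icc _ _) hcont hdiff (fun x hx => ?_) hml hmr h1
    rw [(hd x).deriv]
    exact mul_nonneg (mul_nonneg (by positivity) (invSqrtCoeff_pos N).le)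
      (pow_nonneg (hcos x hx).1 _)
  · have h2 : F (Real.pi / 2) - F θ ≤
        ((2 * N + 1) * Real.cos θ ^ (2 * N + 1)) * (Real.pi / 2 - θ) := by
      refine (convex_Icc θ (Real.pi / 2)).image_sub_le_mul_sub_of_deriv_le hcont hdiff
        (fun x hx => ?_) θ hml _ hmr h1
      rw [(hd x).deriv]
      refine mul_le_mul ?_ (pow_le_pow_left₀ (hcos x hx).1 (hcos x hx).2 _)
        (pow_nonneg (hcos x hx).1 _) (by positivity)
      exact mul_le_of_le_one_right (by positivity) (invSqrtCoeff_le_one N)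
    rw [hend] at h2
    refine h2.trans ?_
    have hc : 0 ≤ Real.cos θ := Real.cos_nonneg_of_mem_Icc ⟨by linarith [Real.pi_pos], h1⟩
    have : 0 ≤ (2 * N + 1) * Real.cos θ ^ (2 * N + 1) := by positivity
    nlinarith [Real.pi_le_four]

lemma mul_invSqrtPoly_bounds (N : ℕ) {s c : ℝ} (hs : 0 ≤ s) (h : s ^ 2 + c ^ 2 = 1) :
    s * (invSqrtPoly N).eval (c ^ 2) ≤ 1 ∧
      1 - s * (invSqrtPoly N).eval (c ^ 2) ≤ 2 * (2 * N + 1) * |c| ^ (2 * N + 1) := by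
  have hs1 : s ≤ 1 := by nlinarith [sq_nonneg c]
  have e1 : Real.sin (Real.arcsin s) = s := Real.sin_arcsin (by linarith) hs1
  have e2 : Real.cos (Real.arcsin s) = |c| := by
    rw [Real.cos_arcsin, show 1 - s ^ 2 = c ^ 2 by linarith, Real.sqrt_sq_eq_abs]
  have := sin_mul_invSqrtPoly_bounds N (Real.arcsin_nonneg.2 hs) (Real.arcsin_le_pi_div_two s)
  rwa [e1, e2, sq_abs] at this

/-! ### Half-angle polynomials. -/

/-- The coefficients of `sin (φ / 2) / sin φ` as a power series in `sin² φ`. -/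
def halfCoeff : ℕ → ℝ
  | 0 => 1 / 2
  | k + 1 => halfCoeff k * (((2 * k + 1) ^ 2 - 1 / 4) / ((2 * k + 3) * (2 * k + 2)))

lemma halfCoeff_nonneg (k : ℕ) : 0 ≤ halfCoeff k := by
  induction k with
  | zero => simp [halfCoeff]
  | succ k ih =>
    rw [halfCoeff]
    refine mul_nonneg ih (div_nonneg ?_ (by positivity))
    have : (0 : ℝ) ≤ k := k.cast_nonneg
    nlinarith

lemma mul_halfCoeff_le (k : ℕ) : (2 * k + 1) * halfCoeff k ≤ 1 / 2 := by
  induction k with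
  | zero => simp [halfCoeff]
  | succ k ih =>
    have hk : (0 : ℝ) ≤ k := k.cast_nonneg
    have e : (2 * ((k + 1 : ℕ) : ℝ) + 1) * halfCoeff (k + 1) =
        ((2 * k + 1) * halfCoeff k) *
          (((2 * k + 1) ^ 2 - 1 / 4) / ((2 * k + 1) * (2 * k + 2))) := by
      rw [halfCoeff]; push_cast; field_simp; ring
    rw [e]
    refine (mul_le_of_le_one_right (mul_nonneg (by positivity) (halfCoeff_nonneg k)) ?_).trans ih
    rw [div_le_one (by positivity)]
    nlinarith

/-- The truncated expansion of `sin (φ / 2)`. -/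
def halfSin (N : ℕ) (φ : ℝ) : ℝ :=
  ∑ k ∈ Finset.range (N + 1), halfCoeff k * Real.sin φ ^ (2 * k + 1)

/-- The truncated expansion of `cos (φ / 2) / 2`. -/
def halfCos (N : ℕ) (φ : ℝ) : ℝ :=
  ∑ k ∈ Finset.range (N + 1), (2 * k + 1) * halfCoeff k * Real.sin φ ^ (2 * k) * Real.cos φ

lemma hasDerivAt_halfSin (N : ℕ) (φ : ℝ) : HasDerivAt (halfSin N) (halfCos N φ) φ := by
  unfold halfSin halfCos
  refine HasDerivAt.fun_sum fun k _ => ?_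
  have := ((Real.hasDerivAt_sin φ).pow (2 * k + 1)).const_mul (halfCoeff k)
  refine this.congr_deriv ?_
  simp only [Nat.add_sub_cancel]
  push_cast
  ring

/-- `sin (φ / 2)` solves `y'' = -y / 4`. The recursion of `halfCoeff` is this equation for the
powers of `sin φ`, so a truncation satisfies it up to one residual term. -/
lemma hasDerivAt_halfCos (N : ℕ) (φ : ℝ) :
    HasDerivAt (halfCos N) (-(halfSin N φ / 4) -
      halfCoeff N * ((2 * N + 1) ^ 2 - 1 / 4) * Real.sin φ ^ (2 * N + 1)) φ := by
  induction N with
  | zero =>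
    have e : halfCos 0 = fun φ => 1 / 2 * Real.cos φ := by
      funext φ; simp [halfCos, halfCoeff]
    rw [e]
    refine ((Real.hasDerivAt_cos φ).const_mul (1 / 2)).congr_deriv ?_
    simp [halfSin, halfCoeff]; ring
  | succ N ih =>
    have e : halfCos (N + 1) = fun φ => halfCos N φ + (2 * (N + 1 : ℕ) + 1) *
        halfCoeff (N + 1) * (Real.sin φ ^ (2 * N + 2) * Real.cos φ) := by
      funext φ
      rw [halfCos, Finset.sum_range_succ, ← halfCos]
      ring
    have e' : halfSin (N + 1) φ = halfSin N φ + halfCoeff (N + 1) *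
        Real.sin φ ^ (2 * N + 3) := by
      rw [halfSin, Finset.sum_range_succ, ← halfSin]
      ring
    rw [e, e']
    have h1 := (((Real.hasDerivAt_sin φ).pow (2 * N + 2)).mul (Real.hasDerivAt_cos φ)).const_mul
      ((2 * (N + 1 : ℕ) + 1) * halfCoeff (N + 1))
    refine (ih.add h1).congr_deriv ?_
    have hc : Real.cos φ ^ 2 = 1 - Real.sin φ ^ 2 := by linarith [Real.sin_sq_add_cos_sq φ]
    have hb : halfCoeff (N + 1) * ((2 * N + 3) * (2 * N + 2)) =
        halfCoeff N * ((2 * N + 1) ^ 2 - 1 / 4) := by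
      rw [halfCoeff]; field_simp
    simp only [Pi.pow_apply, show 2 * N + 2 - 1 = 2 * N + 1 by omega]
    push_cast
    linear_combination Real.sin φ ^ (2 * N + 1) * hb +
      (2 * N + 3) * halfCoeff (N + 1) * (2 * N + 2) * Real.sin φ ^ (2 * N + 1) * hc

lemma mul_bounds_of_deriv {f f' : ℝ → ℝ} {x M : ℝ} (hx : 0 ≤ x) (h0 : f 0 = 0)
    (hf : ∀ t, HasDerivAt f (f' t) t) (h : ∀ t ∈ Set.Icc 0 x, 0 ≤ f' t ∧ f' t ≤ M) :
    0 ≤ f x ∧ f x ≤ M * x := by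
  have hcont : ContinuousOn f (Set.Icc 0 x) := fun x _ => (hf x).continuousAt.continuousWithinAt
  have hdiff : DifferentiableOn ℝ f (interior (Set.Icc 0 x)) :=
    fun x _ => (hf x).differentiableAt.differentiableWithinAt
  have hml : (0 : ℝ) ∈ Set.Icc 0 x := ⟨le_rfl, hx⟩
  have hmr : x ∈ Set.Icc 0 x := ⟨hx, le_rfl⟩
  constructor
  · rw [← h0]
    refine monotoneOn_of_deriv_nonneg (convex_Icc _ _) hcont hdiff (fun t ht => ?_) hml hmr hx
    rw [(hf t).deriv]
    exact (h t (interior_subset ht)).1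
  · have := (convex_Icc 0 x).image_sub_le_mul_sub_of_deriv_le hcont hdiff
        (fun t ht => (by rw [(hf t).deriv]; exact (h t (interior_subset ht)).2 : deriv f t ≤ M))
        0 hml _ hmr hx
    simpa [h0] using this

/-- The error `h` of the sine truncation solves `h'' + h / 4 = r` with `r ≥ 0` and zero initial
data. Hence `h` and `h'` are nonnegative and bounded by a multiple of the final value of `r`, which
increases on `[0, π / 2]`. -/
lemma half_bounds (N : ℕ) {φ : ℝ} (h0 : 0 ≤ φ) (h1 : φ ≤ Real.pi / 2) :
    (0 ≤ Real.cos (φ / 2) - 2 * halfCos N φ ∧ Real.cos (φ / 2) - 2 * halfCos N φ ≤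
        4 * (2 * N + 1) * Real.sin φ ^ (2 * N + 1)) ∧
      (0 ≤ Real.sin (φ / 2) - halfSin N φ ∧ Real.sin (φ / 2) - halfSin N φ ≤
        4 * (2 * N + 1) * Real.sin φ ^ (2 * N + 1)) := by
  have hpi := Real.pi_le_four
  have hpi0 := Real.pi_pos
  have hpi2 : Real.pi / 2 ≤ 2 := by linarith
  set κ : ℝ := halfCoeff N * ((2 * N + 1) ^ 2 - 1 / 4) with hκ
  have hN : (0 : ℝ) ≤ N := N.cast_nonneg
  have hκ0 : 0 ≤ κ := mul_nonneg (halfCoeff_nonneg N) (by nlinarith)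
  have hκ1 : κ ≤ (2 * N + 1) / 2 := by
    have := mul_halfCoeff_le N
    have h3 := halfCoeff_nonneg N
    nlinarith
  have hs : ∀ x : ℝ, HasDerivAt (fun t => Real.sin (t / 2)) (Real.cos (x / 2) / 2) x := fun x => by
    have := ((hasDerivAt_id x).div_const 2).sin
    refine this.congr_deriv ?_
    simp only [id]; ring
  have hc : ∀ x : ℝ, HasDerivAt (fun t => Real.cos (t / 2)) (-(Real.sin (x / 2) / 2)) x :=
    fun x => by
    have := ((hasDerivAt_id x).div_const 2).cos
    refine this.congr_deriv ?_
    simp only [id]; ring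
  set h : ℝ → ℝ := fun t => Real.sin (t / 2) - halfSin N t with hh
  set h' : ℝ → ℝ := fun t => Real.cos (t / 2) / 2 - halfCos N t with hh'
  set r : ℝ → ℝ := fun t => κ * Real.sin t ^ (2 * N + 1) with hr
  have hdh : ∀ t, HasDerivAt h (h' t) t := fun t => (hs t).sub (hasDerivAt_halfSin N t)
  have hdh' : ∀ t, HasDerivAt h' (r t - h t / 4) t := fun t => by
    refine (((hc t).div_const 2).sub (hasDerivAt_halfCos N t)).congr_deriv ?_
    simp only [hr, hh, hκ]; ring
  have hz : h 0 = 0 := by simp [hh, halfSin]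
  have hz' : h' 0 = 0 := by
    simp [hh', halfCos, Finset.sum_range_succ', halfCoeff]
  -- Variation of constants: the two combinations below have derivatives `r cos (t / 2)` and `r sin
  -- (t / 2)`, and `h'` is recovered from them with nonnegative weights.
  have hdA : ∀ t, HasDerivAt (fun t => h' t * Real.cos (t / 2) + h t / 2 * Real.sin (t / 2))
      (r t * Real.cos (t / 2)) t := fun t => by
    refine (((hdh' t).mul (hc t)).add (((hdh t).div_const 2).mul (hs t))).congr_deriv ?_
    ring
  have hdB : ∀ t, HasDerivAt (fun t => h' t * Real.sin (t / 2) - h t / 2 * Real.cos (t / 2))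
      (r t * Real.sin (t / 2)) t := fun t => by
    refine (((hdh' t).mul (hs t)).sub (((hdh t).div_const 2).mul (hc t))).congr_deriv ?_
    ring
  have hcs : ∀ t, 0 ≤ t → t ≤ Real.pi / 2 → 0 ≤ Real.cos (t / 2) ∧ 0 ≤ Real.sin (t / 2) ∧
      0 ≤ Real.sin t := fun t ht ht1 =>
    ⟨Real.cos_nonneg_of_mem_Icc ⟨by linarith, by linarith⟩,
      Real.sin_nonneg_of_nonneg_of_le_pi (by linarith) (by linarith),
      Real.sin_nonneg_of_nonneg_of_le_pi (by linarith) (by linarith)⟩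
  have hrb : ∀ x, 0 ≤ x → x ≤ Real.pi / 2 → ∀ t ∈ Set.Icc 0 x, 0 ≤ r t ∧ r t ≤ r x := by
    intro x hx hx1 t ht
    obtain ⟨_, _, h3⟩ := hcs t ht.1 (ht.2.trans hx1)
    refine ⟨mul_nonneg hκ0 (pow_nonneg h3 _), mul_le_mul_of_nonneg_left
      (pow_le_pow_left₀ h3 ?_ _) hκ0⟩
    exact Real.sin_le_sin_of_le_of_le_pi_div_two (by linarith [ht.1]) hx1 ht.2
  have key : ∀ x, 0 ≤ x → x ≤ Real.pi / 2 → 0 ≤ h' x ∧ h' x ≤ 4 * r x := by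
    intro x hx hx1
    have hb := hrb x hx hx1
    have hA := mul_bounds_of_deriv (M := r x) hx (by simp [hz, hz']) hdA (fun t ht => by
      obtain ⟨h3, _, _⟩ := hcs t ht.1 (ht.2.trans hx1)
      exact ⟨mul_nonneg (hb t ht).1 h3,
        (mul_le_of_le_one_right (hb t ht).1 (Real.cos_le_one _)).trans (hb t ht).2⟩)
    have hB := mul_bounds_of_deriv (M := r x) hx (by simp [hz, hz']) hdB (fun t ht => by
      obtain ⟨_, h3, _⟩ := hcs t ht.1 (ht.2.trans hx1)
      exact ⟨mul_nonneg (hb t ht).1 h3,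
        (mul_le_of_le_one_right (hb t ht).1 (Real.sin_le_one _)).trans (hb t ht).2⟩)
    obtain ⟨hc0, hs0, _⟩ := hcs x hx hx1
    have hsc := Real.sin_sq_add_cos_sq (x / 2)
    have e : h' x = (h' x * Real.cos (x / 2) + h x / 2 * Real.sin (x / 2)) * Real.cos (x / 2) +
        (h' x * Real.sin (x / 2) - h x / 2 * Real.cos (x / 2)) * Real.sin (x / 2) := by
      linear_combination -(h' x) * hsc
    have hr0 := (hb x ⟨hx, le_rfl⟩).1
    have hrx : r x * x ≤ 2 * r x := by nlinarith
    rw [e]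
    refine ⟨add_nonneg (mul_nonneg hA.1 hc0) (mul_nonneg hB.1 hs0), ?_⟩
    have := mul_le_of_le_one_right hA.1 (Real.cos_le_one (x / 2))
    have := mul_le_of_le_one_right hB.1 (Real.sin_le_one (x / 2))
    linarith [hA.2, hB.2]
  have hh0 := mul_bounds_of_deriv (M := 4 * r φ) h0 hz hdh (fun t ht => by
    have := key t ht.1 (ht.2.trans h1)
    exact ⟨this.1, this.2.trans (by linarith [(hrb φ h0 h1 t ht).2])⟩)
  have hk := key φ h0 h1
  have hr0 := (hrb φ h0 h1 φ ⟨h0, le_rfl⟩).1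
  have hr1 : 8 * r φ ≤ 4 * (2 * N + 1) * Real.sin φ ^ (2 * N + 1) := by
    have := mul_le_mul_of_nonneg_right hκ1 (pow_nonneg (hcs φ h0 h1).2.2 (2 * N + 1))
    simp only [hr]; linarith
  have e : Real.cos (φ / 2) - 2 * halfCos N φ = 2 * h' φ := by simp only [hh']; ring
  rw [e]
  refine ⟨⟨by linarith, by linarith⟩, hh0.1, hh0.2.trans (le_trans ?_ hr1)⟩
  nlinarith

/-- Polynomials `p`, `q` such that `p (cos φ) ≈ cos (φ / 2)` and
`sin φ * q (cos φ) ≈ sin (φ / 2)`. -/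
def halfAngleP (N : ℕ) : ℝ[X] :=
  ∑ k ∈ Finset.range (N + 1), C (2 * ((2 * k + 1) * halfCoeff k)) * ((1 - X ^ 2) ^ k * X)

/-- The companion of `halfAngleP` that multiplies `sin φ`. -/
def halfAngleQ (N : ℕ) : ℝ[X] :=
  ∑ k ∈ Finset.range (N + 1), C (halfCoeff k) * (1 - X ^ 2) ^ k

lemma par_one_sub_X_sq_pow {k N : ℕ} (h : k ≤ N) :
    Par (2 * N) ((1 - X ^ 2 : ℝ[X]) ^ k) := by
  have := ((par_one_sub_X_sq (R := ℝ)).pow k).mono (N - k)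
  rwa [show k * 2 + 2 * (N - k) = 2 * N by omega] at this

lemma par_halfAngleP (N : ℕ) : Par (2 * N + 1) (halfAngleP N) :=
  Par.sum fun k hk => Par.C_mul _
    ((par_one_sub_X_sq_pow (by rw [Finset.mem_range] at hk; omega)).mul par_X)

lemma parQ_halfAngleQ (N : ℕ) : ParQ (2 * N + 1) (halfAngleQ N) := by
  rw [parQ_iff, add_comm]
  exact par_X.mul (Par.sum fun k hk => Par.C_mul _
    (par_one_sub_X_sq_pow (by rw [Finset.mem_range] at hk; omega)))

lemma eval_halfAngleP (N : ℕ) (φ : ℝ) :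
    (halfAngleP N).eval (Real.cos φ) = 2 * halfCos N φ := by
  have h : 1 - Real.cos φ ^ 2 = Real.sin φ ^ 2 := by linarith [Real.sin_sq_add_cos_sq φ]
  simp only [halfAngleP, halfCos, eval_finsetSum, eval_mul, eval_C, eval_pow, eval_sub, eval_one,
    eval_X, h, Finset.mul_sum, ← pow_mul]
  exact Finset.sum_congr rfl fun k _ => by ring

lemma eval_halfAngleQ (N : ℕ) (φ : ℝ) :
    Real.sin φ * (halfAngleQ N).eval (Real.cos φ) = halfSin N φ := by
  have h : 1 - Real.cos φ ^ 2 = Real.sin φ ^ 2 := by linarith [Real.sin_sq_add_cos_sq φ]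
  simp only [halfAngleQ, halfSin, eval_finsetSum, eval_mul, eval_C, eval_pow, eval_sub, eval_one,
    eval_X, h, Finset.mul_sum, ← pow_mul]
  exact Finset.sum_congr rfl fun k _ => by ring

lemma halfCos_neg (N : ℕ) (φ : ℝ) : halfCos N (-φ) = halfCos N φ := by
  simp [halfCos, pow_mul]

lemma halfSin_neg (N : ℕ) (φ : ℝ) : halfSin N (-φ) = -halfSin N φ := by
  rw [halfSin, halfSin, ← Finset.sum_neg_distrib]
  refine Finset.sum_congr rfl fun k _ => ?_
  rw [Real.sin_neg, (show Odd (2 * k + 1) from ⟨k, rfl⟩).neg_pow]; ring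

lemma halfAngle_approx (N : ℕ) {φ : ℝ} (h : |φ| ≤ Real.pi / 2) :
    |(halfAngleP N).eval (Real.cos φ) - Real.cos (φ / 2)| ≤
        4 * (2 * N + 1) * |Real.sin φ| ^ (2 * N + 1) ∧
      |Real.sin φ * (halfAngleQ N).eval (Real.cos φ) - Real.sin (φ / 2)| ≤
        4 * (2 * N + 1) * |Real.sin φ| ^ (2 * N + 1) := by
  rw [eval_halfAngleP, eval_halfAngleQ]
  have key : ∀ φ, 0 ≤ φ → φ ≤ Real.pi / 2 → |2 * halfCos N φ - Real.cos (φ / 2)| ≤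
        4 * (2 * N + 1) * |Real.sin φ| ^ (2 * N + 1) ∧
      |halfSin N φ - Real.sin (φ / 2)| ≤ 4 * (2 * N + 1) * |Real.sin φ| ^ (2 * N + 1) := by
    intro φ h0 h1
    obtain ⟨⟨a, b⟩, c, d⟩ := half_bounds N h0 h1
    rw [abs_sub_comm, abs_of_nonneg a, abs_sub_comm, abs_of_nonneg c, abs_of_nonneg
      (Real.sin_nonneg_of_nonneg_of_le_pi h0 (by linarith [Real.pi_pos]))]
    exact ⟨b, d⟩
  rcases le_total 0 φ with h0 | h0
  · rw [abs_of_nonneg h0] at h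
    exact key φ h0 h
  · rw [abs_of_nonpos h0] at h
    have := key (-φ) (by linarith) h
    rw [halfCos_neg, halfSin_neg, neg_div, Real.cos_neg, Real.sin_neg, Real.sin_neg, abs_neg,
      neg_sub_neg, abs_sub_comm (Real.sin _)] at this
    exact this

/-- For `x = cos φ ≥ 0` the truncations lie between `0` and `cos (φ / 2)`, `sin (φ / 2)`, whose
squares sum to one. For `x ≤ 0` use parity. -/
lemma halfAngle_le (N : ℕ) {x : ℝ} (hx : x ∈ Set.Icc (-1 : ℝ) 1) :
    (halfAngleP N).eval x ^ 2 + (1 - x ^ 2) * (halfAngleQ N).eval x ^ 2 ≤ 1 := by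
  have key : ∀ x : ℝ, 0 ≤ x → x ≤ 1 →
      (halfAngleP N).eval x ^ 2 + (1 - x ^ 2) * (halfAngleQ N).eval x ^ 2 ≤ 1 := by
    intro x h0 h1
    obtain ⟨φ, hφ0, hφ1, rfl⟩ : ∃ φ : ℝ, 0 ≤ φ ∧ φ ≤ Real.pi / 2 ∧ Real.cos φ = x :=
      ⟨Real.arccos x, Real.arccos_nonneg x, Real.arccos_le_pi_div_two.2 h0,
        Real.cos_arccos (by linarith) h1⟩
    have e : 1 - Real.cos φ ^ 2 = Real.sin φ ^ 2 := by linarith [Real.sin_sq_add_cos_sq φ]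
    rw [e, ← mul_pow, eval_halfAngleP, eval_halfAngleQ]
    obtain ⟨⟨a, _⟩, c, _⟩ := half_bounds N hφ0 hφ1
    have hs : 0 ≤ Real.sin φ :=
      Real.sin_nonneg_of_nonneg_of_le_pi hφ0 (by linarith [Real.pi_pos])
    have hc : 0 ≤ halfCos N φ := Finset.sum_nonneg fun k _ => mul_nonneg (mul_nonneg (mul_nonneg
      (by positivity) (halfCoeff_nonneg k)) (pow_nonneg hs _)) h0
    have hs' : 0 ≤ halfSin N φ := Finset.sum_nonneg fun k _ =>
      mul_nonneg (halfCoeff_nonneg k) (pow_nonneg hs _)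
    have := Real.sin_sq_add_cos_sq (φ / 2)
    nlinarith
  rcases le_total 0 x with h0 | h0
  · exact key x h0 hx.2
  · have := key (-x) (by linarith) (by linarith [hx.1])
    have e1 : (halfAngleP N).eval (-x) = -(halfAngleP N).eval x := by
      simp [halfAngleP, eval_finsetSum]
    have e2 : (halfAngleQ N).eval (-x) = (halfAngleQ N).eval x := by
      simp [halfAngleQ, eval_finsetSum]
    rwa [e1, e2, neg_sq, neg_sq] at this

/-! ## An odd polynomial that approximates the sign -/

/-- The polynomial `sin² (n t) / sin² t` in `sin t`. -/
def fejer : ℕ → ℝ[X]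
  | 0 => 0
  | 1 => 1
  | n + 2 => (C 2 - C 4 * X ^ 2) * fejer (n + 1) - fejer n + C 2

lemma par_fejer : ∀ n, Par (2 * n) (fejer n)
  | 0 => par_zero
  | 1 => par_one.mono_two
  | n + 2 => by
    have h2 : Par 2 (C 2 - C 4 * X ^ 2 : ℝ[X]) := by
      rw [sub_eq_add_neg]
      refine Par.add ?_ (Par.neg (Par.C_mul _ (by simpa using par_X.pow 2)))
      simpa using ((par_one (R := ℝ)).C_mul 2).mono_two
    have hC : Par (2 * (n + 2)) (C 2 : ℝ[X]) := by
      simpa using ((par_one (R := ℝ)).C_mul 2).mono (n + 2)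
    rw [fejer, sub_eq_add_neg]
    refine ((Par.add ?_ ?_)).add hC
    · have := h2.mul (par_fejer (n + 1))
      rwa [show 2 + 2 * (n + 1) = 2 * (n + 2) by ring] at this
    · have := ((par_fejer n).mono 2).neg
      rwa [show 2 * n + 2 * 2 = 2 * (n + 2) by ring] at this

/-- The recursion is `sin²(u + t) + sin²(u - t) = (2 - 4 sin² t) sin² u + 2 sin² t` with `u = (n +
1) t`. -/
lemma eval_fejer (t : ℝ) : ∀ n : ℕ,
    Real.sin t ^ 2 * (fejer n).eval (Real.sin t) = Real.sin (n * t) ^ 2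
  | 0 => by simp [fejer]
  | 1 => by simp [fejer]
  | n + 2 => by
    have h1 := eval_fejer t (n + 1)
    have h0 := eval_fejer t n
    simp only [fejer, eval_add, eval_sub, eval_mul, eval_C, eval_pow, eval_X]
    have e : Real.sin t ^ 2 * ((2 - 4 * Real.sin t ^ 2) * (fejer (n + 1)).eval (Real.sin t) -
        (fejer n).eval (Real.sin t) + 2) = (2 - 4 * Real.sin t ^ 2) *
        Real.sin ((n + 1 : ℕ) * t) ^ 2 - Real.sin (n * t) ^ 2 + 2 * Real.sin t ^ 2 := by
      rw [← h1, ← h0]; ring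
    rw [e]
    have a1 : ((n + 2 : ℕ) : ℝ) * t = (n + 1 : ℕ) * t + t := by push_cast; ring
    have a2 : (n : ℝ) * t = (n + 1 : ℕ) * t - t := by push_cast; ring
    rw [a1, a2, Real.sin_add, Real.sin_sub]
    generalize ((n + 1 : ℕ) : ℝ) * t = u
    have c1 : Real.cos t ^ 2 = 1 - Real.sin t ^ 2 := by linarith [Real.sin_sq_add_cos_sq t]
    have c2 : Real.cos u ^ 2 = 1 - Real.sin u ^ 2 := by linarith [Real.sin_sq_add_cos_sq u]
    linear_combination (-2 * Real.sin u ^ 2) * c1 - 2 * Real.sin t ^ 2 * c2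

/-- An odd polynomial with values in `[-1, 1]` that is bounded below by a constant on
`[1 / N, 1]`. -/
def coarseSign (N : ℕ) : ℝ[X] :=
  C (1 / 7) * (X * ∑ n ∈ Finset.Icc 1 N, C (1 / (n : ℝ) ^ 2) * fejer n)

lemma par_coarseSign (N : ℕ) : Par (2 * N + 1) (coarseSign N) := by
  rw [add_comm]
  refine Par.C_mul _ (par_X.mul (Par.sum fun n hn => Par.C_mul _ ?_))
  have := (par_fejer n).mono (N - n)
  rw [Finset.mem_Icc] at hn
  rwa [show 2 * n + 2 * (N - n) = 2 * N by omega] at this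

/-- The terms are at most `t²`, which is used up to `n ≈ 1 / t`, and at most `1 / n²`, which is used
beyond and telescopes. Both ranges contribute order `t`. -/
lemma sum_sin_sq_le {t : ℝ} (h0 : 0 < t) (h1 : t ≤ 2) (N : ℕ) :
    ∑ n ∈ Finset.Icc 1 N, Real.sin (n * t) ^ 2 / (n : ℝ) ^ 2 ≤ 4 * t := by
  set M : ℕ := ⌈1 / t⌉₊ with hM
  have hM0 : 0 < M := Nat.ceil_pos.2 (by positivity)
  have hM1 : 1 / t ≤ M := Nat.le_ceil _
  have hM2 : (M : ℝ) ≤ 1 / t + 1 := (Nat.ceil_lt_add_one (by positivity)).le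
  have hMp : (0 : ℝ) < M := by exact_mod_cast hM0
  have hMt : (M : ℝ) * t ^ 2 ≤ t + t ^ 2 := by
    have := mul_le_mul_of_nonneg_right hM2 (sq_nonneg t)
    have e : (1 / t + 1) * t ^ 2 = t + t ^ 2 := by field_simp
    linarith
  have hMi : 1 / (M : ℝ) ≤ t := by
    rw [div_le_iff₀ hMp]; rw [div_le_iff₀ h0] at hM1; linarith
  have hterm : ∀ n : ℕ, 1 ≤ n → Real.sin (n * t) ^ 2 / (n : ℝ) ^ 2 ≤ t ^ 2 := fun n hn => by
    have hn' : (0 : ℝ) < n := by exact_mod_cast hn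
    rw [div_le_iff₀ (by positivity), ← mul_pow, sq_le_sq, mul_comm t]
    exact Real.abs_sin_le_abs
  have hA : ∀ N ≤ M, ∑ n ∈ Finset.Icc 1 N, Real.sin (n * t) ^ 2 / (n : ℝ) ^ 2 ≤ M * t ^ 2 := by
    intro N hN
    calc _ ≤ ∑ n ∈ Finset.Icc 1 N, t ^ 2 :=
          Finset.sum_le_sum fun n hn => hterm n (Finset.mem_Icc.1 hn).1
      _ = N * t ^ 2 := by simp
      _ ≤ M * t ^ 2 := by gcongr
  have hB : ∀ N ≥ M, ∑ n ∈ Finset.Icc 1 N, Real.sin (n * t) ^ 2 / (n : ℝ) ^ 2 ≤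
      M * t ^ 2 + (1 / M - 1 / N) := by
    intro N hN
    induction N, hN using Nat.le_induction with
    | base => simpa using hA M le_rfl
    | succ N hN ih =>
      rw [Finset.sum_Icc_succ_top (by omega)]
      have hNp : (0 : ℝ) < N := by exact_mod_cast lt_of_lt_of_le hM0 hN
      have : Real.sin ((N + 1 : ℕ) * t) ^ 2 / ((N + 1 : ℕ) : ℝ) ^ 2 ≤
          1 / N - 1 / (N + 1 : ℕ) := by
        push_cast
        have e : 1 / (N : ℝ) - 1 / (N + 1) = (1 + 1 / N) / (N + 1) ^ 2 := by field_simp; ring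
        rw [e]
        gcongr
        have := Real.sin_sq_le_one ((N + 1) * t)
        have : 0 ≤ 1 / (N : ℝ) := by positivity
        linarith
      linarith
  rcases le_total N M with h | h
  · have := hA N h
    nlinarith
  · have := hB N h
    have : 0 ≤ 1 / (N : ℝ) := by positivity
    nlinarith

lemma eval_coarseSign (t : ℝ) (N : ℕ) :
    (coarseSign N).eval (Real.sin t) * Real.sin t =
      1 / 7 * ∑ n ∈ Finset.Icc 1 N, Real.sin (n * t) ^ 2 / (n : ℝ) ^ 2 := by
  simp only [coarseSign, eval_mul, eval_C, eval_X, eval_finsetSum, mul_assoc]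
  congr 1
  rw [mul_left_comm, mul_comm, mul_assoc, ← mul_assoc, ← sq, Finset.mul_sum]
  refine Finset.sum_congr rfl fun n _ => ?_
  rw [mul_left_comm, eval_fejer]
  ring

lemma coarseSign_neg (N : ℕ) (x : ℝ) : (coarseSign N).eval (-x) = -(coarseSign N).eval x := by
  have h : ∀ n, (fejer n).eval (-x) = (fejer n).eval x := by
    intro n
    induction n using Nat.strong_induction_on with
    | _ n ih =>
      match n, ih with
      | 0, _ => simp [fejer]
      | 1, _ => simp [fejer]
      | n + 2, ih => simp [fejer, ih n (by omega), ih (n + 1) (by omega)]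
  simp [coarseSign, eval_finsetSum, h]

/-- The sum of `sin²(nt) / n²` is comparable to `t`, hence to `sin t`. Above, `4t ≤ 2π sin t < 7 sin
t` explains the factor `1 / 7`. Below, for `t ≤ 1` the first `⌊1 / t⌋` terms are at least `t² / 4`
each, and for `t ≥ 1` the first term suffices; either way the sum is at least `sin t / 8`, and `56 =
7 * 8`. -/
lemma coarseSign_bounds (N : ℕ) {x : ℝ} (h0 : 0 < x) (h1 : x ≤ 1) :
    0 ≤ (coarseSign N).eval x ∧ (coarseSign N).eval x ≤ 1 ∧
      (1 ≤ N * x → 1 / 56 ≤ (coarseSign N).eval x) := by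
  obtain ⟨t, ht0, ht1, rfl⟩ : ∃ t : ℝ, 0 < t ∧ t ≤ Real.pi / 2 ∧ Real.sin t = x :=
    ⟨Real.arcsin x, Real.arcsin_pos.2 h0, Real.arcsin_le_pi_div_two x,
      Real.sin_arcsin (by linarith) h1⟩
  have e := eval_coarseSign t N
  have hpi := Real.pi_le_four
  have hpi' := Real.pi_pos
  have hjordan : 2 / Real.pi * t ≤ Real.sin t := Real.mul_le_sin ht0.le ht1
  have hjordan : t ≤ Real.pi / 2 * Real.sin t := by
    have := mul_le_mul_of_nonneg_left hjordan (show (0 : ℝ) ≤ Real.pi / 2 by positivity)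
    have e : Real.pi / 2 * (2 / Real.pi * t) = t := by field_simp
    linarith
  have hpi3 : Real.pi < 3.15 := Real.pi_lt_d2
  have hsum0 : 0 ≤ ∑ n ∈ Finset.Icc 1 N, Real.sin (n * t) ^ 2 / (n : ℝ) ^ 2 :=
    Finset.sum_nonneg fun n _ => by positivity
  have hle := sum_sin_sq_le ht0 (by linarith) N
  refine ⟨?_, ?_, fun hN => ?_⟩
  · by_contra hcon
    push Not at hcon
    nlinarith
  · by_contra hcon
    push Not at hcon
    nlinarith
  · have hsle : Real.sin t ≤ t := Real.sin_le ht0.le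
    suffices h : 1 / 8 * Real.sin t ≤
        ∑ n ∈ Finset.Icc 1 N, Real.sin (n * t) ^ 2 / (n : ℝ) ^ 2 by
      rw [← mul_le_mul_iff_left₀ h0, e]; linarith
    have hN0 : 1 ≤ N := by
      rcases Nat.eq_zero_or_pos N with h | h
      · subst h; simp at hN; linarith
      · exact h
    rcases le_total t 1 with ht | ht
    · set M : ℕ := ⌊1 / t⌋₊ with hM
      have hM1 : (M : ℝ) ≤ 1 / t := Nat.floor_le (by positivity)
      have hM2 : 1 / t < M + 1 := Nat.lt_floor_add_one _
      have hM0 : 1 ≤ M := Nat.le_floor (by rw [Nat.cast_one, le_div_iff₀ ht0]; linarith)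
      have hM0' : (1 : ℝ) ≤ M := by exact_mod_cast hM0
      have hMN : M ≤ N := by
        have : (M : ℝ) ≤ N := hM1.trans (by rw [div_le_iff₀ ht0]; nlinarith)
        exact_mod_cast this
      have hMt : 1 / 2 ≤ M * t := by
        rw [div_lt_iff₀ ht0] at hM2
        nlinarith
      calc 1 / 8 * Real.sin t ≤ M * (t ^ 2 / 4) := by nlinarith
        _ = ∑ n ∈ Finset.Icc 1 M, t ^ 2 / 4 := by simp
        _ ≤ ∑ n ∈ Finset.Icc 1 M, Real.sin (n * t) ^ 2 / (n : ℝ) ^ 2 := by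
          refine Finset.sum_le_sum fun n hn => ?_
          rw [Finset.mem_Icc] at hn
          have hn1 : (1 : ℝ) ≤ n := by exact_mod_cast hn.1
          have hnM : (n : ℝ) ≤ M := by exact_mod_cast hn.2
          have hnt : n * t ≤ 1 := by
            have := hnM.trans hM1
            rwa [le_div_iff₀ ht0] at this
          have hj := Real.mul_le_sin (show 0 ≤ n * t by positivity) (by linarith [Real.pi_gt_three])
          have h2 : (n : ℝ) * t / 2 ≤ Real.sin (n * t) := by
            refine le_trans ?_ hj
            rw [div_mul_eq_mul_div, le_div_iff₀ hpi']
            nlinarith [show 0 ≤ n * t by positivity]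
          rw [le_div_iff₀ (by positivity)]
          have h3 := pow_le_pow_left₀ (by positivity) h2 2
          linarith [h3, show (n * t / 2) ^ 2 = t ^ 2 / 4 * (n : ℝ) ^ 2 by ring]
        _ ≤ _ := Finset.sum_le_sum_of_subset_of_nonneg
          (Finset.Icc_subset_Icc_right hMN) fun n _ _ => by positivity
    · have hs : 1 / 2 ≤ Real.sin t := by nlinarith
      calc 1 / 8 * Real.sin t ≤ Real.sin t ^ 2 := by nlinarith
        _ = ∑ n ∈ Finset.Icc (1 : ℕ) 1, Real.sin (n * t) ^ 2 / (n : ℝ) ^ 2 := by simp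
        _ ≤ _ := Finset.sum_le_sum_of_subset_of_nonneg
          (Finset.Icc_subset_Icc_right hN0) fun n _ _ => by positivity

end QGadget
end

noncomputable section

namespace QGadget

open Polynomial
open scoped Matrix.Norms.L2Operator

/-! ## Lengths of the sequences -/

/-- With `m = 2N + 1`, `c ^ m ≤ e^{-δm}`. One half of the exponent absorbs the factor `m`, since `m
≤ 2δ⁻¹ e^{δm/2}`; the other half brings the error below the target. -/
lemma exists_decay {δ η : ℝ} (hδ : 0 < δ) (hδ1 : δ ≤ 1) (hη : 0 < η) (hη1 : η ≤ 1) :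
    ∃ N : ℕ, (2 * N + 1 : ℝ) ≤ 21 * (δ⁻¹ * Real.log (2 / (η * δ))) ∧
      ∀ c : ℝ, 0 ≤ c → c ≤ 1 - δ → 4 * (2 * N + 1) * c ^ (2 * N + 1) ≤ η / 2 := by
  have hηδ : η * δ ≤ 1 := mul_le_one₀ hη1 hδ.le hδ1
  have hηδ0 : 0 < η * δ := mul_pos hη hδ
  set L : ℝ := Real.log (2 / (η * δ)) with hL
  have hL2 : Real.log 2 ≤ L := by
    refine Real.log_le_log two_pos ?_
    rw [le_div_iff₀ hηδ0]; linarith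
  have hl2 : 0.69 < Real.log 2 := by linarith [Real.log_two_gt_d9]
  set E : ℝ := Real.log (16 / (η * δ)) with hE
  have hEL : E ≤ 4 * L := by
    have : E = 3 * Real.log 2 + L := by
      rw [hE, hL, show 16 / (η * δ) = 2 ^ 3 * (2 / (η * δ)) by ring,
        Real.log_mul (by positivity) (by positivity), Real.log_pow]
      norm_num
    linarith
  have hE0 : 0 ≤ E := Real.log_nonneg (by rw [le_div_iff₀ hηδ0]; linarith)
  have hδi : 1 ≤ δ⁻¹ := (one_le_inv₀ hδ).2 hδ1
  set N : ℕ := ⌈2 * δ⁻¹ * E⌉₊ with hN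
  have hN1 : 2 * δ⁻¹ * E ≤ N := Nat.le_ceil _
  have hN2 : (N : ℝ) ≤ 2 * δ⁻¹ * E + 1 := (Nat.ceil_lt_add_one (by positivity)).le
  refine ⟨N, ?_, fun c hc0 hc1 => ?_⟩
  -- `2N + 1 ≤ 4δ⁻¹E + 3 ≤ 16δ⁻¹L + 3`, and `3 ≤ 5L` because `L ≥ log 2`; this gives `21`.
  · have h1 : δ⁻¹ * E ≤ δ⁻¹ * (4 * L) := mul_le_mul_of_nonneg_left hEL (by positivity)
    have h2 : L ≤ δ⁻¹ * L := le_mul_of_one_le_left (by linarith) hδi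
    nlinarith
  · have h1 : c ^ (2 * N + 1) ≤ Real.exp (-(δ * (2 * N + 1))) := by
      calc c ^ (2 * N + 1) ≤ (Real.exp (-δ)) ^ (2 * N + 1) :=
            pow_le_pow_left₀ hc0 (hc1.trans (by linarith [Real.add_one_le_exp (-δ)])) _
        _ = Real.exp (-(δ * (2 * N + 1))) := by
            rw [← Real.exp_nat_mul]; push_cast; ring_nf
    set m : ℝ := 2 * N + 1 with hm
    have hm0 : 0 < m := by positivity
    have h2 : m ≤ 2 * δ⁻¹ * Real.exp (δ * m / 2) := by
      have := Real.add_one_le_exp (δ * m / 2)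
      have h3 : 2 * δ⁻¹ * (δ * m / 2) ≤ 2 * δ⁻¹ * Real.exp (δ * m / 2) :=
        mul_le_mul_of_nonneg_left (by linarith) (by positivity)
      have e : 2 * δ⁻¹ * (δ * m / 2) = m := by field_simp
      linarith
    have h3 : Real.exp (-(δ * m / 2)) ≤ η * δ / 16 := by
      have : E ≤ δ * m / 2 := by
        have h4 : δ * (2 * δ⁻¹ * E) ≤ δ * m := mul_le_mul_of_nonneg_left
          (by rw [hm]; linarith [(Nat.cast_nonneg N : (0 : ℝ) ≤ N)]) hδ.le
        have e : δ * (2 * δ⁻¹ * E) = 2 * E := by field_simp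
        linarith
      calc Real.exp (-(δ * m / 2)) ≤ Real.exp (-E) := Real.exp_le_exp.2 (by linarith)
        _ = η * δ / 16 := by
          rw [Real.exp_neg, hE, Real.exp_log (by positivity), inv_div]
    calc 4 * m * c ^ (2 * N + 1)
        ≤ 4 * (2 * δ⁻¹ * Real.exp (δ * m / 2)) * Real.exp (-(δ * m)) := by gcongr
      _ = 8 * δ⁻¹ * Real.exp (-(δ * m / 2)) := by
          have : Real.exp (-(δ * m)) = Real.exp (-(δ * m / 2)) * Real.exp (-(δ * m / 2)) := by
            rw [← Real.exp_add]; ring_nf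
          have h5 : Real.exp (δ * m / 2) * Real.exp (-(δ * m / 2)) = 1 := by
            rw [← Real.exp_add]; simp
          rw [this]; linear_combination 8 * δ⁻¹ * Real.exp (-(δ * m / 2)) * h5
      _ ≤ 8 * δ⁻¹ * (η * δ / 16) := by gcongr
      _ = η / 2 := by field_simp; ring

/-- Used with `y ≥ 2`: constants and powers inside a logarithm are absorbed by a power of `y`, hence
by a constant factor outside. -/
lemma log_le_of_le_pow {x y : ℝ} (k : ℕ) (hx : 0 < x) (h : x ≤ y ^ k) :
    Real.log x ≤ k * Real.log y := by
  rw [← Real.log_pow]; exact Real.log_le_log hx h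

/-- The phase rotations commute with the twist, so the inner twists cancel between consecutive
queries and only the outermost ones survive. -/
lemma seq_conj (φ : ℕ → ℝ) (α θ : ℝ) (n : ℕ) :
    seq φ (twist α θ) n = rotZ (α / 2) * seq φ (rotX θ) n * rotZ (-(α / 2)) := by
  induction n with
  | zero =>
    simp only [seq, alt, rotZ_mul]; congr 1; ring
  | succ n ih =>
    have h1 : rotZ (-(α / 2)) * rotZ (α / 2) = 1 := by rw [rotZ_mul]; simp [rotZ_zero]
    have h2 : rotZ (-(α / 2)) * rotZ (φ (n + 1)) = rotZ (φ (n + 1)) * rotZ (-(α / 2)) := by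
      rw [rotZ_mul, rotZ_mul, add_comm]
    have e : ∀ U, seq φ U (n + 1) = seq φ U n * U * rotZ (φ (n + 1)) := fun U => rfl
    rw [e, e, ih, twist]
    simp only [mul_assoc]
    rw [← h2]
    simp only [← mul_assoc _ (rotZ (α / 2)), h1, one_mul]

lemma norm_seq_twist_sub_le (φ : ℕ → ℝ) (α θ : ℝ) (n : ℕ) {r : ℝ}
    (h : ‖seq φ (rotX θ) n - quat 0 1‖ ≤ r) :
    ‖seq φ (twist α θ) n - quat 0 (Complex.exp (Complex.I * α))‖ ≤ r := by
  have e : quat 0 (Complex.exp (Complex.I * α)) =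
      rotZ (α / 2) * quat 0 1 * rotZ (-(α / 2)) := by
    have := twist_eq_quat α (Real.pi / 2)
    rw [twist, rotX_eq_quat] at this
    simpa using this.symm
  rw [seq_conj, e, ← sub_mul, ← mul_sub]
  calc _ ≤ ‖rotZ (α / 2)‖ * ‖seq φ (rotX θ) n - quat 0 1‖ * ‖rotZ (-(α / 2))‖ :=
        (norm_mul_le _ _).trans (mul_le_mul_of_nonneg_right (norm_mul_le _ _) (norm_nonneg _))
    _ ≤ 1 * r * 1 := by
        have h1 := norm_le_one_of_mem (rotZ_mem (α / 2))
        have h2 := norm_le_one_of_mem (rotZ_mem (-(α / 2)))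
        gcongr
        linarith [norm_nonneg (seq φ (rotX θ) n - quat 0 1)]
    _ = r := by ring

lemma parQ_invSqrt_comp (N : ℕ) : ParQ (2 * N + 1) ((invSqrtPoly N).comp (X ^ 2)) := by
  rw [parQ_iff, add_comm]
  refine par_X.mul ?_
  rw [invSqrtPoly, Polynomial.sum_comp]
  refine Par.sum fun k hk => ?_
  simp only [mul_comp, C_comp, X_pow_comp, ← pow_mul]
  refine Par.C_mul _ ?_
  rw [Finset.mem_range] at hk
  have := ((par_X (R := ℝ)).pow (2 * k)).mono (N - k)
  rwa [show 2 * k * 1 + 2 * (N - k) = 2 * N by omega] at this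

lemma sq_le_one_of {a : ℝ} (h0 : 0 ≤ a) (h1 : a ≤ 1) : a ^ 2 ≤ 1 := by nlinarith

lemma one_sub_sq_mul_invSqrt_sq_le (N : ℕ) {x : ℝ} (hx : x ∈ Set.Icc (-1 : ℝ) 1) :
    (1 - x ^ 2) * (invSqrtPoly N).eval (x ^ 2) ^ 2 ≤ 1 := by
  have h : 0 ≤ 1 - x ^ 2 := by nlinarith [hx.1, hx.2]
  have e := Real.sq_sqrt h
  obtain ⟨h1, -⟩ := mul_invSqrtPoly_bounds N (Real.sqrt_nonneg (1 - x ^ 2))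
    (show √(1 - x ^ 2) ^ 2 + x ^ 2 = 1 by rw [e]; ring)
  rw [← e, ← mul_pow]
  exact sq_le_one_of (mul_nonneg (Real.sqrt_nonneg _)
    (eval_invSqrtPoly_nonneg N (sq_nonneg x))) h1

lemma abs_le_one_sub {c δ : ℝ} (h : c ∈ Set.Icc (-1 + δ) (1 - δ)) : |c| ≤ 1 - δ :=
  abs_le.2 ⟨by linarith [h.1], h.2⟩

/-- The sequence that amplifies the off-diagonal entries of `e^{iφσ_z/2} e^{iθσ_x} e^{-iφσ_z/2}`
to modulus one without changing their phase. -/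
theorem exists_amplification : ∃ K : ℝ, 0 < K ∧ ∀ ε δ : ℝ, 0 < ε → ε ≤ 1 → 0 < δ → δ ≤ 1 →
    ∃ (n : ℕ) (φ : ℕ → ℝ), (n : ℝ) ≤ K * (δ⁻¹ * Real.log (2 / (ε * δ))) ∧
      ∀ α θ : ℝ, θ ∈ Set.Icc 0 Real.pi → Real.cos θ ∈ Set.Icc (-1 + δ) (1 - δ) →
        ‖seq φ (twist α θ) n - quat 0 (Complex.exp (Complex.I * α))‖ ≤ ε := by
  refine ⟨84, by norm_num, fun ε δ hε hε1 hδ hδ1 => ?_⟩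
  -- `exists_phases_approx` bounds the squared distance by `8η`.
  have hη : 0 < ε ^ 2 / 8 := by positivity
  have hη1 : ε ^ 2 / 8 < 1 := by nlinarith
  obtain ⟨N, hN, hdec⟩ := exists_decay hδ hδ1 hη hη1.le
  obtain ⟨φ, hφ⟩ := exists_phases_approx (n := 2 * N + 1) par_zero (parQ_invSqrt_comp N)
    (fun x hx => by simpa using one_sub_sq_mul_invSqrt_sq_le N hx) hη hη1
  refine ⟨2 * N + 1, φ, ?_, fun α θ hθ hc => ?_⟩
  · have h1 : Real.log (2 / (ε ^ 2 / 8 * δ)) ≤ (4 : ℕ) * Real.log (2 / (ε * δ)) := by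
      refine log_le_of_le_pow 4 (by positivity) ?_
      rw [div_pow, div_le_div_iff₀ (by positivity) (by positivity)]
      have : ε ^ 4 * δ ^ 4 ≤ ε ^ 2 * δ := mul_le_mul
        (pow_le_pow_of_le_one hε.le hε1 (by norm_num))
        (by simpa using pow_le_pow_of_le_one hδ.le hδ1 (show 1 ≤ 4 by norm_num))
        (by positivity) (by positivity)
      nlinarith
    push_cast at h1 ⊢
    have := mul_le_mul_of_nonneg_left h1 (show 0 ≤ δ⁻¹ by positivity)
    linarith
  · refine norm_seq_twist_sub_le φ α θ _ ?_
    have hs : 0 ≤ Real.sin θ := Real.sin_nonneg_of_mem_Icc hθ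
    obtain ⟨h1, h2⟩ := mul_invSqrtPoly_bounds N hs (Real.sin_sq_add_cos_sq θ)
    have h3 := hdec _ (abs_nonneg _) (abs_le_one_sub hc)
    have hp : 0 ≤ (2 * (N : ℝ) + 1) * |Real.cos θ| ^ (2 * N + 1) := by positivity
    have := hφ θ 0 1 (by norm_num) (by simpa using hη.le) (by
      rw [eval_comp, eval_pow, eval_X, abs_sub_comm, abs_of_nonneg (by linarith)]
      linarith)
    rw [show 8 * (ε ^ 2 / 8) = ε ^ 2 by ring] at this
    simpa using (sq_le_sq₀ (norm_nonneg _) hε.le).1 this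

/-- The composition of `coarseSign` with the truncated power series of `z / √(1 - (1 - z²))`. -/
def fineSign (M N : ℕ) : ℝ[X] :=
  coarseSign M * (invSqrtPoly N).comp (1 - coarseSign M ^ 2)

lemma par_fineSign (M N : ℕ) : Par ((2 * M + 1) * (2 * N + 1)) (fineSign M N) := by
  have h2 : Par (2 * (2 * M + 1)) (1 - coarseSign M ^ 2) := by
    rw [sub_eq_add_neg]
    exact Par.add (by simpa using (par_one (R := ℝ)).mono (2 * M + 1))
      ((par_coarseSign M).pow 2).neg
  have h3 : Par (2 * N * (2 * M + 1)) ((invSqrtPoly N).comp (1 - coarseSign M ^ 2)) := by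
    rw [invSqrtPoly, Polynomial.sum_comp]
    refine Par.sum fun k hk => ?_
    simp only [mul_comp, C_comp, X_pow_comp]
    refine Par.C_mul _ ?_
    rw [Finset.mem_range] at hk
    have := (h2.pow k).mono ((N - k) * (2 * M + 1))
    obtain ⟨j, rfl⟩ : ∃ j, N = k + j := ⟨N - k, by omega⟩
    rw [Nat.add_sub_cancel_left] at this
    convert this using 1
    ring
  have := (par_coarseSign M).mul h3
  rwa [show 2 * M + 1 + 2 * N * (2 * M + 1) = (2 * M + 1) * (2 * N + 1) by ring] at this

lemma fineSign_neg (M N : ℕ) (x : ℝ) : (fineSign M N).eval (-x) = -(fineSign M N).eval x := by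
  simp [fineSign, eval_comp, coarseSign_neg]

/-- Sharpening applies `z ↦ z / √(1 - (1 - z²))` to a value `z` that is at least `1 / 56`. Its rate
of convergence is an absolute constant, so sharpening contributes only a logarithmic factor to the
degree. -/
lemma fineSign_bounds (M N : ℕ) {x : ℝ} (h0 : 0 < x) (h1 : x ≤ 1) :
    0 ≤ (fineSign M N).eval x ∧ (fineSign M N).eval x ≤ 1 ∧
      (1 ≤ M * x → 1 - (fineSign M N).eval x ≤
        2 * (2 * N + 1) * √(1 - 1 / 56 ^ 2) ^ (2 * N + 1)) := by
  obtain ⟨a, b, c⟩ := coarseSign_bounds M h0 h1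
  simp only [fineSign, eval_mul, eval_comp, eval_sub, eval_one, eval_pow]
  generalize (coarseSign M).eval x = z at *
  have hz : 0 ≤ 1 - z ^ 2 := by nlinarith
  obtain ⟨h2, h3⟩ := mul_invSqrtPoly_bounds N (c := √(1 - z ^ 2)) a
    (by rw [Real.sq_sqrt hz]; ring)
  rw [Real.sq_sqrt hz] at h2 h3
  refine ⟨mul_nonneg a (eval_invSqrtPoly_nonneg N hz), h2, fun hM => h3.trans ?_⟩
  rw [abs_of_nonneg (Real.sqrt_nonneg _)]
  gcongr
  have := c hM
  nlinarith

lemma fineSign_sq_le (M N : ℕ) {x : ℝ} (hx : x ∈ Set.Icc (-1 : ℝ) 1) :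
    (fineSign M N).eval x ^ 2 ≤ 1 := by
  rcases lt_trichotomy 0 x with h | h | h
  · obtain ⟨a, b, -⟩ := fineSign_bounds M N h hx.2
    exact sq_le_one_of a b
  · have := fineSign_neg M N x
    rw [← h, neg_zero] at this
    rw [← h, show (fineSign M N).eval 0 = 0 by linarith]; norm_num
  · obtain ⟨a, b, -⟩ := fineSign_bounds M N (neg_pos.2 h) (by linarith [hx.1])
    rw [fineSign_neg] at a b
    rw [← neg_sq]
    exact sq_le_one_of a b

/-- The analogue of `exists_amplification` with an even number of queries, for positive
`cos θ`. -/
theorem exists_even_amplification : ∃ K : ℝ, 0 < K ∧ ∀ ε δ : ℝ, 0 < ε → ε ≤ 1 → 0 < δ → δ ≤ 1 →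
    ∃ (n : ℕ) (φ : ℕ → ℝ), (((2 * n : ℕ) : ℝ)) ≤ K * (δ⁻¹ * Real.log (2 / (ε * δ))) ∧
      ∀ α θ : ℝ, θ ∈ Set.Icc 0 Real.pi → Real.cos θ ∈ Set.Icc δ (1 - δ) →
        ‖seq φ (twist α θ) (2 * n) - quat 0 (Complex.exp (Complex.I * α))‖ ≤ ε := by
  refine ⟨5 * (21 * (6272 * 17)) + 84, by norm_num, fun ε δ hε hε1 hδ hδ1 => ?_⟩
  have hη : 0 < ε ^ 2 / 8 := by positivity
  have hη1 : ε ^ 2 / 8 < 1 := by nlinarith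
  obtain ⟨N, hN, hdec⟩ := exists_decay hδ hδ1 hη hη1.le
  -- `6272 = 2 * 56²`, and `√(1 - 1 / 56²) ≤ 1 - 1 / (2 * 56²)`.
  obtain ⟨J, hJ, hdecJ⟩ := exists_decay (δ := 1 / 6272) (by norm_num) (by norm_num) hη hη1.le
  set M : ℕ := ⌈1 / δ⌉₊ with hM
  have hM1 : 1 / δ ≤ M := Nat.le_ceil _
  have hM2 : (M : ℝ) ≤ 1 / δ + 1 := (Nat.ceil_lt_add_one (by positivity)).le
  -- The odd factor is close to `1` where `cos θ ≥ δ` and flips the parity of the amplifying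
  -- polynomial. The total length, a sum of two odd numbers, is even.
  set q : ℝ[X] := fineSign M J * (invSqrtPoly N).comp (X ^ 2) with hq
  obtain ⟨n, hn⟩ : ∃ n, (2 * M + 1) * (2 * J + 1) + (2 * N + 1) = 2 * n :=
    ⟨2 * M * J + M + J + N + 1, by ring⟩
  have hqpar : ParQ (2 * n) q := by
    rw [← hn]; exact (par_fineSign M J).mul_parQ (parQ_invSqrt_comp N)
  have hqe : ∀ x, q.eval x = (fineSign M J).eval x * (invSqrtPoly N).eval (x ^ 2) := by
    intro x; simp [hq, eval_comp]
  obtain ⟨φ, hφ⟩ := exists_phases_approx (n := 2 * n) par_zero hqpar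
    (fun x hx => by
      have h1 := one_sub_sq_mul_invSqrt_sq_le N hx
      have h2 := fineSign_sq_le M J hx
      have h3 : 0 ≤ (1 - x ^ 2) * (invSqrtPoly N).eval (x ^ 2) ^ 2 :=
        mul_nonneg (by nlinarith [hx.1, hx.2]) (sq_nonneg _)
      rw [hqe]
      simp only [eval_zero]
      have := mul_le_one₀ h2 h3 h1
      linarith [this, show (fineSign M J).eval x ^ 2 * ((1 - x ^ 2) *
        (invSqrtPoly N).eval (x ^ 2) ^ 2) = (1 - x ^ 2) *
        ((fineSign M J).eval x * (invSqrtPoly N).eval (x ^ 2)) ^ 2 by ring]) hη hη1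
  refine ⟨n, φ, ?_, fun α θ hθ hc => ?_⟩
  · have hδi : 1 ≤ δ⁻¹ := (one_le_inv₀ hδ).2 hδ1
    have hεδ4 : ε ^ 4 * δ ^ 4 ≤ ε ^ 2 * δ := mul_le_mul
        (pow_le_pow_of_le_one hε.le hε1 (by norm_num))
        (by simpa using pow_le_pow_of_le_one hδ.le hδ1 (show 1 ≤ 4 by norm_num))
        (by positivity) (by positivity)
    have h1 : Real.log (2 / (ε ^ 2 / 8 * δ)) ≤ (4 : ℕ) * Real.log (2 / (ε * δ)) := by
      refine log_le_of_le_pow 4 (by positivity) ?_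
      rw [div_pow, div_le_div_iff₀ (by positivity) (by positivity)]
      nlinarith
    have h2 : Real.log (2 / (ε ^ 2 / 8 * (1 / 6272))) ≤ (17 : ℕ) * Real.log (2 / (ε * δ)) := by
      refine log_le_of_le_pow 17 (by positivity) ?_
      rw [div_pow, div_le_div_iff₀ (by positivity) (by positivity), mul_pow]
      have : ε ^ 17 * δ ^ 17 ≤ ε ^ 2 * 1 := mul_le_mul
        (pow_le_pow_of_le_one hε.le hε1 (by norm_num))
        (pow_le_one₀ hδ.le hδ1) (by positivity) (by positivity)
      nlinarith [sq_nonneg ε]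
    rw [← hn]
    push_cast at h1 h2 ⊢
    set L := Real.log (2 / (ε * δ)) with hL
    have hm : (2 * M + 1 : ℝ) ≤ 5 * δ⁻¹ := by rw [one_div] at hM2; linarith
    have hJ' : (2 * J + 1 : ℝ) ≤ 21 * (6272 * 17) * L := by
      refine hJ.trans ?_
      have : ((1 : ℝ) / 6272)⁻¹ = 6272 := by norm_num
      rw [this]; linarith
    have h3 := mul_le_mul hm hJ' (by positivity) (by positivity)
    have h4 := mul_le_mul_of_nonneg_left h1 (show 0 ≤ δ⁻¹ by positivity)
    linarith
  · refine norm_seq_twist_sub_le φ α θ _ ?_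
    have hs : 0 ≤ Real.sin θ := Real.sin_nonneg_of_mem_Icc hθ
    have hc0 : 0 < Real.cos θ := hδ.trans_le hc.1
    obtain ⟨h1, h2⟩ := mul_invSqrtPoly_bounds N hs (Real.sin_sq_add_cos_sq θ)
    have hb0 := mul_nonneg hs (eval_invSqrtPoly_nonneg N (sq_nonneg (Real.cos θ)))
    have h3 := hdec _ (abs_nonneg _) (abs_le_one_sub ⟨by linarith, hc.2⟩)
    have hp : 0 ≤ (2 * (N : ℝ) + 1) * |Real.cos θ| ^ (2 * N + 1) := by positivity
    obtain ⟨a, b, c⟩ := fineSign_bounds M J hc0 (Real.cos_le_one θ)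
    have h4 := c (by
      rw [div_le_iff₀ hδ] at hM1
      exact hM1.trans (mul_le_mul_of_nonneg_left hc.1 (Nat.cast_nonneg _)))
    have h5 := hdecJ (√(1 - 1 / 56 ^ 2)) (Real.sqrt_nonneg _)
      (by rw [Real.sqrt_le_left (by norm_num)]; norm_num)
    have hp' : 0 ≤ (2 * (J : ℝ) + 1) * √(1 - 1 / 56 ^ 2) ^ (2 * J + 1) := by positivity
    have := hφ θ 0 1 (by norm_num) (by simpa using hη.le) (by
      rw [hqe, mul_left_comm]
      generalize Real.sin θ * (invSqrtPoly N).eval (Real.cos θ ^ 2) = u at *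
      generalize (fineSign M J).eval (Real.cos θ) = v at *
      have : v * u ≤ 1 := mul_le_one₀ b hb0 h1
      rw [abs_sub_comm, abs_of_nonneg (by linarith)]
      nlinarith)
    rw [show 8 * (ε ^ 2 / 8) = ε ^ 2 by ring] at this
    simpa using (sq_le_sq₀ (norm_nonneg _) hε.le).1 this

/-- The sequence that halves the angle of a rotation. -/
theorem exists_half_angle : ∃ K : ℝ, 0 < K ∧ ∀ ε γ : ℝ, 0 < ε → ε ≤ 1 → 0 < γ → γ ≤ 1 →
    ∃ (n : ℕ) (φ : ℕ → ℝ), (n : ℝ) ≤ K * ((γ ^ 2)⁻¹ * Real.log (2 / (ε * γ))) ∧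
      ∀ α : ℝ, |α| ≤ Real.pi / 2 → γ ≤ Real.cos α →
        ‖seq φ (rotX α) n - rotX (α / 2)‖ ≤ ε := by
  refine ⟨210, by norm_num, fun ε γ hε hε1 hγ hγ1 => ?_⟩
  have hη : 0 < ε ^ 2 / 8 := by positivity
  have hη1 : ε ^ 2 / 8 < 1 := by nlinarith
  -- `cos α ≥ γ` gives `|sin α| ≤ √(1 - γ²) ≤ 1 - γ² / 2`.
  obtain ⟨N, hN, hdec⟩ := exists_decay (δ := γ ^ 2 / 2) (by positivity) (by nlinarith) hη hη1.le
  obtain ⟨φ, hφ⟩ := exists_phases_approx (par_halfAngleP N) (parQ_halfAngleQ N)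
    (fun x hx => halfAngle_le N hx) hη hη1
  refine ⟨2 * N + 1, φ, ?_, fun α hα hc => ?_⟩
  · have h1 : Real.log (2 / (ε ^ 2 / 8 * (γ ^ 2 / 2))) ≤ (5 : ℕ) * Real.log (2 / (ε * γ)) := by
      refine log_le_of_le_pow 5 (by positivity) ?_
      rw [div_pow, div_le_div_iff₀ (by positivity) (by positivity), mul_pow]
      have : ε ^ 5 * γ ^ 5 ≤ ε ^ 2 * γ ^ 2 := mul_le_mul
        (pow_le_pow_of_le_one hε.le hε1 (by norm_num))
        (pow_le_pow_of_le_one hγ.le hγ1 (by norm_num))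
        (by positivity) (by positivity)
      nlinarith
    push_cast at h1 ⊢
    have h2 := mul_le_mul_of_nonneg_left h1 (show 0 ≤ (γ ^ 2)⁻¹ by positivity)
    have e : (γ ^ 2 / 2)⁻¹ = 2 * (γ ^ 2)⁻¹ := by rw [inv_div]; ring
    rw [e] at hN
    linarith
  · have hsc := Real.sin_sq_add_cos_sq α
    have hs : |Real.sin α| ≤ 1 - γ ^ 2 / 2 := by
      refine abs_le_of_sq_le_sq ?_ (by nlinarith)
      nlinarith [sq_nonneg (γ ^ 2)]
    have h3 := hdec _ (abs_nonneg _) hs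
    obtain ⟨h1, h2⟩ := halfAngle_approx N hα
    have := hφ α (Real.cos (α / 2)) (Real.sin (α / 2))
      (by linarith [Real.sin_sq_add_cos_sq (α / 2)]) (by linarith) (by linarith)
    rw [show 8 * (ε ^ 2 / 8) = ε ^ 2 by ring, ← rotX_eq_quat] at this
    exact (sq_le_sq₀ (norm_nonneg _) hε.le).1 this

end QGadget
end

noncomputable section

namespace QGadget

open scoped Matrix.Norms.L2Operator

/-! ## Operators on the register -/

section Register

variable {m : ℕ}

/-- The operator that applies to qubit `q` a one-qubit operator that depends on the other
qubits. -/
def qmat (q : Fin (m + 1)) (A : Reg m → Mat2) : RegMat m :=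
  Matrix.of fun s t => if ∀ r, r ≠ q → s r = t r then A s (s q) (t q) else 0

lemma eq_update_of_agree {q : Fin (m + 1)} {s t : Reg m} (h : ∀ r, r ≠ q → s r = t r) :
    t = Function.update s q (t q) := by
  funext r
  by_cases hr : r = q
  · subst hr; simp
  · rw [Function.update_of_ne hr, h r hr]

lemma sum_agree (q : Fin (m + 1)) (s : Reg m) (f : Reg m → ℂ)
    (hf : ∀ u, ¬ (∀ r, r ≠ q → s r = u r) → f u = 0) :
    ∑ u, f u = ∑ v, f (Function.update s q v) := by
  symm
  refine Finset.sum_of_injOn (Function.update s q) ?_ (fun _ _ => Finset.mem_coe.2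
    (Finset.mem_univ _)) (fun u _ hu => hf u fun h => hu ?_) fun _ _ => rfl
  · exact (Function.update_injective s q).injOn
  · exact ⟨u q, by simp, (eq_update_of_agree h).symm⟩

/-- If `B` does not look at qubit `q`, the other qubits act as a fixed label and the one-qubit
operators multiply label by label. -/
lemma qmat_mul {q : Fin (m + 1)} {A B : Reg m → Mat2}
    (hB : ∀ s v, B (Function.update s q v) = B s) :
    qmat q A * qmat q B = qmat q fun s => A s * B s := by
  ext s t
  rw [Matrix.mul_apply, sum_agree q s]
  · have h1 : ∀ v, ∀ r, r ≠ q → s r = Function.update s q v r := fun v r hr => by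
      rw [Function.update_of_ne hr]
    have h2 : ∀ v, (∀ r, r ≠ q → Function.update s q v r = t r) ↔ ∀ r, r ≠ q → s r = t r :=
      fun v => forall₂_congr fun r hr => by rw [Function.update_of_ne hr]
    simp only [qmat, Matrix.of_apply, if_pos (h1 _), h2, hB, Function.update_self]
    split_ifs
    · rw [Matrix.mul_apply]
    · simp
  · intro u hu
    simp [qmat, if_neg hu]

lemma qmat_one (q : Fin (m + 1)) : qmat q (fun _ => 1) = 1 := by
  ext s t
  by_cases h : s = t
  · subst h; simp [qmat]
  · rw [Matrix.one_apply_ne h]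
    simp only [qmat, Matrix.of_apply]
    split_ifs with h1
    · refine Matrix.one_apply_ne fun h2 => h ?_
      rw [eq_update_of_agree h1, ← h2, Function.update_eq_self]
    · rfl

lemma qmat_conjTranspose {q : Fin (m + 1)} {A : Reg m → Mat2}
    (hA : ∀ s v, A (Function.update s q v) = A s) :
    (qmat q A).conjTranspose = qmat q fun s => (A s).conjTranspose := by
  ext s t
  simp only [qmat, Matrix.conjTranspose_apply, Matrix.of_apply]
  have h : (∀ r, r ≠ q → t r = s r) ↔ ∀ r, r ≠ q → s r = t r :=
    forall₂_congr fun r _ => eq_comm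
  simp only [h]
  split_ifs with h1
  · rw [eq_update_of_agree h1, hA]
  · simp

lemma qmat_mem_unitaryGroup {q : Fin (m + 1)} {A : Reg m → Mat2}
    (hA : ∀ s v, A (Function.update s q v) = A s)
    (h : ∀ s, A s ∈ Matrix.unitaryGroup (Fin 2) ℂ) :
    qmat q A ∈ Matrix.unitaryGroup (Reg m) ℂ := by
  rw [Matrix.mem_unitaryGroup_iff', Matrix.star_eq_conjTranspose, qmat_conjTranspose hA,
    qmat_mul hA, ← qmat_one q]
  congr 1
  funext s
  exact Matrix.mem_unitaryGroup_iff'.1 (h s)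

lemma onQubit_eq_qmat (q : Fin (m + 1)) (g : Mat2) : onQubit q g = qmat q fun _ => g := rfl

lemma controlled_eq_qmat {c q : Fin (m + 1)} (h : c ≠ q) (g : Mat2) :
    controlled c (onQubit q g) = qmat q fun s => if s c = 1 then g else 1 := by
  ext s t
  simp only [controlled, onQubit, qmat, Matrix.of_apply]
  by_cases h1 : ∀ r, r ≠ q → s r = t r
  · rw [if_pos h1, if_pos h1, h1 c h]
    split_ifs with h2 h3
    · rfl
    · rw [h3, Matrix.one_apply_eq]
    · rw [Matrix.one_apply_ne]
      intro h4
      apply h3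
      rw [eq_update_of_agree h1, ← h4, Function.update_eq_self]
  · rw [if_neg h1, if_neg h1]
    have : s ≠ t := by rintro rfl; exact h1 fun _ _ => rfl
    simp [this]

/-- The isometry that is given by an injective map into the basis states. -/
def emb (f : Fin 2 → Reg m) : Matrix (Reg m) (Fin 2) ℂ :=
  Matrix.of fun s j => if s = f j then 1 else 0

lemma mul_emb_apply (M : RegMat m) (f : Fin 2 → Reg m) (s : Reg m) (j : Fin 2) :
    (M * emb f) s j = M s (f j) := by
  simp [Matrix.mul_apply, emb]

lemma emb_mul_apply (f : Fin 2 → Reg m) (A : Mat2) (s : Reg m) (j : Fin 2) :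
    (emb f * A) s j = ∑ v, if s = f v then A v j else 0 := by
  simp [Matrix.mul_apply, emb]

lemma emb_conjTranspose_mul (f : Fin 2 → Reg m) (M : Matrix (Reg m) (Fin 2) ℂ) (i j : Fin 2) :
    ((emb f).conjTranspose * M) i j = M (f i) j := by
  simp [Matrix.mul_apply, emb, apply_ite star]

lemma emb_conjTranspose_mul_self {f : Fin 2 → Reg m} (hf : Function.Injective f) :
    (emb f).conjTranspose * emb f = 1 := by
  ext i j
  rw [emb_conjTranspose_mul]
  simp [emb, hf.eq_iff, Matrix.one_apply]

lemma norm_emb_le {f : Fin 2 → Reg m} (hf : Function.Injective f) : ‖emb f‖ ≤ 1 := by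
  have h := Matrix.l2_opNorm_conjTranspose_mul_self (emb f)
  rw [emb_conjTranspose_mul_self hf, CStarRing.norm_one] at h
  nlinarith [norm_nonneg (emb f)]

lemma ket_injective : Function.Injective (Circuit.ket m) := fun i j h => by
  simpa [Circuit.ket] using congrFun h 0

lemma Circuit.output_eq {e : ℕ} {υ : Type} (P : Circuit m e υ) (V : Fin e → Mat2)
    (Y : υ → Mat2) :
    P.output V Y = (emb (Circuit.ket m)).conjTranspose * (P.mat V Y * emb (Circuit.ket m)) := by
  ext i j
  rw [emb_conjTranspose_mul, mul_emb_apply]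
  rfl

/-- On the ancilla state `|0⟩`, the operator `X` acts as `A` on the target, up to an error `r`. -/
structure Sim (X : RegMat m) (A : Mat2) (r : ℝ) : Prop where
  norm_left : ‖X‖ ≤ 1
  norm_right : ‖A‖ ≤ 1
  close : ‖X * emb (Circuit.ket m) - emb (Circuit.ket m) * A‖ ≤ r

/-- Replace one factor at a time. The norm bounds carried by `Sim` keep the two errors from being
amplified, so they just add up. -/
lemma Sim.mul {X Y : RegMat m} {A B : Mat2} {r r' : ℝ} (h : Sim X A r) (h' : Sim Y B r') :
    Sim (X * Y) (A * B) (r + r') := by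
  refine ⟨(norm_mul_le _ _).trans (mul_le_one₀ h.1 (norm_nonneg _) h'.1),
    (norm_mul_le _ _).trans (mul_le_one₀ h.2 (norm_nonneg _) h'.2), ?_⟩
  have e : X * Y * emb (Circuit.ket m) - emb (Circuit.ket m) * (A * B) =
      (X * emb (Circuit.ket m) - emb (Circuit.ket m) * A) * B +
        X * (Y * emb (Circuit.ket m) - emb (Circuit.ket m) * B) := by
    rw [Matrix.sub_mul, Matrix.mul_sub]
    simp only [Matrix.mul_assoc]
    abel
  rw [e]
  refine (norm_add_le _ _).trans (add_le_add ?_ ?_)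
  · refine (Matrix.l2_opNorm_mul _ _).trans ((mul_le_of_le_one_right (norm_nonneg _) h'.2).trans
      h.3)
  · refine (Matrix.l2_opNorm_mul _ _).trans ((mul_le_of_le_one_left (norm_nonneg _) h.1).trans
      h'.3)

lemma Sim.mono {X : RegMat m} {A : Mat2} {r r' : ℝ} (h : Sim X A r) (hr : r ≤ r') :
    Sim X A r' := ⟨h.1, h.2, h.3.trans hr⟩

lemma Sim.one : Sim (1 : RegMat m) 1 0 :=
  ⟨norm_le_one_of_mem (one_mem _), norm_le_one_of_mem (one_mem _), by simp⟩

lemma Sim.prod_ofFn {n : ℕ} {X : Fin n → RegMat m} {A : Fin n → Mat2} {r : ℝ}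
    (h : ∀ k, Sim (X k) (A k) r) : Sim (List.ofFn X).prod (List.ofFn A).prod (n * r) := by
  induction n with
  | zero => simpa using Sim.one
  | succ n ih =>
    rw [List.ofFn_succ, List.ofFn_succ, List.prod_cons, List.prod_cons]
    refine ((h 0).mul (ih fun k => h k.succ)).mono ?_
    push_cast
    linarith

lemma onQubit_zero_mul_emb (g : Mat2) :
    (onQubit 0 g : RegMat m) * emb (Circuit.ket m) = emb (Circuit.ket m) * g := by
  ext s j
  rw [mul_emb_apply, emb_mul_apply]
  simp only [onQubit, Matrix.of_apply]
  have h0 : Circuit.ket m j 0 = j := by simp [Circuit.ket]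
  by_cases h : ∀ r, r ≠ 0 → s r = Circuit.ket m j r
  · have hs : ∀ v, s = Circuit.ket m v ↔ v = s 0 := by
      intro v
      constructor
      · intro h; rw [h]; simp [Circuit.ket]
      · rintro rfl
        funext r
        by_cases hr : r = 0
        · subst hr; simp [Circuit.ket]
        · rw [h r hr]; simp [Circuit.ket, hr]
    rw [if_pos h, h0]
    simp [hs]
  · rw [if_neg h]
    symm
    refine Finset.sum_eq_zero fun v _ => if_neg fun hs => h fun r hr => ?_
    rw [hs]; simp [Circuit.ket, hr]

lemma Sim.onQubit_zero {g : Mat2} (h : g ∈ Matrix.unitaryGroup (Fin 2) ℂ) :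
    Sim (onQubit 0 g : RegMat m) g 0 :=
  ⟨norm_le_one_of_mem (qmat_mem_unitaryGroup (fun _ _ => rfl) fun _ => h), norm_le_one_of_mem h,
    by rw [onQubit_zero_mul_emb]; simp⟩

lemma Sim.norm_output_sub_le {e : ℕ} {υ : Type} {P : Circuit m e υ} {V : Fin e → Mat2}
    {Y : υ → Mat2} {A : Mat2} {r : ℝ} (h : Sim (P.mat V Y) A r) : ‖P.output V Y - A‖ ≤ r := by
  have e1 : P.output V Y - A = (emb (Circuit.ket m)).conjTranspose *
      (P.mat V Y * emb (Circuit.ket m) - emb (Circuit.ket m) * A) := by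
    rw [Matrix.mul_sub, ← Circuit.output_eq, ← Matrix.mul_assoc _ _ A,
      emb_conjTranspose_mul_self ket_injective, Matrix.one_mul]
  rw [e1]
  refine (Matrix.l2_opNorm_mul _ _).trans ((mul_le_of_le_one_left (norm_nonneg _) ?_).trans h.3)
  rw [Matrix.l2_opNorm_conjTranspose]
  exact norm_emb_le ket_injective

end Register

/-! ## Operators selected by the target -/

section Select

variable {m : ℕ}

/-- `A` or `B` on the first ancilla, according to the state of the target. -/
def sel (A B : Mat2) : RegMat (m + 1) := qmat 1 fun s => if s 0 = 1 then B else A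

lemma sel_invariant (A B : Mat2) (s : Reg (m + 1)) (v : Fin 2) :
    (if Function.update s 1 v 0 = 1 then B else A) = if s 0 = 1 then B else A := by
  rw [Function.update_of_ne (by simp)]

lemma sel_mul (A B A' B' : Mat2) :
    (sel A B * sel A' B' : RegMat (m + 1)) = sel (A * A') (B * B') := by
  rw [sel, sel, qmat_mul (sel_invariant A' B'), sel]
  congr 1
  funext s
  split_ifs <;> rfl

lemma sel_self (A : Mat2) : (onQubit 1 A : RegMat (m + 1)) = sel A A := by
  rw [onQubit_eq_qmat, sel]; simp

lemma sel_one (B : Mat2) : (controlled 0 (onQubit 1 B) : RegMat (m + 1)) = sel 1 B :=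
  controlled_eq_qmat (by simp) B

lemma sel_mem {A B : Mat2} (hA : A ∈ Matrix.unitaryGroup (Fin 2) ℂ)
    (hB : B ∈ Matrix.unitaryGroup (Fin 2) ℂ) :
    (sel A B : RegMat (m + 1)) ∈ Matrix.unitaryGroup _ ℂ :=
  qmat_mem_unitaryGroup (sel_invariant A B) fun s => by split_ifs <;> assumption

/-- The two states of the target run two independent sequences on the ancilla. -/
lemma alt_sel (a b : ℕ → Mat2) (u v : Mat2) (n : ℕ) :
    alt (fun k => (sel (a k) (b k) : RegMat (m + 1))) (sel u v) n =
      sel (alt a u n) (alt b v n) := by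
  induction n with
  | zero => rfl
  | succ n ih => rw [alt, ih, sel_mul, sel_mul]; rfl

lemma norm_single_le : ‖(Matrix.single 0 1 1 : Mat2)‖ ≤ 1 := by
  have h := Matrix.l2_opNorm_conjTranspose_mul_self (Matrix.single 0 1 1 : Mat2)
  have e : (Matrix.single 0 1 1 : Mat2).conjTranspose * Matrix.single 0 1 1 =
      Matrix.diagonal ![0, 1] := by
    ext i j
    fin_cases i <;> fin_cases j <;> simp [Matrix.mul_apply, Matrix.single]
  rw [e, Matrix.l2_opNorm_diagonal] at h
  have h1 : ‖(![0, 1] : Fin 2 → ℂ)‖ ≤ 1 := by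
    rw [pi_norm_le_iff_of_nonneg zero_le_one]
    intro i; fin_cases i <;> simp
  nlinarith [norm_nonneg (Matrix.single 0 1 1 : Mat2)]

/-- If `M` multiplies the ancilla state `|0⟩` approximately by the phase `μ`, then `M` controlled
by the target is approximately the phase gate `diag(1, μ)` on the target. -/
lemma sim_sel {M : Mat2} {μ ν : ℂ} {r : ℝ} (hM : M ∈ Matrix.unitaryGroup (Fin 2) ℂ)
    (hμ : ‖μ‖ ≤ 1) (h : ‖M - !![μ, 0; 0, ν]‖ ≤ r) :
    Sim (sel 1 M : RegMat (m + 1)) !![1, 0; 0, μ] r := by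
  refine ⟨norm_le_one_of_mem (sel_mem (one_mem _) hM), ?_, ?_⟩
  · have e : (!![1, 0; 0, μ] : Mat2) = Matrix.diagonal ![1, μ] := by
      ext i j
      fin_cases i <;> fin_cases j <;> simp
    rw [e, Matrix.l2_opNorm_diagonal, pi_norm_le_iff_of_nonneg zero_le_one]
    intro i; fin_cases i <;> simp [hμ]
  -- `f` embeds the states of the first ancilla with the target at `1` and the other ancillas at
  -- `0`. The discrepancy lives on this branch only and is the first column of `M - diag(μ, ν)`,
  -- which `Matrix.single 0 1 1` selects.
  · set f : Fin 2 → Reg (m + 1) := fun v => Function.update (Circuit.ket (m + 1) 1) 1 v with hf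
    have hfinj : Function.Injective f :=
      Function.update_injective (Circuit.ket (m + 1) 1) 1
    have e : (sel 1 M : RegMat (m + 1)) * emb (Circuit.ket (m + 1)) -
        emb (Circuit.ket (m + 1)) * !![1, 0; 0, μ] =
        emb f * ((M - !![μ, 0; 0, ν]) * (Matrix.single 0 1 1 : Mat2)) := by
      ext s j
      rw [Matrix.sub_apply, mul_emb_apply, emb_mul_apply, emb_mul_apply]
      have hk1 : ∀ j, Circuit.ket (m + 1) j 1 = 0 := fun j => by simp [Circuit.ket]
      have hk0 : ∀ j, Circuit.ket (m + 1) j 0 = j := fun j => by simp [Circuit.ket]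
      have hs : ∀ j v, s = Function.update (Circuit.ket (m + 1) j) 1 v ↔
          (∀ r, r ≠ 1 → s r = Circuit.ket (m + 1) j r) ∧ v = s 1 := by
        intro j v
        constructor
        · intro h
          refine ⟨fun r hr => ?_, ?_⟩
          · rw [h, Function.update_of_ne hr]
          · rw [h, Function.update_self]
        · rintro ⟨h1, rfl⟩
          exact eq_update_of_agree fun r hr => (h1 r hr).symm
      have hs0 : ∀ j, s = Circuit.ket (m + 1) j ↔
          (∀ r, r ≠ 1 → s r = Circuit.ket (m + 1) j r) ∧ 0 = s 1 := by
        intro j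
        rw [← hs, ← hk1 j, Function.update_eq_self]
      simp only [sel, qmat, Matrix.of_apply, hk1, hf, hs, hs0, Fin.sum_univ_two, Matrix.mul_apply,
        Matrix.single, Matrix.sub_apply]
      have hp : ∀ i, (∀ r, r ≠ 1 → s r = Circuit.ket (m + 1) i r) → s 0 = i := fun i h => by
        rw [h 0 (by simp), hk0]
      generalize s 1 = v at *
      obtain hj | hj : j = 0 ∨ j = 1 := by omega
      all_goals
        subst hj
        by_cases h0 : ∀ r, r ≠ 1 → s r = Circuit.ket (m + 1) 0 r
        · have h1 : ¬ ∀ r, r ≠ 1 → s r = Circuit.ket (m + 1) 1 r := fun h1 => by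
            simpa [hp 0 h0] using hp 1 h1
          simp only [eq_true h0, eq_false h1, hp 0 h0]
          obtain rfl | rfl : v = 0 ∨ v = 1 := by omega
          all_goals simp
        · by_cases h1 : ∀ r, r ≠ 1 → s r = Circuit.ket (m + 1) 1 r
          · simp only [eq_false h0, eq_true h1, hp 1 h1]
            obtain rfl | rfl : v = 0 ∨ v = 1 := by omega
            all_goals simp
          · simp only [eq_false h0, eq_false h1]
            simp
    rw [e]
    refine (Matrix.l2_opNorm_mul _ _).trans ((mul_le_of_le_one_left (norm_nonneg _)
      (norm_emb_le hfinj)).trans ?_)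
    exact (Matrix.l2_opNorm_mul _ _).trans ((mul_le_of_le_one_right (norm_nonneg _)
      norm_single_le).trans h)

end Select

end QGadget
end

noncomputable section

namespace QGadget

open scoped Matrix.Norms.L2Operator

/-! ## Alternating lists of steps -/

/-- `a 0 ++ u ++ a 1 ++ u ++ ⋯ ++ u ++ a n`. -/
def altList {σ : Type*} (a : ℕ → List σ) (u : List σ) : ℕ → List σ
  | 0 => a 0
  | n + 1 => altList a u n ++ u ++ a (n + 1)

lemma prod_map_altList {σ M : Type*} [Monoid M] (f : σ → M) (a : ℕ → List σ) (u : List σ)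
    (n : ℕ) : ((altList a u n).map f).prod =
      alt (fun k => ((a k).map f).prod) (u.map f).prod n := by
  induction n with
  | zero => rfl
  | succ n ih => simp [altList, alt, ih, mul_assoc]

lemma length_altList {σ : Type*} {a : ℕ → List σ} {l : ℕ} (h : ∀ k, (a k).length = l)
    (u : List σ) (n : ℕ) : (altList a u n).length = (n + 1) * l + n * u.length := by
  induction n with
  | zero => simp [altList, h]
  | succ n ih => simp only [altList, List.length_append, ih, h]; ring

lemma forall_mem_altList {σ : Type*} {p : σ → Prop} {a : ℕ → List σ} {u : List σ}
    (ha : ∀ k, ∀ s ∈ a k, p s) (hu : ∀ s ∈ u, p s) (n : ℕ) : ∀ s ∈ altList a u n, p s := by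
  induction n with
  | zero => exact ha 0
  | succ n ih =>
    intro s hs
    simp only [altList, List.mem_append] at hs
    rcases hs with (hs | hs) | hs
    · exact ih s hs
    · exact hu s hs
    · exact ha _ s hs

lemma alt_mem {M : Type*} [Monoid M] {S : Submonoid M} {a : ℕ → M} {u : M}
    (ha : ∀ k, a k ∈ S) (hu : u ∈ S) (n : ℕ) : alt a u n ∈ S := by
  induction n with
  | zero => exact ha 0
  | succ n ih => exact mul_mem (mul_mem ih hu) (ha _)

lemma seq_mem (φ : ℕ → ℝ) {U : Mat2} (hU : U ∈ Matrix.unitaryGroup (Fin 2) ℂ) (n : ℕ) :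
    seq φ U n ∈ Matrix.unitaryGroup (Fin 2) ℂ := alt_mem (fun k => rotZ_mem (φ k)) hU n

/-- The gate `e^{iφσ_z}`. -/
def rotZGate (φ : ℝ) : Matrix.unitaryGroup (Fin 2) ℂ := ⟨rotZ φ, rotZ_mem φ⟩

/-- The gate `-iσ_x`. -/
def flipGate : Matrix.unitaryGroup (Fin 2) ℂ := ⟨quat 0 (-1), quat_mem_unitaryGroup (by simp)⟩

lemma Circuit.mat_append {m e : ℕ} {υ : Type} (P Q : Circuit m e υ) (V : Fin e → Mat2)
    (Y : υ → Mat2) : Circuit.mat (P ++ Q) V Y = P.mat V Y * Circuit.mat Q V Y := by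
  simp [Circuit.mat]

lemma Circuit.mat_singleton {m e : ℕ} {υ : Type} (s : Step m e υ) (V : Fin e → Mat2)
    (Y : υ → Mat2) : Circuit.mat [s] V Y = s.mat V Y := by
  simp [Circuit.mat]

/-! ## Correction with ancillas -/

section Ancillas

variable {m e : ℕ} {υ : Type}

/-- The correction of the black box `i`, from a circuit `L` that performs the amplifying sequence
on the first ancilla when the target is in state `|1⟩`. -/
def corrected (L : Circuit (m + 1) e υ) (i : Fin e) : Circuit (m + 1) e υ :=
  L ++ [Step.cgate 0 1 (by simp) flipGate] ++ [Step.call i 0] ++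
    [Step.cgate 0 1 (by simp) flipGate] ++ L

/-- `diag(1, e^{iα})` is `e^{-iασ_z/2}` up to a scalar, and the scalar cancels in the conjugation.
-/
lemma phase_mul_twist (α θ : ℝ) :
    (!![1, 0; 0, Complex.exp (Complex.I * α)] : Mat2) * twist α θ *
      !![1, 0; 0, starRingEnd ℂ (Complex.exp (Complex.I * α))] = rotX θ := by
  have h := normSq_exp_I_mul α
  rw [twist_eq_quat]
  have h' : Complex.exp (Complex.I * α) * starRingEnd ℂ (Complex.exp (Complex.I * α)) = 1 := by
    rw [Complex.mul_conj, h]; simp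
  generalize Complex.exp (Complex.I * α) = ω at *
  generalize hω : starRingEnd ℂ ω = ω' at *
  simp only [quat, rotX]
  generalize Real.sin θ = s
  generalize Real.cos θ = c
  ext i j
  fin_cases i <;> fin_cases j <;> simp [Matrix.mul_apply, Fin.sum_univ_two, hω]
  · linear_combination Complex.I * s * h'
  · linear_combination Complex.I * s * h'
  · linear_combination c * h'

/-- With `ω = e^{iα}`, the flip after or before the sequence gives approximately `diag(ω, ω̄)` or
`diag(ω̄, ω)`. Acting on the ancilla `|0⟩`, these kick back the phases `ω` and `ω̄`, so the inverse
phase costs no inverse query. Each run contributes an error `r`. -/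
lemma sim_corrected {L : Circuit (m + 1) e υ} {i : Fin e} {V : Fin e → Mat2} {Y : υ → Mat2}
    {S : Mat2} {α θ r : ℝ} (hS : S ∈ Matrix.unitaryGroup (Fin 2) ℂ)
    (hL : L.mat V Y = sel 1 S) (hV : V i = twist α θ)
    (h : ‖S - quat 0 (Complex.exp (Complex.I * α))‖ ≤ r) :
    Sim ((corrected L i).mat V Y) (rotX θ) (2 * r) := by
  set ω := Complex.exp (Complex.I * α) with hω
  have hn : ‖ω‖ = 1 := by rw [hω, mul_comm, Complex.norm_exp_ofReal_mul_I]
  have hflip := flipGate.2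
  have hflipn := norm_le_one_of_mem hflip
  have hflipv : (flipGate : Mat2) = quat 0 (-1) := rfl
  have h1 : Sim (sel 1 (S * flipGate) : RegMat (m + 1)) !![1, 0; 0, ω] r := by
    refine sim_sel (ν := starRingEnd ℂ ω) (mul_mem hS hflip) hn.le ?_
    have e : (!![ω, 0; 0, starRingEnd ℂ ω] : Mat2) = quat 0 ω * flipGate := by
      rw [hflipv, quat_mul]; simp [quat]
    rw [e, ← sub_mul]
    exact (norm_mul_le _ _).trans ((mul_le_of_le_one_right (norm_nonneg _) hflipn).trans h)
  have h3 : Sim (sel 1 (flipGate * S) : RegMat (m + 1)) !![1, 0; 0, starRingEnd ℂ ω] r := by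
    refine sim_sel (ν := ω) (mul_mem hflip hS) (by simp [hn]) ?_
    have e : (!![starRingEnd ℂ ω, 0; 0, ω] : Mat2) = flipGate * quat 0 ω := by
      rw [hflipv, quat_mul]; simp [quat]
    rw [e, ← mul_sub]
    exact (norm_mul_le _ _).trans ((mul_le_of_le_one_left (norm_nonneg _) hflipn).trans h)
  have h2 : Sim (onQubit 0 (V i) : RegMat (m + 1)) (twist α θ) 0 := by
    rw [hV]; exact Sim.onQubit_zero (twist_mem α θ)
  have hmat : (corrected L i).mat V Y =
      sel 1 (S * flipGate) * onQubit 0 (V i) * sel 1 (flipGate * S) := by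
    simp only [corrected, Circuit.mat_append, Circuit.mat_singleton, hL, Step.mat, sel_one]
    rw [show (1 : Mat2) = 1 * 1 by simp, ← sel_mul, ← sel_mul]
    simp only [mul_assoc, mul_one]
  rw [hmat, ← phase_mul_twist α θ]
  exact ((h1.mul h2).mul h3).mono (by linarith)

/-- The amplifying sequence with controlled queries. -/
def controlledSeq (φ : ℕ → ℝ) (n : ℕ) (i : Fin e) : Circuit (m + 1) e υ :=
  altList (fun k => [Step.cgate 0 1 (by simp) (rotZGate (φ k))])
    [Step.ccall i 0 1 (by simp)] n

lemma controlledSeq_mat (φ : ℕ → ℝ) (n : ℕ) (i : Fin e) (V : Fin e → Mat2) (Y : υ → Mat2) :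
    (controlledSeq (m := m) φ n i).mat V Y = sel 1 (seq φ (V i) n) := by
  rw [Circuit.mat, controlledSeq, prod_map_altList]
  simp only [List.map_cons, List.map_nil, List.prod_singleton, Step.mat, sel_one]
  rw [alt_sel (fun _ => 1)]
  congr 1
  induction n with
  | zero => rfl
  | succ n ih => rw [alt, ih]; simp

/-- Phases for which the sequence is trivial. -/
def trivialPhase : ℕ → ℝ
  | 0 => 0
  | n + 1 => if Even n then Real.pi / 2 else -(Real.pi / 2)

/-- The phases `±π / 2` are `±iσ_z`, and `U σ_z U σ_z = U U† = 1` for twisted embeddable `U`.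
Queries cancel in pairs, hence the even length. -/
lemma seq_trivialPhase (α θ : ℝ) (n : ℕ) : seq trivialPhase (twist α θ) (2 * n) = 1 := by
  induction n with
  | zero => exact rotZ_zero
  | succ n ih =>
    have e : seq trivialPhase (twist α θ) (2 * (n + 1)) =
        seq trivialPhase (twist α θ) (2 * n) * twist α θ * rotZ (Real.pi / 2) * twist α θ *
          rotZ (-(Real.pi / 2)) := by
      have h1 : trivialPhase (2 * n + 1) = Real.pi / 2 := by simp [trivialPhase]
      have h2 : trivialPhase (2 * n + 1 + 1) = -(Real.pi / 2) := by
        rw [trivialPhase, if_neg (by simp [parity_simps])]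
      rw [← h2, ← h1]
      rfl
    have hI : Complex.exp (Complex.I * ((Real.pi / 2 : ℝ) : ℂ)) = Complex.I := by
      rw [mul_comm]; push_cast; exact Complex.exp_pi_div_two_mul_I
    have hI' : Complex.exp (Complex.I * ((-(Real.pi / 2) : ℝ) : ℂ)) = -Complex.I := by
      rw [Complex.ofReal_neg, mul_neg, Complex.exp_neg, hI, Complex.inv_I]
    have hsc : (Real.sin θ : ℂ) ^ 2 + (Real.cos θ : ℂ) ^ 2 = 1 := by
      exact_mod_cast Real.sin_sq_add_cos_sq θ
    have h' : Complex.exp (Complex.I * α) * starRingEnd ℂ (Complex.exp (Complex.I * α)) = 1 := by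
      rw [Complex.mul_conj, normSq_exp_I_mul]; simp
    rw [e, ih, one_mul, twist_eq_quat, rotZ_eq_quat, rotZ_eq_quat, hI, hI', quat_mul, quat_mul,
      quat_mul]
    have h1 : (1 : Mat2) = quat 1 0 := by
      ext i j; fin_cases i <;> fin_cases j <;> simp [quat]
    rw [h1]
    simp only [map_mul, Complex.conj_ofReal, map_zero, map_neg, Complex.conj_I]
    generalize Complex.exp (Complex.I * α) = ω at *
    generalize starRingEnd ℂ ω = ω' at *
    congr 1
    · linear_combination (-((Real.cos θ : ℂ) ^ 2) - (Real.sin θ : ℂ) ^ 2 * ω * ω') *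
        Complex.I_mul_I + (Real.sin θ : ℂ) ^ 2 * h' + hsc
    · ring

/-- The amplifying sequence with uncontrolled queries and controlled phases. -/
def uncontrolledSeq (φ : ℕ → ℝ) (n : ℕ) (i : Fin e) : Circuit (m + 1) e υ :=
  altList (fun k => [Step.gate 1 (rotZGate (trivialPhase k)),
    Step.cgate 0 1 (by simp) (rotZGate (φ k - trivialPhase k))]) [Step.call i 1] n

/-- The target only switches between the phases `trivialPhase` and `φ`, while the queries are made
in both branches; in the branch `0` they cancel. -/
lemma uncontrolledSeq_mat (φ : ℕ → ℝ) (n : ℕ) (i : Fin e) {V : Fin e → Mat2} {α θ : ℝ}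
    (hV : V i = twist α θ) (Y : υ → Mat2) :
    (uncontrolledSeq (m := m) φ (2 * n) i).mat V Y = sel 1 (seq φ (V i) (2 * n)) := by
  rw [Circuit.mat, uncontrolledSeq, prod_map_altList]
  simp only [List.map_cons, List.map_nil, List.prod_cons, List.prod_nil, mul_one, Step.mat,
    sel_one]
  simp only [sel_self, sel_mul, rotZGate, rotZ_mul, add_sub_cancel, mul_one]
  rw [alt_sel]
  congr 1
  rw [hV]
  exact seq_trivialPhase α θ n

lemma length_corrected (L : Circuit (m + 1) e υ) (i : Fin e) :
    (corrected L i).length = 2 * L.length + 3 := by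
  simp only [corrected, List.length_append, List.length_singleton]
  ring

end Ancillas

/-! ### Correctors with ancillas and their cost. -/

lemma signal_of_twist {α θ : ℝ} (hθ : θ ∈ Set.Icc 0 Real.pi) :
    signal (twist α θ 0 0).re = rotX θ := by
  rw [signal, twist_eq_quat]
  simp only [quat, Matrix.of_apply, Matrix.cons_val', Matrix.cons_val_zero, Complex.ofReal_re]
  rw [Real.arccos_cos hθ.1 hθ.2]

lemma log_two_le_log {ε δ : ℝ} (hε : 0 < ε) (hε1 : ε ≤ 1) (hδ : 0 < δ) (hδ1 : δ ≤ 1) :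
    Real.log 2 ≤ Real.log (2 / (ε * δ)) := by
  refine Real.log_le_log two_pos ?_
  rw [le_div_iff₀ (by positivity)]
  have : ε * δ ≤ 1 := mul_le_one₀ hε1 hδ.le hδ1
  linarith

lemma half_le_ancilla_cost {ε δ : ℝ} (hε : 0 < ε) (hε1 : ε ≤ 1) (hδ : 0 < δ) (hδ1 : δ ≤ 1) :
    1 / 2 ≤ δ⁻¹ * Real.log (2 / (ε * δ)) := by
  have h1 := log_two_le_log hε hε1 hδ hδ1
  have h2 : 0.69 < Real.log 2 := by linarith [Real.log_two_gt_d9]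
  have h3 : 1 ≤ δ⁻¹ := (one_le_inv₀ hδ).2 hδ1
  nlinarith

lemma ancilla_cost_quarter {ε δ : ℝ} (hε : 0 < ε) (hε1 : ε ≤ 1) (hδ : 0 < δ) (hδ1 : δ ≤ 1) :
    δ⁻¹ * Real.log (2 / (ε / 4 * δ)) ≤ 3 * (δ⁻¹ * Real.log (2 / (ε * δ))) := by
  have h : Real.log (2 / (ε / 4 * δ)) ≤ (3 : ℕ) * Real.log (2 / (ε * δ)) := by
    refine log_le_of_le_pow 3 (by positivity) ?_
    rw [div_pow, div_le_div_iff₀ (by positivity) (by positivity), mul_pow]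
    have : ε ^ 3 * δ ^ 3 ≤ ε * δ := mul_le_mul
      (by simpa using pow_le_pow_of_le_one hε.le hε1 (show 1 ≤ 3 by norm_num))
      (by simpa using pow_le_pow_of_le_one hδ.le hδ1 (show 1 ≤ 3 by norm_num))
      (by positivity) (by positivity)
    nlinarith
  have := mul_le_mul_of_nonneg_left h (show 0 ≤ δ⁻¹ by positivity)
  push_cast at this
  linarith

theorem exists_controlled_corrector : ∃ K : ℝ, 0 < K ∧ ∀ ε δ γ : ℝ, 0 < ε → ε ≤ 1 → 0 < δ →
    δ ≤ 1 → ∀ (e : ℕ) (υ : Type), ∃ P : Fin e → Circuit 1 e υ,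
      (∀ i, ((P i).length : ℝ) ≤ K * Correction.cost ε δ γ .controlledAccess) ∧
      ∀ i V Y, Correction.Domain δ γ (V i) .controlledAccess →
        Sim ((P i).mat V Y) (signal (V i 0 0).re) (ε / 2) := by
  obtain ⟨K, hK, h⟩ := exists_amplification
  -- The length is `4n + 5`. Precision `ε / 4` triples the cost at most, and the cost is at least `1
  -- / 2`.
  refine ⟨12 * K + 10, by positivity, fun ε δ γ hε hε1 hδ hδ1 e υ => ?_⟩
  obtain ⟨n, φ, hn, hφ⟩ := h (ε / 4) δ (by positivity) (by linarith) hδ hδ1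
  refine ⟨fun i => corrected (m := 0) (controlledSeq φ n i) i, fun i => ?_, ?_⟩
  · rw [length_corrected, controlledSeq, length_altList (l := 1) (fun _ => rfl),
      List.length_singleton]
    push_cast
    have h1 := half_le_ancilla_cost hε hε1 hδ hδ1
    have h2 := ancilla_cost_quarter hε hε1 hδ hδ1
    simp only [Correction.cost]
    have h3 := mul_le_mul_of_nonneg_left h2 hK.le
    linarith
  · rintro i V Y ⟨θ, hθ, α, -, hV, hc⟩
    have hS := seq_mem φ (twist_mem α θ) n
    have := sim_corrected (m := 0) (Y := Y) hS
      (by rw [controlledSeq_mat, hV]) hV (hφ α θ hθ hc)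
    rw [hV, signal_of_twist hθ]
    exact this.mono (by linarith)

theorem exists_uncontrolled_corrector : ∃ K : ℝ, 0 < K ∧ ∀ ε δ γ : ℝ, 0 < ε → ε ≤ 1 → 0 < δ →
    δ ≤ 1 → ∀ (e : ℕ) (υ : Type), ∃ P : Fin e → Circuit 2 e υ,
      (∀ i, (P i).Uncontrolled) ∧
      (∀ i, ((P i).length : ℝ) ≤ K * Correction.cost ε δ γ .uncontrolledAccess) ∧
      ∀ i V Y, Correction.Domain δ γ (V i) .uncontrolledAccess →
        Sim ((P i).mat V Y) (signal (V i 0 0).re) (ε / 2) := by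
  obtain ⟨K, hK, h⟩ := exists_even_amplification
  -- The length is `6 * (2n) + 7`, since every phase now takes two gates.
  refine ⟨18 * K + 14, by positivity, fun ε δ γ hε hε1 hδ hδ1 e υ => ?_⟩
  obtain ⟨n, φ, hn, hφ⟩ := h (ε / 4) δ (by positivity) (by linarith) hδ hδ1
  refine ⟨fun i => corrected (m := 1) (uncontrolledSeq φ (2 * n) i) i, fun i => ?_, fun i => ?_, ?_⟩
  · have hu : ∀ s ∈ (uncontrolledSeq φ (2 * n) i : Circuit (1 + 1) e υ),
        s.isControlledCall = false := by
      refine forall_mem_altList (fun k s hs => ?_) (fun s hs => ?_) _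
      · simp only [List.mem_cons, List.not_mem_nil, or_false] at hs
        rcases hs with rfl | rfl <;> rfl
      · rw [List.mem_singleton] at hs
        subst hs; rfl
    intro s hs
    simp only [corrected, List.mem_append, List.mem_singleton] at hs
    rcases hs with (((hs | rfl) | rfl) | rfl) | hs
    · exact hu s hs
    · rfl
    · rfl
    · rfl
    · exact hu s hs
  · rw [length_corrected, uncontrolledSeq, length_altList (l := 2) (fun _ => rfl),
      List.length_singleton]
    push_cast at hn ⊢
    have h1 := half_le_ancilla_cost hε hε1 hδ hδ1
    have h2 := ancilla_cost_quarter hε hε1 hδ hδ1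
    simp only [Correction.cost]
    have h3 := mul_le_mul_of_nonneg_left h2 hK.le
    linarith
  · rintro i V Y ⟨θ, hθ, α, -, hV, hc⟩
    have hS := seq_mem φ (twist_mem α θ) (2 * n)
    have := sim_corrected (m := 1) (Y := Y) hS
      (by rw [uncontrolledSeq_mat φ n i hV, hV]) hV (hφ α θ hθ hc)
    rw [hV, signal_of_twist hθ]
    exact this.mono (by linarith)

end QGadget
end

noncomputable section

namespace QGadget

open scoped Matrix.Norms.L2Operator

/-! ## Twisted embeddable unitaries as fixed points of an anti-automorphism -/

/-- The Pauli matrix `σ_z`. -/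
def pauliZ : Mat2 := !![1, 0; 0, -1]

lemma pauliZ_mul_self : pauliZ * pauliZ = 1 := by
  ext i j
  fin_cases i <;> fin_cases j <;> simp [pauliZ, Matrix.mul_apply]

lemma pauliZ_conjTranspose : pauliZ.conjTranspose = pauliZ := by
  ext i j
  fin_cases i <;> fin_cases j <;> simp [pauliZ]

lemma pauliZ_mem : pauliZ ∈ Matrix.unitaryGroup (Fin 2) ℂ := by
  rw [Matrix.mem_unitaryGroup_iff, Matrix.star_eq_conjTranspose, pauliZ_conjTranspose,
    pauliZ_mul_self]

/-- The anti-automorphism `U ↦ σ_z U† σ_z`. -/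
def reversal (U : Mat2) : Mat2 := pauliZ * U.conjTranspose * pauliZ

lemma reversal_mul (A B : Mat2) : reversal (A * B) = reversal B * reversal A := by
  have e : reversal B * reversal A =
      pauliZ * B.conjTranspose * (pauliZ * pauliZ) * (A.conjTranspose * pauliZ) := by
    simp only [reversal, mul_assoc]
  rw [e, pauliZ_mul_self, reversal, Matrix.conjTranspose_mul]
  simp only [mul_assoc, one_mul]

lemma reversal_one : reversal 1 = 1 := by
  rw [reversal, Matrix.conjTranspose_one, mul_one, pauliZ_mul_self]

lemma reversal_quat (α β : ℂ) : reversal (quat α β) = quat (starRingEnd ℂ α) β := by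
  ext i j
  fin_cases i <;> fin_cases j <;>
    simp [reversal, pauliZ, quat, Matrix.mul_apply, Fin.sum_univ_two, Matrix.vecMul,
      Matrix.vecHead, Matrix.vecTail]

lemma reversal_rotZ (x : ℝ) : reversal (rotZ x) = rotZ (-x) := by
  rw [rotZ_eq_quat, rotZ_eq_quat, reversal_quat, conj_exp_I_mul]
  simp

lemma reversal_sub (A B : Mat2) : reversal (A - B) = reversal A - reversal B := by
  simp only [reversal, Matrix.conjTranspose_sub, mul_sub, sub_mul]

lemma reversal_mem {U : Mat2} (h : U ∈ Matrix.unitaryGroup (Fin 2) ℂ) :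
    reversal U ∈ Matrix.unitaryGroup (Fin 2) ℂ :=
  mul_mem (mul_mem pauliZ_mem (Unitary.star_mem h)) pauliZ_mem

lemma norm_reversal_le (A : Mat2) : ‖reversal A‖ ≤ ‖A‖ := by
  have h := norm_le_one_of_mem pauliZ_mem
  refine (norm_mul_le _ _).trans ((mul_le_of_le_one_right (norm_nonneg _) h).trans ?_)
  refine (norm_mul_le _ _).trans ((mul_le_of_le_one_left (norm_nonneg _) h).trans ?_)
  rw [Matrix.l2_opNorm_conjTranspose]

/-- Special unitary matrices that are fixed by `reversal`. -/
structure IsReversible (U : Mat2) : Prop where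
  mem : U ∈ Matrix.unitaryGroup (Fin 2) ℂ
  det : U.det = 1
  fixed : reversal U = U

lemma det_quat (α β : ℂ) :
    (quat α β).det = ((Complex.normSq α + Complex.normSq β : ℝ) : ℂ) := by
  rw [quat, Matrix.det_fin_two_of, Complex.ofReal_add, ← Complex.mul_conj, ← Complex.mul_conj]
  linear_combination -(β * starRingEnd ℂ β) * Complex.I_mul_I

lemma isReversible_quat {a : ℝ} {β : ℂ} (h : a ^ 2 + Complex.normSq β = 1) :
    IsReversible (quat a β) := by
  have h' : Complex.normSq (a : ℂ) + Complex.normSq β = 1 := by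
    rw [Complex.normSq_ofReal, ← sq, h]
  exact ⟨quat_mem_unitaryGroup h', by rw [det_quat, h', Complex.ofReal_one],
    by rw [reversal_quat, Complex.conj_ofReal]⟩

lemma isReversible_twist (α θ : ℝ) : IsReversible (twist α θ) := by
  rw [twist_eq_quat]
  apply isReversible_quat
  rw [Complex.normSq_mul, normSq_exp_I_mul, Complex.normSq_ofReal]
  linarith [Real.sin_sq_add_cos_sq θ]

lemma isReversible_rotX (θ : ℝ) : IsReversible (rotX θ) := by
  rw [rotX_eq_quat]
  apply isReversible_quat
  rw [Complex.normSq_ofReal]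
  linarith [Real.sin_sq_add_cos_sq θ]

lemma IsTwistedEmbeddable.isReversible {U : Mat2} (h : IsTwistedEmbeddable U) :
    IsReversible U := by
  obtain ⟨θ, -, φ, -, rfl⟩ := h
  exact isReversible_twist φ θ

lemma IsEmbeddable.isReversible {U : Mat2} (h : IsEmbeddable U) : IsReversible U := by
  obtain ⟨θ, -, rfl⟩ := h
  exact isReversible_rotX θ

lemma isTwistedEmbeddable_quat {a : ℝ} {β : ℂ} (h : a ^ 2 + Complex.normSq β = 1) :
    IsTwistedEmbeddable (quat a β) := by
  have ha : -1 ≤ a ∧ a ≤ 1 := by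
    constructor <;> nlinarith [Complex.normSq_nonneg β]
  refine ⟨Real.arccos a, ⟨Real.arccos_nonneg a, Real.arccos_le_pi a⟩, β.arg,
    ⟨(Complex.neg_pi_lt_arg β).le, Complex.arg_le_pi β⟩, ?_⟩
  rw [twist_eq_quat, Real.cos_arccos ha.1 ha.2, Real.sin_arccos]
  congr 1
  rw [show 1 - a ^ 2 = ‖β‖ ^ 2 by rw [← Complex.normSq_eq_norm_sq]; linarith,
    Real.sqrt_sq (norm_nonneg _), mul_comm Complex.I, Complex.norm_mul_exp_arg_mul_I]

/-- Being fixed makes the diagonal real and ties the off-diagonal entries together. Unitarity and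
determinant one then force equal diagonal entries; the determinant excludes `σ_z`, which is unitary
and fixed as well. -/
lemma IsReversible.isTwistedEmbeddable {U : Mat2} (h : IsReversible U) :
    IsTwistedEmbeddable U := by
  obtain ⟨hm, hd, hf⟩ := h
  have h00 : starRingEnd ℂ (U 0 0) = U 0 0 := by
    have := congrFun (congrFun hf 0) 0
    simpa [reversal, pauliZ, Matrix.mul_apply, Fin.sum_univ_two, Matrix.vecMul,
      Matrix.vecHead, Matrix.vecTail, dotProduct] using this
  have h11 : starRingEnd ℂ (U 1 1) = U 1 1 := by
    have := congrFun (congrFun hf 1) 1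
    simpa [reversal, pauliZ, Matrix.mul_apply, Fin.sum_univ_two, Matrix.vecMul,
      Matrix.vecHead, Matrix.vecTail, dotProduct] using this
  have h10 : -starRingEnd ℂ (U 0 1) = U 1 0 := by
    have := congrFun (congrFun hf 1) 0
    simpa [reversal, pauliZ, Matrix.mul_apply, Fin.sum_univ_two, Matrix.vecMul,
      Matrix.vecHead, Matrix.vecTail, dotProduct] using this
  have hU := Matrix.mem_unitaryGroup_iff.1 hm
  have e00 := congrFun (congrFun hU 0) 0
  have e11 := congrFun (congrFun hU 1) 1
  simp [Matrix.mul_apply, Fin.sum_univ_two, Matrix.star_apply] at e00 e11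
  rw [Matrix.det_fin_two] at hd
  rw [h00] at e00
  rw [h11, ← h10, map_neg, Complex.conj_conj] at e11
  rw [← h10] at hd
  have hdd : U 1 1 = U 0 0 := by
    have k1 : U 0 0 * (U 1 1 - U 0 0) = 0 := by linear_combination hd - e00
    rcases mul_eq_zero.1 k1 with k | k
    · have : U 1 1 * U 1 1 = 0 := by
        rw [k] at hd
        linear_combination e11 - hd
      rw [k, mul_self_eq_zero.1 this]
    · exact sub_eq_zero.1 k
  obtain ⟨a, ha⟩ : ∃ a : ℝ, (a : ℂ) = U 0 0 := ⟨(U 0 0).re, Complex.conj_eq_iff_re.1 h00⟩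
  have hUq : U = quat a (-Complex.I * U 0 1) := by
    ext i j
    fin_cases i <;> fin_cases j
    · simp [quat, ha]
    · simp only [quat, Fin.zero_eta, Fin.mk_one, Matrix.of_apply, Matrix.cons_val', Matrix.cons_val_one,
        Matrix.cons_val_zero, Matrix.cons_val_fin_one]
      linear_combination (U 0 1) * Complex.I_mul_I
    · simp [quat, ← h10]
      linear_combination (-(starRingEnd ℂ) (U 0 1)) * Complex.I_mul_I
    · simp [quat, hdd, ha, h00]
  rw [hUq]
  apply isTwistedEmbeddable_quat
  have h1 : ((a ^ 2 + Complex.normSq (-Complex.I * U 0 1) : ℝ) : ℂ) = 1 := by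
    rw [Complex.normSq_mul, Complex.ofReal_add, Complex.ofReal_mul, ← Complex.mul_conj (U 0 1)]
    push_cast
    rw [ha]
    simp
    linear_combination e00
  exact_mod_cast h1

/-! ## Circuits without ancillas -/

/-- Products of one-qubit gates and of one black box, which is denoted by `none`. -/
abbrev Word : Type := List (Option (Matrix.unitaryGroup (Fin 2) ℂ))

/-- The value of a word on the black box `V`. -/
def evalWord (V : Mat2) (w : Word) : Mat2 :=
  (w.map fun o => o.elim V fun g => (g : Mat2)).prod

lemma evalWord_append (V : Mat2) (w w' : Word) :
    evalWord V (w ++ w') = evalWord V w * evalWord V w' := by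
  simp [evalWord]

lemma evalWord_some (V : Mat2) (g : Matrix.unitaryGroup (Fin 2) ℂ) :
    evalWord V [some g] = g := by
  simp [evalWord]

lemma evalWord_none (V : Mat2) : evalWord V [none] = V := by
  simp [evalWord]

lemma evalWord_mem {V : Mat2} (hV : V ∈ Matrix.unitaryGroup (Fin 2) ℂ) (w : Word) :
    evalWord V w ∈ Matrix.unitaryGroup (Fin 2) ℂ := by
  refine list_prod_mem fun U hU => ?_
  rw [List.mem_map] at hU
  obtain ⟨o, -, rfl⟩ := hU
  cases o with
  | none => exact hV
  | some g => exact g.2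

/-- The word whose value is the reversal. -/
def reverseWord (w : Word) : Word :=
  (w.map (Option.map fun g => ⟨reversal g, reversal_mem g.2⟩)).reverse

/-- The black box is fixed by the anti-automorphism, so the reversal of an unknown product is
computed exactly by forward queries. -/
lemma evalWord_reverseWord {V : Mat2} (hV : reversal V = V) (w : Word) :
    evalWord V (reverseWord w) = reversal (evalWord V w) := by
  induction w with
  | nil => simp [evalWord, reverseWord, reversal_one]
  | cons o w ih =>
    have e1 : reverseWord (o :: w) = reverseWord w ++ reverseWord [o] := by simp [reverseWord]
    have e2 : evalWord V (o :: w) = evalWord V [o] * evalWord V w := by simp [evalWord]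
    rw [e1, evalWord_append, ih, e2, reversal_mul]
    congr 1
    cases o with
    | none => simp [reverseWord, evalWord, hV]
    | some g => simp [reverseWord, evalWord]

/-- The word as a circuit without ancillas that queries the black box `i`. -/
def wordCircuit {e : ℕ} {υ : Type} (i : Fin e) (w : Word) : Circuit 0 e υ :=
  w.map fun o => o.elim (Step.call i 0) (Step.gate 0)

lemma onQubit_mul {m : ℕ} (q : Fin (m + 1)) (A B : Mat2) :
    (onQubit q A * onQubit q B : RegMat m) = onQubit q (A * B) :=
  qmat_mul fun _ _ => rfl

lemma wordCircuit_mat {e : ℕ} {υ : Type} (i : Fin e) (w : Word) (V : Fin e → Mat2)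
    (Y : υ → Mat2) : (wordCircuit i w).mat V Y = onQubit 0 (evalWord (V i) w) := by
  induction w with
  | nil => exact (qmat_one 0).symm
  | cons o w ih =>
    have e1 : (wordCircuit i (o :: w) : Circuit 0 e υ) =
        wordCircuit i [o] ++ wordCircuit i w := by simp [wordCircuit]
    have e2 : evalWord (V i) (o :: w) = evalWord (V i) [o] * evalWord (V i) w := by
      simp [evalWord]
    rw [e1, Circuit.mat_append, ih, e2, ← onQubit_mul]
    congr 1
    cases o <;> simp [wordCircuit, Circuit.mat, evalWord, Step.mat]

lemma wordCircuit_uncontrolled {e : ℕ} {υ : Type} (i : Fin e) (w : Word) :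
    (wordCircuit i w : Circuit 0 e υ).Uncontrolled := by
  intro s hs
  rw [wordCircuit, List.mem_map] at hs
  obtain ⟨o, -, rfl⟩ := hs
  cases o <;> rfl

lemma Sim.of_norm_sub_le {m : ℕ} {U A : Mat2} {r : ℝ}
    (hU : U ∈ Matrix.unitaryGroup (Fin 2) ℂ) (hA : A ∈ Matrix.unitaryGroup (Fin 2) ℂ)
    (h : ‖U - A‖ ≤ r) : Sim (onQubit 0 U : RegMat m) A r := by
  refine ⟨(Sim.onQubit_zero hU).1, norm_le_one_of_mem hA, ?_⟩
  rw [onQubit_zero_mul_emb, ← Matrix.mul_sub]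
  exact (Matrix.l2_opNorm_mul _ _).trans ((mul_le_of_le_one_left (norm_nonneg _)
    (norm_emb_le ket_injective)).trans h)

lemma norm_mul_sub_mul_le {A B A' B' : Mat2} (hA : ‖A‖ ≤ 1) (hB : ‖B'‖ ≤ 1) :
    ‖A * B - A' * B'‖ ≤ ‖A - A'‖ + ‖B - B'‖ := by
  have e : A * B - A' * B' = (A - A') * B' + A * (B - B') := by noncomm_ring
  rw [e]
  refine (norm_add_le _ _).trans (add_le_add ?_ ?_)
  · exact (norm_mul_le _ _).trans (mul_le_of_le_one_right (norm_nonneg _) hB)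
  · exact (norm_mul_le _ _).trans (mul_le_of_le_one_left (norm_nonneg _) hA)

lemma norm_seq_sub_seq_le (φ : ℕ → ℝ) {U U' : Mat2}
    (hU : U ∈ Matrix.unitaryGroup (Fin 2) ℂ) (hU' : U' ∈ Matrix.unitaryGroup (Fin 2) ℂ) (n : ℕ) :
    ‖seq φ U n - seq φ U' n‖ ≤ n * ‖U - U'‖ := by
  induction n with
  | zero => simp [seq, alt]
  | succ n ih =>
    have e : ∀ U, seq φ U (n + 1) = seq φ U n * U * rotZ (φ (n + 1)) := fun U => rfl
    rw [e, e, ← sub_mul]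
    refine (norm_mul_le _ _).trans ((mul_le_of_le_one_right (norm_nonneg _)
      (norm_le_one_of_mem (rotZ_mem _))).trans ?_)
    refine (norm_mul_sub_mul_le (norm_le_one_of_mem (seq_mem φ hU n))
      (norm_le_one_of_mem hU')).trans ?_
    push_cast
    linarith

/-- A gate that conjugates rotations about the `z` axis to rotations about the `x` axis. -/
def axisGate : Matrix.unitaryGroup (Fin 2) ℂ :=
  ⟨quat (Complex.I * (√(1 / 2) : ℝ)) (√(1 / 2) : ℝ), quat_mem_unitaryGroup (by
    rw [Complex.normSq_mul, Complex.normSq_I, Complex.normSq_ofReal,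
      Real.mul_self_sqrt (by norm_num)]; norm_num)⟩

lemma axisGate_conj (x : ℝ) :
    (axisGate : Mat2) * rotZ x * ((axisGate⁻¹ : Matrix.unitaryGroup (Fin 2) ℂ) : Mat2) =
      rotX x := by
  have h : ((√(1 / 2) : ℝ) : ℂ) * ((√(1 / 2) : ℝ) : ℂ) = 1 / 2 := by
    rw [← Complex.ofReal_mul, Real.mul_self_sqrt (by norm_num)]; norm_num
  have e : ((axisGate⁻¹ : Matrix.unitaryGroup (Fin 2) ℂ) : Mat2) =
      (quat (Complex.I * (√(1 / 2) : ℝ)) (√(1 / 2) : ℝ)).conjTranspose := rfl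
  have hz : Complex.exp (Complex.I * x) = Real.cos x + Complex.I * Real.sin x := by
    rw [mul_comm, Complex.exp_mul_I]; push_cast; ring
  rw [e, quat_conjTranspose, rotZ_eq_quat, rotX_eq_quat]
  rw [show (axisGate : Mat2) = quat (Complex.I * (√(1 / 2) : ℝ)) (√(1 / 2) : ℝ) from rfl,
    quat_mul, quat_mul, hz]
  simp only [map_add, map_mul, map_neg, map_zero, Complex.conj_ofReal, Complex.conj_I]
  generalize ((√(1 / 2) : ℝ) : ℂ) = g at *
  have hI := Complex.I_mul_I
  congr 1
  · linear_combination (2 * (Real.cos x : ℂ)) * h - g * g * (Real.cos x : ℂ) * hI -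
      g * g * (Real.sin x : ℂ) * Complex.I * hI
  · linear_combination (2 * (Real.sin x : ℂ)) * h - 2 * g * g * (Real.sin x : ℂ) * hI

/-- The word that approximates `e^{-iασ_z}`. -/
def phaseWord (ψ : ℕ → ℝ) (n : ℕ) : Word :=
  [some flipGate] ++ altList (fun k => [some (rotZGate (ψ k))]) [none] n

/-- The word that approximates `e^{-iασ_z/2}`. -/
def halfPhaseWord (φ ψ : ℕ → ℝ) (n k : ℕ) : Word :=
  [some axisGate⁻¹] ++ altList (fun k => [some (rotZGate (φ k))])
    ([some axisGate] ++ phaseWord ψ k ++ [some axisGate⁻¹]) n ++ [some axisGate]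

/-- The word that approximates `e^{iθσ_x}`. -/
def correctionWord (φ ψ : ℕ → ℝ) (n k : ℕ) : Word :=
  halfPhaseWord φ ψ n k ++ [none] ++ reverseWord (halfPhaseWord φ ψ n k)

lemma evalWord_altList (V : Mat2) (φ : ℕ → ℝ) (w : Word) (n : ℕ) :
    evalWord V (altList (fun k => [some (rotZGate (φ k))]) w n) = seq φ (evalWord V w) n := by
  rw [evalWord, prod_map_altList]
  simp [seq, evalWord, rotZGate]

lemma length_correctionWord (φ ψ : ℕ → ℝ) (n k : ℕ) :
    (correctionWord φ ψ n k).length ≤ 15 * ((n + 1) * (k + 1)) := by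
  have h : (correctionWord φ ψ n k).length = 2 * (halfPhaseWord φ ψ n k).length + 1 := by
    simp only [correctionWord, reverseWord, List.length_append, List.length_reverse,
      List.length_map, List.length_singleton]
    ring
  rw [h, halfPhaseWord, List.length_append, List.length_append,
    length_altList (l := 1) (fun _ => rfl), List.length_append, List.length_append, phaseWord,
    List.length_append, length_altList (l := 1) (fun _ => rfl)]
  simp only [List.length_singleton]
  nlinarith [Nat.zero_le (n * k)]

lemma evalWord_correctionWord {V : Mat2} (hV : reversal V = V) (φ ψ : ℕ → ℝ) (n k : ℕ) :
    evalWord V (correctionWord φ ψ n k) = evalWord V (halfPhaseWord φ ψ n k) * V *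
      reversal (evalWord V (halfPhaseWord φ ψ n k)) := by
  rw [correctionWord, evalWord_append, evalWord_append, evalWord_none, evalWord_reverseWord hV]

/-- The product is a palindrome, whatever `M` is. Corrected unitaries are therefore exactly twisted
embeddable, even where the correction is inaccurate. -/
lemma isReversible_mul_mul_reversal {M V : Mat2} (hM : M ∈ Matrix.unitaryGroup (Fin 2) ℂ)
    (hV : IsReversible V) : IsReversible (M * V * reversal M) := by
  have hrr : reversal (reversal M) = M := by
    have e : reversal (reversal M) = (pauliZ * pauliZ) * M * (pauliZ * pauliZ) := by
      simp only [reversal, Matrix.conjTranspose_mul, pauliZ_conjTranspose,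
        Matrix.conjTranspose_conjTranspose, mul_assoc]
    rw [e, pauliZ_mul_self, one_mul, mul_one]
  refine ⟨mul_mem (mul_mem hM hV.1) (reversal_mem hM), ?_, ?_⟩
  · have h1 : (pauliZ * pauliZ).det = 1 := by rw [pauliZ_mul_self, Matrix.det_one]
    have h2 : (M * M.conjTranspose).det = 1 := by
      rw [← Matrix.star_eq_conjTranspose, Matrix.mem_unitaryGroup_iff.1 hM, Matrix.det_one]
    rw [Matrix.det_mul] at h1 h2
    rw [Matrix.det_mul, Matrix.det_mul, hV.2, reversal, Matrix.det_mul, Matrix.det_mul]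
    linear_combination h2 + M.det * M.conjTranspose.det * h1
  · rw [reversal_mul, reversal_mul, hrr, hV.3, mul_assoc]

lemma norm_phaseWord_sub_le {ψ : ℕ → ℝ} {k : ℕ} {α θ r : ℝ}
    (h : ‖seq ψ (twist α θ) k - quat 0 (Complex.exp (Complex.I * α))‖ ≤ r) :
    ‖evalWord (twist α θ) (phaseWord ψ k) - rotZ (-α)‖ ≤ r := by
  have e : rotZ (-α) = flipGate * quat 0 (Complex.exp (Complex.I * α)) := by
    rw [show (flipGate : Mat2) = quat 0 (-1) from rfl, quat_mul, rotZ_eq_quat, conj_exp_I_mul]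
    simp
  rw [phaseWord, evalWord_append, evalWord_some, evalWord_altList, evalWord_none, e, ← mul_sub]
  exact (norm_mul_le _ _).trans ((mul_le_of_le_one_left (norm_nonneg _)
    (norm_le_one_of_mem flipGate.2)).trans h)

lemma norm_conj_le {G D H : Mat2} {r : ℝ} (hG : ‖G‖ ≤ 1) (hH : ‖H‖ ≤ 1) (hD : ‖D‖ ≤ r) :
    ‖G * D * H‖ ≤ r :=
  (norm_mul_le _ _).trans ((mul_le_of_le_one_right (norm_nonneg _) hH).trans
    ((norm_mul_le _ _).trans ((mul_le_of_le_one_left (norm_nonneg _) hG).trans hD)))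

/-- The halving sequence queries the approximate rotation `n` times, so its error `r` counts `n`
times; `r'` is the error of halving an exact rotation. -/
lemma norm_halfPhaseWord_sub_le {φ ψ : ℕ → ℝ} {n k : ℕ} {α θ r r' : ℝ}
    (h : ‖seq ψ (twist α θ) k - quat 0 (Complex.exp (Complex.I * α))‖ ≤ r)
    (h' : ‖seq φ (rotX (-α)) n - rotX (-α / 2)‖ ≤ r') :
    ‖evalWord (twist α θ) (halfPhaseWord φ ψ n k) - rotZ (-α / 2)‖ ≤ n * r + r' := by
  set W := evalWord (twist α θ) (phaseWord ψ k) with hW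
  have hWm : W ∈ Matrix.unitaryGroup (Fin 2) ℂ := evalWord_mem (twist_mem α θ) _
  have hG := axisGate.2
  have hG' := (axisGate⁻¹).2
  have hGn := norm_le_one_of_mem hG
  have hGn' := norm_le_one_of_mem hG'
  have hinv : ((axisGate⁻¹ : Matrix.unitaryGroup (Fin 2) ℂ) : Mat2) * (axisGate : Mat2) = 1 := by
    rw [← Submonoid.coe_mul, inv_mul_cancel]; rfl
  have hback : rotZ (-α / 2) = ((axisGate⁻¹ : Matrix.unitaryGroup (Fin 2) ℂ) : Mat2) *
      rotX (-α / 2) * (axisGate : Mat2) := by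
    rw [← axisGate_conj]
    calc rotZ (-α / 2) = 1 * rotZ (-α / 2) * 1 := by simp
      _ = _ := by rw [← hinv]; simp only [mul_assoc]
  have hmid : ‖(axisGate : Mat2) * W * ((axisGate⁻¹ : Matrix.unitaryGroup (Fin 2) ℂ) : Mat2) -
      rotX (-α)‖ ≤ r := by
    rw [← axisGate_conj, ← sub_mul, ← mul_sub]
    exact norm_conj_le hGn hGn' (norm_phaseWord_sub_le h)
  have hseq := norm_seq_sub_seq_le φ (mul_mem (mul_mem hG hWm) hG') (rotX_mem (-α)) n
  rw [halfPhaseWord, evalWord_append, evalWord_append, evalWord_altList, evalWord_append,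
    evalWord_append, evalWord_some, evalWord_some, ← hW, hback, ← sub_mul, ← mul_sub]
  refine norm_conj_le hGn' hGn ?_
  calc _ ≤ _ := norm_sub_le_norm_sub_add_norm_sub _ (seq φ (rotX (-α)) n) _
    _ ≤ n * r + r' := add_le_add (hseq.trans (by gcongr)) h'

lemma norm_correctionWord_sub_le {φ ψ : ℕ → ℝ} {n k : ℕ} {α θ r : ℝ}
    (h : ‖evalWord (twist α θ) (halfPhaseWord φ ψ n k) - rotZ (-α / 2)‖ ≤ r) :
    ‖evalWord (twist α θ) (correctionWord φ ψ n k) - rotX θ‖ ≤ 2 * r := by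
  rw [evalWord_correctionWord (isReversible_twist α θ).fixed]
  set M := evalWord (twist α θ) (halfPhaseWord φ ψ n k) with hM
  have hMm : M ∈ Matrix.unitaryGroup (Fin 2) ℂ := evalWord_mem (twist_mem α θ) _
  have e : rotX θ = rotZ (-α / 2) * twist α θ * reversal (rotZ (-α / 2)) := by
    have h1 : rotZ (-α / 2) * rotZ (α / 2) = 1 := by
      rw [rotZ_mul, show -α / 2 + α / 2 = 0 by ring, rotZ_zero]
    have h2 : rotZ (-(α / 2)) * rotZ (-(-α / 2)) = 1 := by
      rw [rotZ_mul, show -(α / 2) + -(-α / 2) = 0 by ring, rotZ_zero]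
    rw [reversal_rotZ, twist]
    calc rotX θ = (rotZ (-α / 2) * rotZ (α / 2)) * rotX θ *
          (rotZ (-(α / 2)) * rotZ (-(-α / 2))) := by rw [h1, h2, one_mul, mul_one]
      _ = _ := by simp only [mul_assoc]
  have h1 : ‖reversal M - reversal (rotZ (-α / 2))‖ ≤ r := by
    rw [← reversal_sub]; exact (norm_reversal_le _).trans h
  rw [e]
  refine (norm_mul_sub_mul_le (norm_le_one_of_mem (mul_mem hMm (twist_mem α θ)))
    (norm_le_one_of_mem (reversal_mem (rotZ_mem _)))).trans ?_
  rw [← sub_mul]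
  have h2 := (norm_mul_le (M - rotZ (-α / 2)) (twist α θ)).trans
    (mul_le_of_le_one_right (norm_nonneg _) (norm_le_one_of_mem (twist_mem α θ)))
  linarith

lemma log_bound_of_free {A x : ℝ} (hA : 2 ≤ A) (hx : 2 ≤ x) :
    Real.log (A * x ^ 3) ≤ (Real.log A / Real.log 2 + 3) * Real.log x := by
  have h2 : 0 < Real.log 2 := Real.log_pos one_lt_two
  have hL : Real.log 2 ≤ Real.log x := Real.log_le_log two_pos hx
  have hA0 : 0 ≤ Real.log A := Real.log_nonneg (by linarith)
  rw [Real.log_mul (by positivity) (by positivity), Real.log_pow, add_mul]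
  have : Real.log A ≤ Real.log A / Real.log 2 * Real.log x := by
    rw [div_mul_eq_mul_div, le_div_iff₀ h2]
    exact mul_le_mul_of_nonneg_left hL hA0
  push_cast
  linarith

/-- Amplification, of length about `δ⁻¹ log`, is nested in halving, of length about `γ⁻² log`. The
lengths multiply, which explains the squared logarithm in the cost. -/
theorem exists_ancillaFree_corrector : ∃ K : ℝ, 0 < K ∧ ∀ ε δ γ : ℝ, 0 < ε → ε ≤ 1 → 0 < δ →
    δ ≤ 1 → 0 < γ → γ ≤ 1 → ∀ (e : ℕ) (υ : Type), ∃ P : Fin e → Circuit 0 e υ,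
      (∀ i, (P i).Uncontrolled) ∧
      (∀ i, ((P i).length : ℝ) ≤ K * Correction.cost ε δ γ .ancillaFree) ∧
      (∀ i V Y, Correction.Domain δ γ (V i) .ancillaFree →
        Sim ((P i).mat V Y) (signal (V i 0 0).re) (ε / 2)) ∧
      ∀ i V Y, IsReversible (V i) → ∃ U, IsReversible U ∧ (P i).mat V Y = onQubit 0 U := by
  obtain ⟨K₁, hK₁, h₁⟩ := exists_half_angle
  obtain ⟨K₂, hK₂, h₂⟩ := exists_amplification
  set A : ℝ := 4 * K₁ + 2 with hA
  set B : ℝ := Real.log (32 * A) / Real.log 2 + 3 with hB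
  have hl2 : 0.69 < Real.log 2 := by linarith [Real.log_two_gt_d9]
  have hB0 : 0 < B := by
    have := Real.log_nonneg (show 1 ≤ 32 * A by linarith)
    positivity
  refine ⟨15 * (A * (K₂ * B + 2)), by positivity, fun ε δ γ hε hε1 hδ hδ1 hγ hγ1 e υ => ?_⟩
  obtain ⟨n, φ, hn, hφ⟩ := h₁ (ε / 8) γ (by positivity) (by linarith) hγ hγ1
  -- The inner precision is divided by the number of its uses. The total error is `2 (n ε / (8(n +
  -- 1)) + ε / 8) ≤ ε / 2`, the factor `2` coming from `M` and its reversal.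
  have hε2 : ε / (8 * (n + 1)) ≤ 1 := by
    rw [div_le_one (by positivity)]; linarith [(Nat.cast_nonneg n : (0 : ℝ) ≤ n)]
  obtain ⟨k, ψ, hk, hψ⟩ := h₂ (ε / (8 * (n + 1))) δ (by positivity) hε2 hδ hδ1
  refine ⟨fun i => wordCircuit i (correctionWord φ ψ n k),
    fun i => wordCircuit_uncontrolled i _, fun i => ?_, ?_, fun i V Y hV => ?_⟩
  · have hlen : ((wordCircuit i (correctionWord φ ψ n k) : Circuit 0 e υ).length : ℝ) ≤
        15 * ((n + 1) * (k + 1)) := by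
      rw [wordCircuit, List.length_map]
      exact_mod_cast length_correctionWord φ ψ n k
    refine hlen.trans ?_
    simp only [Correction.cost]
    set x : ℝ := 2 / (ε * δ * γ) with hx
    have hεδ : ε * δ ≤ 1 := mul_le_one₀ hε1 hδ.le hδ1
    have hεδγ : ε * δ * γ ≤ 1 := mul_le_one₀ hεδ hγ.le hγ1
    have hx2 : 2 ≤ x := by rw [hx, le_div_iff₀ (by positivity)]; linarith
    set L : ℝ := Real.log x with hL
    have hL2 : Real.log 2 ≤ L := Real.log_le_log two_pos hx2
    have hLx : L ≤ x := (Real.log_le_sub_one_of_pos (by linarith)).trans (by linarith)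
    have hγi : 1 ≤ (γ ^ 2)⁻¹ := (one_le_inv₀ (by positivity)).2 (pow_le_one₀ hγ.le hγ1)
    have hδi : 1 ≤ δ⁻¹ := (one_le_inv₀ hδ).2 hδ1
    have l1 : Real.log (2 / (ε / 8 * γ)) ≤ (4 : ℕ) * L := by
      refine log_le_of_le_pow 4 (by positivity) ?_
      rw [hx, div_pow, div_le_div_iff₀ (by positivity) (by positivity), mul_pow, mul_pow]
      have : ε ^ 4 * δ ^ 4 * γ ^ 4 ≤ ε * 1 * γ := by
        gcongr
        · simpa using pow_le_pow_of_le_one hε.le hε1 (show 1 ≤ 4 by norm_num)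
        · exact pow_le_one₀ hδ.le hδ1
        · simpa using pow_le_pow_of_le_one hγ.le hγ1 (show 1 ≤ 4 by norm_num)
      linarith
    have hn1 : (n + 1 : ℝ) ≤ A * ((γ ^ 2)⁻¹ * L) := by
      have a1 := mul_le_mul_of_nonneg_left l1 (show 0 ≤ (γ ^ 2)⁻¹ by positivity)
      have a2 := mul_le_mul_of_nonneg_left a1 hK₁.le
      push_cast at a2
      have a3 : L ≤ (γ ^ 2)⁻¹ * L := le_mul_of_one_le_left (by linarith) hγi
      rw [hA]
      linarith
    -- The inner precision depends on `n`, but `n + 1` is polynomial in the parameters: the argument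
    -- is at most `32A x³`, so its logarithm is still of order `L`.
    have l2 : Real.log (2 / (ε / (8 * (n + 1)) * δ)) ≤ B * L := by
      refine le_trans (Real.log_le_log (by positivity) ?_)
        (log_bound_of_free (A := 32 * A) (by linarith) hx2)
      have a1 : (n + 1 : ℝ) ≤ A * ((γ ^ 2)⁻¹ * x) := hn1.trans (by gcongr)
      have e1 : 2 / (ε / (8 * (n + 1)) * δ) = 16 / (ε * δ) * (n + 1) := by field_simp; ring
      rw [e1]
      calc 16 / (ε * δ) * (n + 1) ≤ 16 / (ε * δ) * (A * ((γ ^ 2)⁻¹ * x)) := by gcongr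
        _ = 32 * A * (1 / (ε ^ 2 * δ ^ 2 * γ ^ 3)) := by rw [hx]; field_simp; ring
        _ ≤ 32 * A * x ^ 3 := by
          refine mul_le_mul_of_nonneg_left ?_ (by positivity)
          rw [hx, div_pow, div_le_div_iff₀ (by positivity) (by positivity), mul_pow, mul_pow]
          have : ε ^ 3 * δ ^ 3 * γ ^ 3 ≤ ε ^ 2 * δ ^ 2 * γ ^ 3 := by
            gcongr ?_ * ?_ * _
            · exact pow_le_pow_of_le_one hε.le hε1 (by norm_num)
            · exact pow_le_pow_of_le_one hδ.le hδ1 (by norm_num)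
          have : 0 < ε ^ 2 * δ ^ 2 * γ ^ 3 := by positivity
          linarith
    have hk1 : (k + 1 : ℝ) ≤ (K₂ * B + 2) * (δ⁻¹ * L) := by
      have a1 := mul_le_mul_of_nonneg_left l2 (show 0 ≤ δ⁻¹ by positivity)
      have a2 := mul_le_mul_of_nonneg_left a1 hK₂.le
      have a3 : L ≤ δ⁻¹ * L := le_mul_of_one_le_left (by linarith) hδi
      linarith
    have hL0 : 0 ≤ L := by linarith
    have := mul_le_mul hn1 hk1 (by positivity) (by positivity)
    linarith
  · rintro i V Y ⟨θ, hθ, α, hα, hV, hc, hcα⟩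
    have hα' : |-α| ≤ Real.pi / 2 := by rw [abs_neg]; exact abs_le.2 hα
    have hr := norm_halfPhaseWord_sub_le (hψ α θ hθ hc)
      (hφ (-α) hα' (by rw [Real.cos_neg]; exact hcα.1))
    have hr' := norm_correctionWord_sub_le hr
    rw [wordCircuit_mat, hV, signal_of_twist hθ]
    refine Sim.of_norm_sub_le (evalWord_mem (twist_mem α θ) _) (rotX_mem θ) (hr'.trans ?_)
    have : n * (ε / (8 * (n + 1))) ≤ ε / 8 := by
      have hn0 : (0 : ℝ) < n + 1 := by positivity
      rw [← mul_div_assoc, div_le_div_iff₀ (by positivity) (by positivity)]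
      nlinarith
    linarith
  · refine ⟨_, ?_, wordCircuit_mat i _ V Y⟩
    rw [evalWord_correctionWord hV.fixed]
    exact isReversible_mul_mul_reversal (evalWord_mem hV.1 _) hV

end QGadget
end

noncomputable section

namespace QGadget

open scoped Matrix.Norms.L2Operator

/-! ## Antisymmetric protocols -/

lemma det_rotZ (x : ℝ) : (rotZ x).det = 1 := by
  rw [rotZ_eq_quat, det_quat, normSq_exp_I_mul]
  simp

/-- Regroups a protocol so that it can be read from the right, as reversal does. -/
lemma mul_prod_ofFn_shift {M : Type*} [Monoid M] {n : ℕ} (a : Fin (n + 1) → M) (u : Fin n → M) :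
    a 0 * (List.ofFn fun k => u k * a k.succ).prod =
      (List.ofFn fun k => a k.castSucc * u k).prod * a (Fin.last n) := by
  induction n with
  | zero => simp
  | succ n ih =>
    have h := ih (fun k => a k.succ) fun k => u k.succ
    rw [List.ofFn_succ, List.ofFn_succ, List.prod_cons, List.prod_cons, mul_assoc (a _ * u _)]
    simp only [Fin.succ_last, ← Fin.succ_castSucc] at h ⊢
    rw [← h]
    simp [mul_assoc]

lemma reversal_list_prod (l : List Mat2) : reversal l.prod = (l.reverse.map reversal).prod := by
  induction l with
  | nil => simp [reversal_one]
  | cons A l ih => simp [reversal_mul, ih]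

lemma reversal_prod_ofFn {n : ℕ} (f : Fin n → Mat2) :
    reversal (List.ofFn f).prod = (List.ofFn fun k => reversal (f k.rev)).prod := by
  have h : (List.ofFn f).reverse.map reversal = List.ofFn fun k => reversal (f k.rev) := by
    apply List.ext_getElem
    · simp
    · intro i h1 h2
      simp only [List.length_map, List.length_reverse, List.length_ofFn] at h1
      simp only [List.getElem_map, List.getElem_reverse, List.getElem_ofFn, List.length_ofFn]
      congr 2
      ext
      simp only [Fin.val_rev]
      omega
  rw [reversal_list_prod, h]

/-- The anti-automorphism reverses the order, fixes the inputs and negates the phases; antisymmetry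
says that this restores the protocol. -/
lemma isReversible_eval {t : ℕ} {Φ : MQSP t} (h : Φ.IsAntisymmetric) {U : Fin t → Mat2}
    (hU : ∀ k, IsReversible (U k)) : IsReversible (Φ.eval U) := by
  refine ⟨mul_mem (rotZ_mem _) (list_prod_mem fun X hX => ?_), ?_, ?_⟩
  · obtain ⟨k, rfl⟩ := (List.mem_ofFn' _ _).1 hX
    exact mul_mem (hU _).mem (rotZ_mem _)
  · have hd : ∀ l : List Mat2, (∀ X ∈ l, X.det = 1) → l.prod.det = 1 := by
      intro l hl
      induction l with
      | nil => simp
      | cons X l ih =>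
        rw [List.prod_cons, Matrix.det_mul, hl X (by simp), one_mul]
        exact ih fun Y hY => hl Y (by simp [hY])
    rw [MQSP.eval, Matrix.det_mul, det_rotZ, one_mul]
    refine hd _ fun X hX => ?_
    obtain ⟨k, rfl⟩ := (List.mem_ofFn' _ _).1 hX
    rw [Matrix.det_mul, (hU _).det, det_rotZ, one_mul]
  · rw [MQSP.eval, mul_prod_ofFn_shift (fun k => rotZ (Φ.phase k)) fun k => U (Φ.label k),
      reversal_mul, reversal_prod_ofFn, reversal_rotZ,
      ← mul_prod_ofFn_shift (fun k => rotZ (Φ.phase k)) fun k => U (Φ.label k)]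
    congr 2
    · rw [← h.1 0, Fin.rev_zero]
    · congr 1
      funext k
      rw [reversal_mul, (hU _).fixed, reversal_rotZ, h.2, ← h.1 k.succ, Fin.rev_succ]

/-! ## Realization by nearby operators -/

lemma norm_eq_norm_act (K : Mat2) : ‖K‖ = ‖act K‖ := Matrix.cstar_norm_def K

lemma norm_apply_le (K : Mat2) (i j : Fin 2) : ‖K i j‖ ≤ ‖K‖ := by
  have h := (act K).le_opNorm (EuclideanSpace.single j 1)
  rw [PiLp.norm_single, norm_one, mul_one, ← norm_eq_norm_act] at h
  refine le_trans ?_ h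
  refine le_trans (le_of_eq ?_) (PiLp.norm_apply_le (act K (EuclideanSpace.single j 1)) i)
  rw [act, Matrix.ofLp_toEuclideanCLM]
  simp

lemma norm_act_of_mem {V : Mat2} (hV : V ∈ Matrix.unitaryGroup (Fin 2) ℂ)
    (ψ : EuclideanSpace ℂ (Fin 2)) : ‖act V ψ‖ = ‖ψ‖ := by
  have hle : ∀ U ∈ Matrix.unitaryGroup (Fin 2) ℂ, ∀ χ, ‖act U χ‖ ≤ ‖χ‖ := fun U hU χ =>
    ((act U).le_opNorm χ).trans (mul_le_of_le_one_left (norm_nonneg _)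
      ((norm_eq_norm_act U).symm.le.trans (norm_le_one_of_mem hU)))
  refine le_antisymm (hle V hV ψ) ?_
  have h : act (star V) (act V ψ) = ψ := by
    rw [← mul_apply_eq_comp, act, act, ← map_mul, Matrix.mem_unitaryGroup_iff'.1 hV,
      map_one, one_apply_eq_self]
  calc ‖ψ‖ = ‖act (star V) (act V ψ)‖ := by rw [h]
    _ ≤ _ := hle _ (Unitary.star_mem hV) _

lemma norm_act_sub_le {K V : Mat2} {r : ℝ} (h : ‖K - V‖ ≤ r) {ψ : EuclideanSpace ℂ (Fin 2)}
    (hψ : ‖ψ‖ = 1) : ‖act K ψ - act V ψ‖ ≤ r := by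
  have e : act K ψ - act V ψ = act (K - V) ψ := by
    rw [act, act, act, map_sub, sub_apply]
  rw [e]
  have h1 := (act (K - V)).le_opNorm ψ
  rw [hψ, mul_one, ← norm_eq_norm_act] at h1
  exact h1.trans h

lemma abs_norm_act_sub_one_le {K V : Mat2} {r : ℝ} (hV : V ∈ Matrix.unitaryGroup (Fin 2) ℂ)
    (h : ‖K - V‖ ≤ r) {ψ : EuclideanSpace ℂ (Fin 2)} (hψ : ‖ψ‖ = 1) :
    |‖act K ψ‖ - 1| ≤ r := by
  have h1 := abs_norm_sub_norm_le (act K ψ) (act V ψ)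
  rw [norm_act_of_mem hV, hψ] at h1
  exact h1.trans (norm_act_sub_le h hψ)

/-- The hypothesis is `ε / 2` because normalization doubles the error: `‖Kψ‖` is within `ε / 2` of
one, so normalizing moves the state by at most another `ε / 2`. -/
lemma approxRealizes_of_norm_sub_le {ε p h : ℝ} {K V : Mat2} (hε : 0 < ε) (hε1 : ε ≤ 1)
    (hV : IsTwistedEmbeddable V) (hV0 : V 0 0 = h) (hKV : ‖K - V‖ ≤ ε / 2)
    (hp : ∀ ψ : EuclideanSpace ℂ (Fin 2), ‖ψ‖ = 1 → p ≤ ‖act K ψ‖ ^ 2) :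
    ApproxRealizes ε p h K := by
  refine ⟨?_, V, hV, hV0, ?_, fun ψ hψ => ⟨hp ψ hψ, ?_⟩⟩
  · rw [← hV0, ← Matrix.sub_apply]
    linarith [norm_apply_le (K - V) 0 0]
  · rw [opDist, ← norm_eq_norm_act]
    linarith
  · have h1 := abs_norm_act_sub_one_le hV.isReversible.mem hKV hψ
    have h2 := norm_act_sub_le hKV hψ
    have h0 : 0 < ‖act K ψ‖ := by linarith [(abs_le.1 h1).1]
    have h3 : ‖((‖act K ψ‖⁻¹ : ℝ) : ℂ) • act K ψ - act K ψ‖ ≤ ε / 2 := by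
      have e : ((‖act K ψ‖⁻¹ : ℝ) : ℂ) • act K ψ - act K ψ =
          ((‖act K ψ‖⁻¹ - 1 : ℝ) : ℂ) • act K ψ := by
        push_cast
        rw [sub_smul, one_smul]
      rw [e, norm_smul, Complex.norm_real, Real.norm_eq_abs, ← abs_of_pos h0, ← abs_mul,
        abs_of_pos h0, sub_mul, inv_mul_cancel₀ h0.ne', one_mul, abs_sub_comm]
      exact h1
    calc _ ≤ _ := norm_sub_le_norm_sub_add_norm_sub _ (act K ψ) _
      _ ≤ ε := by linarith

/-- In general `‖Kψ‖ ≥ 1 - ε / 2`. Without ancillas nothing is measured and `K` is exactly unitary.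
-/
lemma successProb_le {ε : ℝ} {K V : Mat2} (hε : 0 < ε) (hε1 : ε ≤ 1)
    (hV : V ∈ Matrix.unitaryGroup (Fin 2) ℂ) (hKV : ‖K - V‖ ≤ ε / 2) {mode : Correction}
    (hK : mode = .ancillaFree → K ∈ Matrix.unitaryGroup (Fin 2) ℂ)
    (ψ : EuclideanSpace ℂ (Fin 2)) (hψ : ‖ψ‖ = 1) :
    mode.successProb ε ≤ ‖act K ψ‖ ^ 2 := by
  have h1 := (abs_le.1 (abs_norm_act_sub_one_le hV hKV hψ)).1
  have h2 : (1 - ε) ^ 2 ≤ ‖act K ψ‖ ^ 2 := pow_le_pow_left₀ (by linarith) (by linarith) 2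
  cases mode with
  | controlledAccess => exact h2
  | uncontrolledAccess => exact h2
  | ancillaFree => rw [norm_act_of_mem (hK rfl), hψ, one_pow]; rfl

/-! ## Circuits for protocols -/

section Protocol

variable {m e c : ℕ} {υ : Type}

/-- The circuit that runs a protocol, with a circuit for each oracle. -/
def protocolCircuit (Φ : MQSP c) (b : Fin c → Circuit m e υ) : Circuit m e υ :=
  [Step.gate 0 (rotZGate (Φ.phase 0))] ++
    (List.ofFn fun k => b (Φ.label k) ++ [Step.gate 0 (rotZGate (Φ.phase k.succ))]).flatten

lemma Circuit.mat_flatten (l : List (Circuit m e υ)) (V : Fin e → Mat2) (Y : υ → Mat2) :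
    Circuit.mat l.flatten V Y = (l.map fun P => P.mat V Y).prod := by
  induction l with
  | nil => rfl
  | cons P l ih => rw [List.flatten_cons, Circuit.mat_append, ih, List.map_cons, List.prod_cons]

lemma protocolCircuit_mat (Φ : MQSP c) (b : Fin c → Circuit m e υ) (V : Fin e → Mat2)
    (Y : υ → Mat2) : (protocolCircuit Φ b).mat V Y = onQubit 0 (rotZ (Φ.phase 0)) *
      (List.ofFn fun k => (b (Φ.label k)).mat V Y *
        onQubit 0 (rotZ (Φ.phase k.succ))).prod := by
  rw [protocolCircuit, Circuit.mat_append, Circuit.mat_flatten, List.map_ofFn,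
    Circuit.mat_singleton]
  congr 3
  funext k
  rw [Function.comp_apply, Circuit.mat_append, Circuit.mat_singleton]
  rfl

lemma sim_protocolCircuit (Φ : MQSP c) {b : Fin c → Circuit m e υ} {V : Fin e → Mat2}
    {Y : υ → Mat2} {U : Fin c → Mat2} {r : ℝ} (h : ∀ k, Sim ((b k).mat V Y) (U k) r) :
    Sim ((protocolCircuit Φ b).mat V Y) (Φ.eval U) (Φ.n * r) := by
  rw [protocolCircuit_mat]
  refine ((Sim.onQubit_zero (rotZ_mem _)).mul (Sim.prod_ofFn fun k =>
    ((h (Φ.label k)).mul (Sim.onQubit_zero (rotZ_mem (Φ.phase k.succ)))).mono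
      (add_zero r).le)).mono (zero_add _).le

lemma prod_ofFn_onQubit {n : ℕ} (q : Fin (m + 1)) (f : Fin n → Mat2) :
    (List.ofFn fun k => (onQubit q (f k) : RegMat m)).prod = onQubit q (List.ofFn f).prod := by
  induction n with
  | zero => rw [List.ofFn_zero, List.ofFn_zero]; exact (qmat_one q).symm
  | succ n ih =>
    rw [List.ofFn_succ, List.ofFn_succ, List.prod_cons, List.prod_cons, ih, onQubit_mul]

lemma protocolCircuit_mat_of_onQubit (Φ : MQSP c) {b : Fin c → Circuit m e υ} {V : Fin e → Mat2}
    {Y : υ → Mat2} {U : Fin c → Mat2} (h : ∀ k, (b k).mat V Y = onQubit 0 (U k)) :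
    (protocolCircuit Φ b).mat V Y = onQubit 0 (Φ.eval U) := by
  rw [protocolCircuit_mat]
  simp only [h, onQubit_mul, prod_ofFn_onQubit]
  rfl

lemma Circuit.output_of_mat_eq_onQubit {P : Circuit m e υ} {V : Fin e → Mat2} {Y : υ → Mat2}
    {g : Mat2} (h : P.mat V Y = onQubit 0 g) : P.output V Y = g := by
  rw [Circuit.output_eq, h, onQubit_zero_mul_emb, ← Matrix.mul_assoc,
    emb_conjTranspose_mul_self ket_injective, Matrix.one_mul]

lemma length_protocolCircuit_le (Φ : MQSP c) {b : Fin c → Circuit m e υ} {s : ℝ}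
    (h : ∀ k, ((b k).length : ℝ) ≤ s) :
    ((protocolCircuit Φ b).length : ℝ) ≤ 1 + Φ.n * (s + 1) := by
  rw [protocolCircuit, List.length_append, List.length_singleton, List.length_flatten,
    List.map_ofFn, List.sum_ofFn]
  push_cast
  refine add_le_add le_rfl ?_
  have : ∀ k ∈ Finset.univ, (((List.length ∘ fun k : Fin Φ.n => b (Φ.label k) ++
      [Step.gate 0 (rotZGate (Φ.phase k.succ))]) k : ℕ) : ℝ) ≤ s + 1 := fun k _ => by
    rw [Function.comp_apply, List.length_append, List.length_singleton, Nat.cast_add, Nat.cast_one]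
    exact add_le_add (h _) le_rfl
  refine (Finset.sum_le_card_nsmul _ _ _ this).trans (le_of_eq ?_)
  rw [Finset.card_univ, Fintype.card_fin, nsmul_eq_mul]

lemma protocolCircuit_uncontrolled (Φ : MQSP c) {b : Fin c → Circuit m e υ}
    (h : ∀ k, (b k).Uncontrolled) : (protocolCircuit Φ b).Uncontrolled := by
  intro s hs
  rw [protocolCircuit, List.mem_append, List.mem_singleton, List.mem_flatten] at hs
  rcases hs with rfl | ⟨l, hl, hs⟩
  · rfl
  · obtain ⟨k, rfl⟩ := (List.mem_ofFn' _ _).1 hl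
    rcases List.mem_append.1 hs with hs | hs
    · exact h _ s hs
    · rw [List.mem_singleton.1 hs]; rfl

end Protocol

/-! ## Composites -/

section Composite

variable {b c m : ℕ} (I : Interlink b c)

/-- The circuit for an input leg of the second gadget: the corrected black box, or the oracle. -/
def legCircuit (R : Fin I.e → Circuit m I.e I.FreeIn) (k : Fin c) : Circuit m I.e I.FreeIn :=
  open Classical in
  if h : ∃ i, I.C i = k then R (I.W h.choose) else [Step.query ⟨k, h⟩ 0]

variable {I} {R : Fin I.e → Circuit m I.e I.FreeIn}

lemma length_legCircuit_le {s : ℝ} (hs : 1 ≤ s) (h : ∀ i, ((R i).length : ℝ) ≤ s) (k : Fin c) :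
    ((legCircuit I R k).length : ℝ) ≤ s := by
  rw [legCircuit]
  split_ifs
  · exact h _
  · simpa using hs

lemma legCircuit_uncontrolled (h : ∀ i, (R i).Uncontrolled) (k : Fin c) :
    (legCircuit I R k).Uncontrolled := by
  rw [legCircuit]
  split_ifs
  · exact h _
  · intro s hs
    rw [List.mem_singleton.1 hs]
    rfl

lemma exists_legCircuit_mat_eq {V : Fin I.e → Mat2} {Y : I.FreeIn → Mat2}
    (h : ∀ i, ∃ U, IsReversible U ∧ (R i).mat V Y = onQubit 0 U)
    (hY : ∀ k, IsReversible (Y k)) (k : Fin c) :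
    ∃ U, IsReversible U ∧ (legCircuit I R k).mat V Y = onQubit 0 U := by
  rw [legCircuit]
  split_ifs with hk
  · exact h _
  · exact ⟨_, hY ⟨k, hk⟩, Circuit.mat_singleton _ _ _⟩

lemma isReversible_output_protocolCircuit {Φ : MQSP c} (hΦ : Φ.IsAntisymmetric)
    {V : Fin I.e → Mat2} {Y : I.FreeIn → Mat2}
    (h : ∀ i, ∃ U, IsReversible U ∧ (R i).mat V Y = onQubit 0 U)
    (hY : ∀ k, IsReversible (Y k)) :
    IsReversible ((protocolCircuit Φ (legCircuit I R)).output V Y) := by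
  choose U hU hR using exists_legCircuit_mat_eq h hY
  rw [Circuit.output_of_mat_eq_onQubit (protocolCircuit_mat_of_onQubit Φ hR)]
  exact isReversible_eval hΦ hU

lemma isEmbeddable_signal (x : ℝ) : IsEmbeddable (signal x) :=
  ⟨Real.arccos x, ⟨Real.arccos_nonneg x, Real.arccos_le_pi x⟩, rfl⟩

/-- `legCircuit` and `Interlink.plug` choose the index of a leg of `C` by the same `choose`, so
their case distinctions match. -/
lemma sim_legCircuit {V : Fin I.e → Mat2} {f : Fin b → ℝ} {y : I.FreeIn → ℝ} {r : ℝ}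
    (hr : 0 ≤ r) (h : ∀ i, Sim ((R i).mat V fun k => signal (y k)) (signal (f (I.B i))) r)
    (k : Fin c) :
    Sim ((legCircuit I R k).mat V fun k => signal (y k)) (signal (I.plug f y k)) r := by
  rw [legCircuit, Interlink.plug]
  split_ifs
  · exact h _
  · rw [Circuit.mat_singleton]
    exact (Sim.onQubit_zero (isEmbeddable_signal _).isReversible.mem).mono hr

lemma plug_mem {f : Fin b → ℝ} {y : I.FreeIn → ℝ} {s : Set ℝ} (hf : ∀ i, f (I.B i) ∈ s)
    (hy : ∀ k, y k ∈ s) (k : Fin c) : I.plug f y k ∈ s := by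
  rw [Interlink.plug]
  split_ifs
  · exact hf _
  · exact hy _

lemma IsTwistedEmbeddable.mem_Icc {V : Mat2} (hV : IsTwistedEmbeddable V) {h : ℝ}
    (h0 : V 0 0 = h) : h ∈ Set.Icc (-1 : ℝ) 1 := by
  obtain ⟨θ, -, φ, -, rfl⟩ := hV
  rw [twist_eq_quat] at h0
  have : (Real.cos θ : ℂ) = h := by simpa [quat] using h0
  rw [← Complex.ofReal_inj.1 this]
  exact ⟨Real.neg_one_le_cos θ, Real.cos_le_one θ⟩

end Composite

/-! ### A uniform corrector and the analysis of composites. -/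

lemma third_le_cost (mode : Correction) {ε δ γ : ℝ} (hε : 0 < ε) (hε1 : ε ≤ 1) (hδ : 0 < δ)
    (hδ1 : δ ≤ 1) (hγ : 0 < γ) (hγ1 : γ ≤ 1) : 1 / 3 ≤ mode.cost ε δ γ := by
  cases mode with
  | controlledAccess =>
    exact le_trans (by norm_num) (half_le_ancilla_cost hε hε1 hδ hδ1)
  | uncontrolledAccess =>
    exact le_trans (by norm_num) (half_le_ancilla_cost hε hε1 hδ hδ1)
  | ancillaFree =>
    have hγi : 1 ≤ (γ ^ 2)⁻¹ := (one_le_inv₀ (by positivity)).2 (pow_le_one₀ hγ.le hγ1)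
    have hδi : 1 ≤ δ⁻¹ := (one_le_inv₀ hδ).2 hδ1
    have hL : Real.log 2 ≤ Real.log (2 / (ε * δ * γ)) := by
      refine Real.log_le_log two_pos ?_
      rw [le_div_iff₀ (by positivity)]
      have := mul_le_one₀ (mul_le_one₀ hε1 hδ.le hδ1) hγ.le hγ1
      linarith
    have h2 : (0.6 : ℝ) ^ 2 ≤ Real.log (2 / (ε * δ * γ)) ^ 2 :=
      pow_le_pow_left₀ (by norm_num) (by linarith [Real.log_two_gt_d9]) 2
    calc (1 / 3 : ℝ) ≤ 1 * 1 * (0.6 : ℝ) ^ 2 := by norm_num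
      _ ≤ _ := mul_le_mul (mul_le_mul hδi hγi zero_le_one (by positivity)) h2 (by positivity)
        (by positivity)

/-- A common interface for the three modes with one constant. The bound `1 ≤ K * mode.cost ε δ γ`
pays for the phase gates of a protocol and for legs that are a single oracle query. -/
theorem exists_corrector : ∃ K : ℝ, 0 < K ∧ ∀ (mode : Correction) (ε δ γ : ℝ), 0 < ε → ε ≤ 1 →
    0 < δ → δ ≤ 1 → 0 < γ → γ ≤ 1 → 1 ≤ K * mode.cost ε δ γ ∧
    ∀ (e : ℕ) (υ : Type), ∃ R : Fin e → Circuit mode.ancillas e υ,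
      (mode ≠ .controlledAccess → ∀ i, (R i).Uncontrolled) ∧
      (∀ i, ((R i).length : ℝ) ≤ K * mode.cost ε δ γ) ∧
      (∀ i V Y, mode.Domain δ γ (V i) → Sim ((R i).mat V Y) (signal (V i 0 0).re) (ε / 2)) ∧
      (mode = .ancillaFree → ∀ i V Y, IsReversible (V i) →
        ∃ U, IsReversible U ∧ (R i).mat V Y = onQubit 0 U) := by
  obtain ⟨K₁, hK₁, h₁⟩ := exists_controlled_corrector
  obtain ⟨K₂, hK₂, h₂⟩ := exists_uncontrolled_corrector
  obtain ⟨K₃, hK₃, h₃⟩ := exists_ancillaFree_corrector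
  refine ⟨K₁ + K₂ + K₃ + 3, by positivity, fun mode ε δ γ hε hε1 hδ hδ1 hγ hγ1 => ?_⟩
  have hc := third_le_cost mode hε hε1 hδ hδ1 hγ hγ1
  refine ⟨by nlinarith [mul_le_mul_of_nonneg_left hc (show 0 ≤ K₁ + K₂ + K₃ by positivity)],
    fun e υ => ?_⟩
  cases mode with
  | controlledAccess =>
    obtain ⟨R, hl, hs⟩ := h₁ ε δ γ hε hε1 hδ hδ1 e υ
    exact ⟨R, fun h => absurd rfl h, fun i => (hl i).trans
      (mul_le_mul_of_nonneg_right (by linarith) (by linarith)), hs, nofun⟩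
  | uncontrolledAccess =>
    obtain ⟨R, hu, hl, hs⟩ := h₂ ε δ γ hε hε1 hδ hδ1 e υ
    exact ⟨R, fun _ => hu, fun i => (hl i).trans
      (mul_le_mul_of_nonneg_right (by linarith) (by linarith)), hs, nofun⟩
  | ancillaFree =>
    obtain ⟨R, hu, hl, hs, hr⟩ := h₃ ε δ γ hε hε1 hδ hδ1 hγ hγ1 e υ
    exact ⟨R, fun _ => hu, fun i => (hl i).trans
      (mul_le_mul_of_nonneg_right (by linarith) (by linarith)), hs, fun _ => hr⟩

section Composite

variable {a b c d m : ℕ} {I : Interlink b c} {R : Fin I.e → Circuit m I.e I.FreeIn}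
  {A : AtomicGadget c d}

lemma length_le_maxLength (A : AtomicGadget c d) (k : Fin d) : (A k).n + 1 ≤ A.maxLength :=
  Finset.le_sup (f := fun k => (A k).length) (Finset.mem_univ k)

lemma sum_length_protocolCircuit_le (A : AtomicGadget c d) {s : ℝ} (hs : 1 ≤ s)
    (h : ∀ i, ((R i).length : ℝ) ≤ s) :
    ((∑ k, (protocolCircuit (A k) (legCircuit I R)).length : ℕ) : ℝ) ≤
      2 * (d * A.maxLength * s) := by
  push_cast
  have hk : ∀ k ∈ Finset.univ, ((protocolCircuit (A k) (legCircuit I R)).length : ℝ) ≤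
      A.maxLength * (2 * s) := fun k _ => by
    have h1 := length_protocolCircuit_le (A k) (length_legCircuit_le hs h)
    have h2 : ((A k).n : ℝ) + 1 ≤ A.maxLength := by exact_mod_cast length_le_maxLength A k
    have h3 := mul_le_mul h2 (show s + 1 ≤ 2 * s by linarith) (by linarith) (by positivity)
    linarith
  refine (Finset.sum_le_card_nsmul _ _ _ hk).trans (le_of_eq ?_)
  simp
  ring

lemma isTwistedEmbeddable_compositeOutput (hA : A.IsAntisymmetric)
    (𝔊 : Gadget (Fin a) (Fin b)) (hR : ∀ i V Y, IsReversible (V i) →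
      ∃ U, IsReversible U ∧ (R i).mat V Y = onQubit 0 U)
    (U : Fin a ⊕ I.FreeIn → Mat2) (hU : ∀ i, IsEmbeddable (U i)) (l : Fin d ⊕ I.FreeOut) :
    IsTwistedEmbeddable
      (compositeOutput I (fun k => protocolCircuit (A k) (legCircuit I R)) 𝔊 U l) := by
  have h𝔊 := 𝔊.twisted (fun j => U (Sum.inl j)) fun j => hU _
  rcases l with k | k
  · exact (isReversible_output_protocolCircuit (hA k)
      (fun i => hR i _ _ (h𝔊 (I.B i)).isReversible)
      fun k => (hU (Sum.inr k)).isReversible).isTwistedEmbeddable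
  · exact h𝔊 k

/-- A protocol makes `n < |Ξ|_∞` queries, each replaced with error at most `ε' / 2`, which totals at
most `ε / 2`. Legs that are passed on are exact. -/
lemma approxRealizes_compositeOutput {mode : Correction} {ε ε' δ γ : ℝ} (hε : 0 < ε)
    (hε1 : ε ≤ 1) (hε' : 0 ≤ ε') (hA : A.IsAntisymmetric) (hle : A.maxLength * ε' ≤ ε)
    (hR : ∀ i V Y, mode.Domain δ γ (V i) → Sim ((R i).mat V Y) (signal (V i 0 0).re) (ε' / 2))
    (hR' : mode = .ancillaFree → ∀ i V Y, IsReversible (V i) →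
      ∃ U, IsReversible U ∧ (R i).mat V Y = onQubit 0 U)
    {𝔊 : Gadget (Fin a) (Fin b)} {F : (Fin a → ℝ) → Fin b → ℝ} {G : (Fin c → ℝ) → Fin d → ℝ}
    (hF : Achieves 𝔊.toFun F) (hG : Achieves A.toFun G) {x : Fin a → ℝ} {y : I.FreeIn → ℝ}
    (hx : ∀ i, x i ∈ Set.Icc (-1 : ℝ) 1) (hy : ∀ k, y k ∈ Set.Icc (-1 : ℝ) 1)
    (hD : ∀ i, mode.Domain δ γ (𝔊.toFun (fun j => signal (x j)) (I.B i)))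
    (l : Fin d ⊕ I.FreeOut) :
    ApproxRealizes ε (mode.successProb ε) (I.comp G F x y l)
      (compositeOutput I (fun k => protocolCircuit (A k) (legCircuit I R)) 𝔊
        (fun j => signal (Sum.elim x y j)) l) := by
  have hT := 𝔊.twisted (fun j => signal (x j)) fun j => isEmbeddable_signal _
  have hK : mode = .ancillaFree → compositeOutput I
      (fun k => protocolCircuit (A k) (legCircuit I R)) 𝔊
        (fun j => signal (Sum.elim x y j)) l ∈ Matrix.unitaryGroup (Fin 2) ℂ := fun h =>
    (isTwistedEmbeddable_compositeOutput hA 𝔊 (hR' h) _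
      (fun j => isEmbeddable_signal _) l).isReversible.mem
  rcases l with k | k
  · have hFm : ∀ i, F x (I.B i) ∈ Set.Icc (-1 : ℝ) 1 := fun i => (hT _).mem_Icc (hF x hx _)
    have hrev := isReversible_eval (hA k)
      fun j => (isEmbeddable_signal (I.plug (F x) y j)).isReversible
    have hleg : ∀ i, Sim ((R i).mat (fun i => 𝔊.toFun (fun j => signal (x j)) (I.B i))
        fun k => signal (y k)) (signal (F x (I.B i))) (ε' / 2) := fun i => by
      have h := hR i (fun i => 𝔊.toFun (fun j => signal (x j)) (I.B i)) (fun k => signal (y k))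
        (hD i)
      rwa [hF x hx (I.B i), Complex.ofReal_re] at h
    have hsim := sim_protocolCircuit (A k) (sim_legCircuit (R := R) (by positivity) hleg)
    have hn : (A k).n * (ε' / 2) ≤ ε / 2 := by
      have h1 : ((A k).n : ℝ) + 1 ≤ A.maxLength := by exact_mod_cast length_le_maxLength A k
      have := mul_le_mul_of_nonneg_right h1 hε'
      linarith
    have hle := hsim.norm_output_sub_le.trans hn
    exact approxRealizes_of_norm_sub_le hε hε1 hrev.isTwistedEmbeddable
      (hG _ (plug_mem hFm hy) k) hle (successProb_le hε hε1 hrev.mem hle hK)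
  · have h0 : ‖𝔊.toFun (fun j => signal (x j)) k - 𝔊.toFun (fun j => signal (x j)) k‖ ≤ ε / 2 := by
      rw [sub_self, norm_zero]
      positivity
    exact approxRealizes_of_norm_sub_le hε hε1 (hT k) (hF x hx k) h0
      (successProb_le hε hε1 (hT k).isReversible.mem h0 hK)

end Composite

end QGadget
end

/-! ### The main theorem. -/

theorem mainTheorem2 :
    ∃ K : ℝ, 0 < K ∧
      ∀ (mode : QGadget.Correction) (b c d : ℕ) (A : QGadget.AtomicGadget c d),
        A.IsAntisymmetric →
      ∀ (I : QGadget.Interlink b c) (ε δ γ : ℝ),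
        0 < ε → ε ≤ 1 → 0 < δ → δ ≤ 1 → 0 < γ → γ ≤ 1 →
      ∃ P : Fin d → QGadget.Circuit mode.ancillas I.e I.FreeIn,
        (mode ≠ QGadget.Correction.controlledAccess → ∀ k, (P k).Uncontrolled) ∧
        ((∑ k, (P k).calls : ℕ) : ℝ)
          ≤ K * (d * A.maxLength * mode.cost (ε / A.maxLength) δ γ) ∧
        ((∑ k, (P k).size : ℕ) : ℝ)
          ≤ K * (d * A.maxLength * mode.cost (ε / A.maxLength) δ γ) ∧
        ∀ (a : ℕ) (𝔊 : QGadget.Gadget (Fin a) (Fin b))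
          (F : (Fin a → ℝ) → Fin b → ℝ) (G : (Fin c → ℝ) → Fin d → ℝ),
          QGadget.Achieves 𝔊.toFun F → QGadget.Achieves A.toFun G →
          (mode = QGadget.Correction.ancillaFree →
            ∃ 𝔊' : QGadget.Gadget (Fin a ⊕ I.FreeIn) (Fin d ⊕ I.FreeOut),
              𝔊'.toFun = QGadget.compositeOutput I P 𝔊) ∧
          ∀ (x : Fin a → ℝ) (y : I.FreeIn → ℝ),
            (∀ i, x i ∈ Set.Icc (-1 : ℝ) 1) → (∀ k, y k ∈ Set.Icc (-1 : ℝ) 1) →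
            (∀ i, mode.Domain δ γ (𝔊.toFun (fun j => QGadget.signal (x j)) (I.B i))) →
            ∀ l, QGadget.ApproxRealizes ε (mode.successProb ε) (I.comp G F x y l)
              (QGadget.compositeOutput I P 𝔊
                (fun j => QGadget.signal (Sum.elim x y j)) l) := by
  obtain ⟨K, hK, h⟩ := QGadget.exists_corrector
  refine ⟨2 * K, by positivity, fun mode b c d A hA I ε δ γ hε hε1 hδ hδ1 hγ hγ1 => ?_⟩
  -- For `d = 0` the maximal length is the empty supremum `0`, and `ε / 0 = 0` would not be an
  -- admissible precision. For `d > 0` it is at least `1` and equals `L`.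
  set L : ℝ := max 1 A.maxLength with hL
  have hL1 : 1 ≤ L := le_max_left _ _
  have hε' : 0 < ε / L := by positivity
  obtain ⟨hs, hR⟩ := h mode (ε / L) δ γ hε' ((div_le_self hε.le hL1).trans hε1) hδ hδ1 hγ hγ1
  obtain ⟨R, hu, hl, hsim, hrev⟩ := hR I.e I.FreeIn
  have hsum := QGadget.sum_length_protocolCircuit_le A hs hl
  have hsize : ((∑ k, (QGadget.protocolCircuit (A k) (QGadget.legCircuit I R)).size : ℕ) : ℝ)
      ≤ 2 * K * (d * A.maxLength * mode.cost (ε / A.maxLength) δ γ) := by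
    rcases Nat.eq_zero_or_pos d with rfl | hd
    · simp
    · have hLA : L = A.maxLength := max_eq_right (by
        exact_mod_cast (Nat.le_add_left 1 _).trans (QGadget.length_le_maxLength A ⟨0, hd⟩))
      rw [hLA] at hsum
      exact hsum.trans (by linarith)
  refine ⟨fun k => QGadget.protocolCircuit (A k) (QGadget.legCircuit I R),
    fun hm k => QGadget.protocolCircuit_uncontrolled _ (QGadget.legCircuit_uncontrolled (hu hm)),
    le_trans ?_ hsize, hsize, fun a 𝔊 F G hF hG => ⟨fun hm =>
      ⟨⟨_, QGadget.isTwistedEmbeddable_compositeOutput hA 𝔊 (hrev hm)⟩, rfl⟩,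
      fun x y hx hy hD l => QGadget.approxRealizes_compositeOutput hε hε1 hε'.le hA ?_ hsim hrev
        hF hG hx hy hD l⟩⟩
  · exact_mod_cast Finset.sum_le_sum fun k _ => List.countP_le_length
  · rw [← mul_div_assoc, div_le_iff₀ (by positivity), mul_comm]
    exact mul_le_mul_of_nonneg_left (le_max_right _ _) hε.le
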